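/- Let $N\ge 1$ and $1<p<\infty$. On $\mathbb R^N$ let $\phi_N(x)=(2\pi)^{-N/2}e^{-|x|^2/2}$ and $d\gamma_N=\phi_N\,dx$. For an open set $\Omega\subset\mathbb R^N$, let $W^{1,p}(\Omega,\phi_N)$ be the set of $\psi\in W^{1,1}_{loc}(\Omega)$ with $\psi,|D\psi|\in L^p(\Omega,\phi_N)$, normed by $\|\psi\|_{L^p(\Omega,\phi_N)}+\|D\psi\|_{L^p(\Omega,\phi_N)}$, and let $W_0^{1,p}(\Omega,\phi_N)$ be the closure of $C_0^\infty(\Omega)$ in it. Put $$\lambda_1(\Omega)=\inf_{w\in W_0^{1,p}(\Omega,\phi_N)\setminus\{0\}}\frac{\int_\Omega|Dw|^p\,d\gamma_N}{\int_\Omega|w|^p\,d\gamma_N}.$$ An eigenfunction corresponding to $\lambda$ on $\Omega$ is a non-zero weak solution $u\in W_0^{1,p}(\Omega,\phi_N)$ of $$-\operatorname{div}\bigl(\phi_N|Du|^{p-2}Du\bigr)=\lambda\,\phi_N|u|^{p-2}u\quad\text{in }\Omega. \qquad (*)$$ For $t\in\mathbb R$ let $H_t=\{x\in\mathbb R^N: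 x_1<t\}$. 1. For every $t\in\mathbb R$ the infimum $\lambda_1(H_t)$ is attained, and there is a function $u_1=u_1(x_1)$, depending only on $x_1$, continuous on $(-\infty,t]$ and positive on $(-\infty,t)$, which is an eigenfunction corresponding to $\lambda_1(H_t)$ on $H_t$; as a function of one variable, it is also an eigenfunction of the one-dimensional problem $$-\bigl(|u'|^{p-2}u'\phi_1\bigr)'=\lambda_1(H_t)\,|u|^{p-2}u\,\phi_1\ \text{ in }(-\infty,t),\qquad u\in W_0^{1,p}((-\infty,t),\phi_1). \qquad (**)$$ Moreover $\lambda_1(H_t)$ is simple: every weak solution $u \in W_0^{1,p}(H_t,\phi_N)$ of $(*)$ with $\Omega=H_t$ and $\lambda=\lambda_1(H_t)$ is of the form $u=\beta u_1$ a.e. with $\beta\in\mathbb R$, and likewise every weak solution of $(**)$ is of the form $u=\beta u_1$ a.e. with $\beta\in\mathbb R$. 2. The map $t\mapsto\lambda_1(H_t)$ is strictly decreasing on $\mathbb R$. 3. Let $t\in\mathbb R$ and let $u=u(x_1)$ be the positive eigenfunction corresponding to $\lambda_1(H_t)$ on $H_t$ with $\|u\|_{L^p(H_t,\phi_N)}=1$,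 taken continuous on $(-\infty,t]$ as a function of $x_1$. Then $u$ is of class $C^1$ on $(-\infty,t]$ (with one-sided derivative at $t$), $s\mapsto\lambda_1(H_s)$ is differentiable at $t$, and $$\frac{d}{ds}\lambda_1(H_s)\Big|_{s=t}=-(p-1)\,|u'(t)|^p\,\phi_1(t).$$ -/

import Mathlib

open MeasureTheory Set
open scoped ContDiff

noncomputable section

namespace GaussP

section General

variable {E : Type*} [NormedAddCommGroup E] [InnerProductSpace ℝ E] [CompleteSpace E]
  [MeasureSpace E] [BorelSpace E]

/-- The standard Gaussian density `φ_N(x) = (2π)^(-N/2) exp(-|x|²/2)`, `N = dim E`.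
For `E = ℝ` this is `φ_1`. -/
def gaussDensity (x : E) : ℝ :=
  (2 * Real.pi) ^ (-(Module.finrank ℝ E : ℝ) / 2) * Real.exp (-‖x‖ ^ 2 / 2)

/-- The Gaussian measure `dγ_N = φ_N dx`. -/
def gaussMeasure (E : Type*) [NormedAddCommGroup E] [InnerProductSpace ℝ E]
    [MeasureSpace E] : Measure E :=
  (volume : Measure E).withDensity fun x => ENNReal.ofReal (gaussDensity x)

/-- `ψ ∈ C_0^∞(Ω)`. -/
def IsTestFunction (Ω : Set E) (ψ : E → ℝ) : Prop :=
  ContDiff ℝ ∞ ψ ∧ HasCompactSupport ψ ∧ tsupport ψ ⊆ Ω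

/-- `u ∈ W^{1,1}_loc(Ω)` with weak gradient `Du = G`. -/
def HasWeakGradient (Ω : Set E) (u : E → ℝ) (G : E → E) : Prop :=
  LocallyIntegrableOn u Ω volume ∧ LocallyIntegrableOn G Ω volume ∧
    ∀ ψ : E → ℝ, IsTestFunction Ω ψ →
      ∫ x in Ω, u x • gradient ψ x = -∫ x in Ω, ψ x • G x

/-- `u ∈ W^{1,p}(Ω, φ_N)` with weak gradient `Du = G`. -/
def MemW (p : ℝ) (Ω : Set E) (u : E → ℝ) (G : E → E) : Prop :=
  HasWeakGradient Ω u G ∧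
    MemLp u (ENNReal.ofReal p) ((gaussMeasure E).restrict Ω) ∧
    MemLp G (ENNReal.ofReal p) ((gaussMeasure E).restrict Ω)

/-- `u ∈ W_0^{1,p}(Ω, φ_N)` with weak gradient `Du = G`: `u` lies in the closure of
`C_0^∞(Ω)` for the norm `‖u‖_{L^p(Ω,φ_N)} + ‖Du‖_{L^p(Ω,φ_N)}` of `W^{1,p}(Ω, φ_N)`. -/
def MemW0 (p : ℝ) (Ω : Set E) (u : E → ℝ) (G : E → E) : Prop :=
  MemW p Ω u G ∧ ∀ ε : ENNReal, 0 < ε → ∃ ψ : E → ℝ, IsTestFunction Ω ψ ∧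
    eLpNorm (fun x => u x - ψ x) (ENNReal.ofReal p) ((gaussMeasure E).restrict Ω) +
      eLpNorm (fun x => G x - gradient ψ x) (ENNReal.ofReal p)
        ((gaussMeasure E).restrict Ω) < ε

/-- The values `‖Dw‖_p^p / ‖w‖_p^p` of the Rayleigh quotient, `w ∈ W_0^{1,p}(Ω, φ_N) \ {0}`. -/
def rayleighValues (p : ℝ) (Ω : Set E) : Set ℝ :=
  {r | ∃ (w : E → ℝ) (G : E → E), MemW0 p Ω w G ∧
    ¬ w =ᵐ[(gaussMeasure E).restrict Ω] 0 ∧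
    r = (∫ x in Ω, ‖G x‖ ^ p ∂gaussMeasure E) / ∫ x in Ω, |w x| ^ p ∂gaussMeasure E}

/-- The first eigenvalue `λ_1(Ω)` of the Gaussian `p`-Laplacian with Dirichlet condition. -/
def lambda1 (p : ℝ) (Ω : Set E) : ℝ := sInf (rayleighValues p Ω)

/-- `u ∈ W_0^{1,p}(Ω, φ_N)` solves `-div(φ_N |Du|^{p-2} Du) = l φ_N |u|^{p-2} u` weakly in `Ω`.
(For `p < 2`, the convention `0 ^ (p - 2) = 0` gives `|ξ|^{p-2} ξ` its usual value `0` at `0`.) -/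
def IsWeakSolution (p : ℝ) (Ω : Set E) (l : ℝ) (u : E → ℝ) : Prop :=
  ∃ G : E → E, MemW0 p Ω u G ∧
    ∀ (ψ : E → ℝ) (Ψ : E → E), MemW0 p Ω ψ Ψ →
      ∫ x in Ω, ‖G x‖ ^ (p - 2) * inner ℝ (G x) (Ψ x) ∂gaussMeasure E =
        l * ∫ x in Ω, |u x| ^ (p - 2) * u x * ψ x ∂gaussMeasure E

/-- A weak solution that is not (almost everywhere) zero. -/
def IsEigenfunction (p : ℝ) (Ω : Set E) (l : ℝ) (u : E → ℝ) : Prop :=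
  IsWeakSolution p Ω l u ∧ ¬ u =ᵐ[(gaussMeasure E).restrict Ω] 0

end General

/-- `H_t = {x ∈ ℝ^N : x_1 < t}`; the coordinate `x_1` is `x 0`. -/
def halfSpace (N : ℕ) [NeZero N] (t : ℝ) : Set (EuclideanSpace ℝ (Fin N)) :=
  {x | x 0 < t}

end GaussP

end

open GaussP

open GaussP

noncomputable section

/-! A positive decreasing solution u of the one-dimensional equation is encoded by q =
(-u'/u)^(p-1), which turns the equation into the first-order Riccati equation q' = l + s q + (p-1)
q^(p/(p-1)). Multiplying q by the Gaussian weight removes the drift s q and leaves a monotone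
integral equation on the half-line, whose least solution `flux` exists in [0, ∞] for every l without
any estimate. The parameter l is admissible for t when this solution is finite before t, and
`threshold` is the largest admissible l. At the threshold the solution must explode exactly at t
(`isBlowup_threshold`), because a solution bounded up to t would tolerate a slightly larger l
(`flux_add_le`). Integrating q back gives a profile that is positive on (-∞, t), vanishes at t and
has a non-zero slope there.

The variational statements all come from Picone's identity. For a test function ψ, the quantity
∫|Dψ|^p - l∫|ψ|^p equals the integral of the convexity gap of |·|^p between Dψ and -(q^(1/(p-1)) ψ)
e, where q is evaluated at ⟨e, x⟩. It is therefore nonnegative, and density carries the inequality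
to W₀ (`IsBlowup.picone_memW0`). By Fatou, equality forces Dv = -(q^(1/(p-1)) v) e almost
everywhere, so v divided by the profile has zero weak gradient and is constant. Hence a blow-up
solution at t can exist only for l = λ₁, whatever the dimension; the infimum is attained and simple,
and no compact embedding is needed. Working with a unit vector e treats the half-space and the
half-line at once.

Strict monotonicity holds because an equal threshold at s < t would make the same least solution
both explode and stay finite at s. For the derivative, the eigenfunction of t translated to τ is a
competitor for τ (`threshold_mul_le`), which bounds the difference quotient on one side; exchanging
t and τ bounds it on the other. The threshold and the eigenfunctions depend continuously on τ, so
both bounds have the same limit, a weighted integral of |u'|^p - λ u^p that Pohozaev's identity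
(`integral_groundGap_mul`) reduces to the boundary term at t. -/

namespace GaussP

open Filter Topology

set_option linter.unusedSectionVars false

/-! ### Integration by parts, Gaussian integrability, and functions with zero weak gradient -/

section Analysis

variable {E : Type*} [NormedAddCommGroup E] [InnerProductSpace ℝ E] [CompleteSpace E]
  [FiniteDimensional ℝ E] [MeasureSpace E] [BorelSpace E] [(volume : Measure E).IsAddHaarMeasure]

/-- The open half-space `{x | ⟪e, x⟫ < t}`. -/
def openHalfSpace (e : E) (t : ℝ) : Set E := {x | inner ℝ e x < t}

theorem mem_openHalfSpace {e x : E} {t : ℝ} : x ∈ openHalfSpace e t ↔ inner ℝ e x < t := Iff.rfl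

theorem isOpen_openHalfSpace (e : E) (t : ℝ) : IsOpen (openHalfSpace e t) :=
  isOpen_lt (by fun_prop) continuous_const

theorem convex_openHalfSpace (e : E) (t : ℝ) : Convex ℝ (openHalfSpace e t) :=
  convex_halfSpace_lt (innerSL ℝ e).isLinear t

theorem continuous_mul_of_tsupport_subset {Ω : Set E} {ψ a : E → ℝ} (hΩ : IsOpen Ω)
    (hψ : Continuous ψ) (hs : tsupport ψ ⊆ Ω) (ha : ContinuousOn a Ω) :
    Continuous fun x => ψ x * a x := by
  rw [continuous_iff_continuousAt]
  intro x
  by_cases hx : x ∈ tsupport ψ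
  · exact hψ.continuousAt.mul (ha.continuousAt (hΩ.mem_nhds (hs hx)))
  · have : (fun x => ψ x * a x) =ᶠ[𝓝 x] fun _ => 0 := by
      filter_upwards [notMem_tsupport_iff_eventuallyEq.1 hx] with y hy
      simp [hy]
    exact continuousAt_const.congr this.symm

theorem eq_zero_of_hasLineDerivAt_of_notMem_tsupport {ψ ψ' : E → ℝ} {v x : E}
    (hψ : HasLineDerivAt ℝ ψ (ψ' x) x v) (hx : x ∉ tsupport ψ) : ψ' x = 0 := by
  have h0 : ψ =ᶠ[𝓝 x] fun _ => 0 := notMem_tsupport_iff_eventuallyEq.1 hx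
  have h1 := hψ.congr_of_eventuallyEq h0.symm
  have h2 : HasLineDerivAt ℝ (fun _ : E => (0 : ℝ)) 0 x v := by
    simpa using (hasFDerivAt_const (𝕜 := ℝ) (0 : ℝ) x).hasLineDerivAt v
  exact h1.unique h2

/-- Integration by parts against a compactly supported `C¹` function. -/
theorem setIntegral_mul_lineDeriv_eq_neg {Ω : Set E} {ψ ψ' a a' : E → ℝ} {v : E} (hΩ : IsOpen Ω)
    (hc : HasCompactSupport ψ) (hs : tsupport ψ ⊆ Ω) (hψ : Continuous ψ) (hψ' : Continuous ψ')
    (hd : ∀ x, HasLineDerivAt ℝ ψ (ψ' x) x v) (ha : ContinuousOn a Ω) (ha' : ContinuousOn a' Ω)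
    (had : ∀ x ∈ Ω, HasLineDerivAt ℝ a (a' x) x v) :
    IntegrableOn (fun x => ψ x * a' x) Ω ∧ IntegrableOn (fun x => ψ' x * a x) Ω ∧
    ∫ x in Ω, ψ x * a' x = -∫ x in Ω, ψ' x * a x := by
  have hz' : ∀ x, x ∉ tsupport ψ → ψ' x = 0 := fun x hx =>
    eq_zero_of_hasLineDerivAt_of_notMem_tsupport (hd x) hx
  have hz : ∀ x, x ∉ tsupport ψ → ψ x = 0 := fun x hx => image_eq_zero_of_notMem_tsupport hx
  have hsub' : tsupport ψ' ⊆ tsupport ψ :=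
    closure_minimal (fun x hx => by by_contra h; exact hx (hz' x h)) (isClosed_tsupport ψ)
  have hc' : HasCompactSupport ψ' := hc.of_isClosed_subset (isClosed_tsupport _) hsub'
  have i1 : Integrable fun x => ψ x * a' x :=
    (continuous_mul_of_tsupport_subset hΩ hψ hs ha').integrable_of_hasCompactSupport hc.mul_right
  have i2 : Integrable fun x => ψ' x * a x :=
    (continuous_mul_of_tsupport_subset hΩ hψ' (hsub'.trans hs)
      ha).integrable_of_hasCompactSupport hc'.mul_right
  have i3 : Integrable fun x => ψ x * a x :=
    (continuous_mul_of_tsupport_subset hΩ hψ hs ha).integrable_of_hasCompactSupport hc.mul_right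
  refine ⟨i1.integrableOn, i2.integrableOn, ?_⟩
  rw [setIntegral_eq_integral_of_forall_compl_eq_zero (fun x hx => by
      rw [hz x fun h => hx (hs h), zero_mul]),
    setIntegral_eq_integral_of_forall_compl_eq_zero (fun x hx => by
      rw [hz' x fun h => hx (hs h), zero_mul])]
  exact integral_bilinear_hasLineDerivAt_right_eq_neg_left_of_integrable
    (B := ContinuousLinearMap.mul ℝ ℝ) (v := v) i2 i1 i3 (fun x _ => hd x)
    (fun x hx => had x (hs hx))

theorem gaussDensity_pos (x : E) : 0 < gaussDensity x := by
  unfold gaussDensity; positivity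

theorem continuous_gaussDensity : Continuous (gaussDensity : E → ℝ) := by
  unfold gaussDensity; fun_prop

theorem hasLineDerivAt_gaussDensity (x v : E) :
    HasLineDerivAt ℝ (gaussDensity : E → ℝ) (-inner ℝ v x * gaussDensity x) x v := by
  unfold HasLineDerivAt gaussDensity
  have h1 : HasDerivAt (fun τ : ℝ => -‖x + τ • v‖ ^ 2 / 2) (-inner ℝ v x) 0 := by
    have h0 : HasDerivAt (fun τ : ℝ => x + τ • v) v 0 := by
      simpa using ((hasDerivAt_id (0 : ℝ)).smul_const v).const_add x
    have := (h0.norm_sq.neg).div_const 2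
    refine this.congr_deriv ?_
    rw [zero_smul, add_zero, real_inner_comm]; ring
  have h2 := (h1.exp).const_mul ((2 * Real.pi) ^ (-(Module.finrank ℝ E : ℝ) / 2))
  refine h2.congr_deriv ?_
  rw [zero_smul, add_zero]; ring

theorem setIntegral_gaussMeasure {F : Type*} [NormedAddCommGroup F] [NormedSpace ℝ F]
    {Ω : Set E} (hΩ : MeasurableSet Ω) (f : E → F) :
    ∫ x in Ω, f x ∂gaussMeasure E = ∫ x in Ω, gaussDensity x • f x := by
  unfold gaussMeasure
  rw [setIntegral_withDensity_eq_setIntegral_toReal_smul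
    (continuous_gaussDensity.measurable.ennreal_ofReal) (by simp) _ hΩ]
  simp [ENNReal.toReal_ofReal (gaussDensity_pos _).le]

theorem gaussMeasure_absolutelyContinuous : gaussMeasure E ≪ (volume : Measure E) :=
  withDensity_absolutelyContinuous _ _

theorem absolutelyContinuous_gaussMeasure : (volume : Measure E) ≪ gaussMeasure E :=
  withDensity_absolutelyContinuous'
    (continuous_gaussDensity.measurable.ennreal_ofReal.aemeasurable)
    (ae_of_all _ fun x => by simpa using gaussDensity_pos x)

theorem ae_gaussMeasure_restrict_iff {Ω : Set E} {P : E → Prop} :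
    (∀ᵐ x ∂(gaussMeasure E).restrict Ω, P x) ↔ ∀ᵐ x ∂(volume : Measure E).restrict Ω, P x :=
  ⟨fun h => (absolutelyContinuous_gaussMeasure.restrict Ω).ae_le h,
    fun h => (gaussMeasure_absolutelyContinuous.restrict Ω).ae_le h⟩

theorem integrableOn_gaussMeasure_iff {F : Type*} [NormedAddCommGroup F] [NormedSpace ℝ F]
    {Ω : Set E} (hΩ : MeasurableSet Ω) (f : E → F) :
    IntegrableOn f Ω (gaussMeasure E) ↔ IntegrableOn (fun x => gaussDensity x • f x) Ω := by
  unfold gaussMeasure IntegrableOn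
  rw [restrict_withDensity hΩ, integrable_withDensity_iff_integrable_smul'
    (continuous_gaussDensity.measurable.ennreal_ofReal) (by simp)]
  simp [ENNReal.toReal_ofReal (gaussDensity_pos _).le]

/-- A polynomial weight (1 + r)^(n+1) is at most exp((n+1) r), and completing the square absorbs
every linear exponent into exp(-r²/2). -/
theorem integrable_exp_norm_gaussMeasure (c : ℝ) :
    Integrable (fun x : E => Real.exp (c * ‖x‖)) (gaussMeasure E) := by
  rw [← integrableOn_univ, integrableOn_gaussMeasure_iff MeasurableSet.univ, integrableOn_univ]
  set n := Module.finrank ℝ E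
  have h1 : Integrable (fun x : E => (1 + ‖x‖) ^ (-((n : ℝ) + 1))) :=
    integrable_one_add_norm (by simp [n])
  refine (h1.const_mul ((2 * Real.pi) ^ (-(n : ℝ) / 2) *
    Real.exp ((c + (n + 1)) ^ 2 / 2))).mono'
    (continuous_gaussDensity.smul (by fun_prop)).aestronglyMeasurable
    (ae_of_all _ fun x => ?_)
  rw [Real.norm_of_nonneg (smul_nonneg (gaussDensity_pos _).le (Real.exp_pos _).le)]
  unfold gaussDensity
  rw [smul_eq_mul, mul_assoc, mul_assoc, ← Real.exp_add]
  refine mul_le_mul_of_nonneg_left ?_ (by positivity)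
  have hr : 0 ≤ ‖x‖ := norm_nonneg x
  have hpos : 0 < (1 + ‖x‖) ^ ((n : ℝ) + 1) := by positivity
  rw [Real.rpow_neg (by positivity), ← div_eq_mul_inv, le_div_iff₀ hpos]
  have h2 : (1 + ‖x‖) ^ ((n : ℝ) + 1) ≤ Real.exp (‖x‖ * (n + 1)) := by
    rw [Real.exp_mul]
    exact Real.rpow_le_rpow (by positivity) (by linarith [Real.add_one_le_exp ‖x‖])
      (by positivity)
  calc _ ≤ Real.exp (-‖x‖ ^ 2 / 2 + c * ‖x‖) * Real.exp (‖x‖ * (n + 1)) :=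
        mul_le_mul_of_nonneg_left h2 (Real.exp_pos _).le
    _ ≤ _ := by
        rw [← Real.exp_add]
        refine Real.exp_le_exp.2 ?_
        nlinarith [sq_nonneg (‖x‖ - (c + (n + 1)))]

/-- Exponential growth is stable under powers, so one pointwise bound serves for every exponent, in
particular for p and its conjugate. -/
theorem memLp_of_norm_le_exp {F : Type*} [NormedAddCommGroup F] {p : ℝ} (hp : 0 < p)
    {Ω : Set E} {f : E → F} {M c : ℝ} (hΩ : MeasurableSet Ω)
    (hf : AEStronglyMeasurable f ((gaussMeasure E).restrict Ω))
    (hb : ∀ x ∈ Ω, ‖f x‖ ≤ M * Real.exp (c * ‖x‖)) :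
    MemLp f (ENNReal.ofReal p) ((gaussMeasure E).restrict Ω) := by
  have h0 : MemLp (fun x : E => Real.exp (c * ‖x‖)) (ENNReal.ofReal p) (gaussMeasure E) := by
    rw [← integrable_norm_rpow_iff (by fun_prop) (by simpa using hp) (by simp)]
    refine (integrable_exp_norm_gaussMeasure (E := E) (c * p)).congr (ae_of_all _ fun x => ?_)
    simp only [Real.norm_eq_abs, Real.abs_exp, ENNReal.toReal_ofReal hp.le, ← Real.exp_mul]
    ring_nf
  refine ((h0.restrict Ω).const_mul M).mono' hf ?_
  filter_upwards [ae_restrict_mem hΩ] with x hx using hb x hx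

/-- A locally integrable function on a half-space whose weak gradient vanishes is constant. -/
theorem ae_eq_const_of_weakGradient_zero_aux {e : E} (he : ‖e‖ = 1) {t : ℝ} {f : E → ℝ}
    (hf : LocallyIntegrableOn f (openHalfSpace e t))
    (h0 : ∀ ψ : E → ℝ, IsTestFunction (openHalfSpace e t) ψ → ∀ v : E,
      ∫ x in openHalfSpace e t, f x * fderiv ℝ ψ x v = 0) {δ : ℝ} (hδ : 0 < δ) :
    ∃ c : ℝ, ∀ᵐ x : E, x ∈ openHalfSpace e (t - 2 * δ) → f x = c := by
  -- Cutting f at distance δ from the boundary makes it locally integrable on the whole space.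
  -- Mollifiers of radius at most δ centred at distance more than 2δ from the boundary never see the
  -- cut.
  set K : Set E := {x | inner ℝ e x ≤ t - δ}
  have hK : IsClosed K := isClosed_le (by fun_prop) continuous_const
  have hKt : K ⊆ openHalfSpace e t := fun x hx => by
    have hx : inner ℝ e x ≤ t - δ := hx
    rw [mem_openHalfSpace]; linarith
  set g : E → ℝ := K.indicator f
  have hg : LocallyIntegrable g := by
    rw [locallyIntegrable_iff]
    intro k hk
    have h1 : IntegrableOn f (k ∩ K) :=
      LocallyIntegrableOn.integrableOn_isCompact
        (hf.mono_set (inter_subset_right.trans hKt)) (hk.inter_right hK)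
    rw [IntegrableOn, integrable_indicator_iff hK.measurableSet, IntegrableOn,
      Measure.restrict_restrict hK.measurableSet, inter_comm]
    exact h1
  let φ : ℕ → ContDiffBump (0 : E) := fun i =>
    ⟨δ / (2 * (i + 1)), δ / (i + 1), by positivity, by
      apply div_lt_div_of_pos_left hδ (by positivity); linarith [(Nat.cast_nonneg i : (0:ℝ) ≤ i)]⟩
  have hφr : ∀ i, (φ i).rOut ≤ δ := fun i =>
    div_le_self hδ.le (by linarith [(Nat.cast_nonneg i : (0:ℝ) ≤ i)])
  have hφ : Tendsto (fun i => (φ i).rOut) atTop (𝓝 0) :=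
    (tendsto_const_div_atTop_nhds_zero_nat δ).comp (tendsto_add_atTop_nat 1) |>.congr
      fun i => by simp [φ]
  have hae := ContDiffBump.ae_convolution_tendsto_right_of_locallyIntegrable (φ := φ)
    (μ := (volume : Measure E)) (K := 2) hφ (Eventually.of_forall fun i => by
      simp only [φ]; apply le_of_eq; field_simp) hg
  have hconst : ∀ i, ∀ x ∈ openHalfSpace e (t - 2 * δ), ∀ y ∈ openHalfSpace e (t - 2 * δ),
      convolution ((φ i).normed volume) g (ContinuousLinearMap.lsmul ℝ ℝ) volume x =
      convolution ((φ i).normed volume) g (ContinuousLinearMap.lsmul ℝ ℝ) volume y := by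
    intro i x hx y hy
    have hc : HasCompactSupport ((φ i).normed (volume : Measure E)) :=
      (φ i).hasCompactSupport_normed
    have hsm : ContDiff ℝ ∞ ((φ i).normed (volume : Measure E)) := (φ i).contDiff_normed
    have hD := hc.hasFDerivAt_convolution_left (ContinuousLinearMap.lsmul ℝ ℝ)
      (hsm.of_le (by simp)) hg
    refine IsOpen.is_const_of_fderiv_eq_zero (𝕜 := ℝ) (isOpen_openHalfSpace e (t - 2 * δ))
      (convex_openHalfSpace e (t - 2 * δ)).isPreconnected
      (fun z _ => (hD z).differentiableAt.differentiableWithinAt) ?_ hx hy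
    intro z hz
    rw [(hD z).fderiv]
    ext v
    have hcf : HasCompactSupport (fderiv ℝ ((φ i).normed (volume : Measure E))) := hc.fderiv ℝ
    have hint := (hcf.convolutionExists_left
      ((ContinuousLinearMap.lsmul ℝ ℝ : ℝ →L[ℝ] ℝ →L[ℝ] ℝ).precompL E)
      (hsm.continuous_fderiv (by simp)) hg z).integrable_swap
    rw [convolution_eq_swap, ContinuousLinearMap.integral_apply hint]
    set ψ : E → ℝ := fun y => (φ i).normed volume (z - y)
    have hψs : tsupport ψ ⊆ K := by
      refine closure_minimal (fun y hy => ?_) hK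
      have h1 : z - y ∈ Function.support ((φ i).normed (volume : Measure E)) := hy
      rw [ContDiffBump.support_normed_eq, Metric.mem_ball, dist_zero_right] at h1
      have h2 := real_inner_le_norm e (y - z)
      rw [he, one_mul, inner_sub_right, norm_sub_rev] at h2
      rw [mem_openHalfSpace] at hz
      change inner ℝ e y ≤ t - δ
      linarith [hφr i]
    have hψ : IsTestFunction (openHalfSpace e t) ψ :=
      ⟨hsm.comp (by fun_prop), hc.comp_homeomorph (Homeomorph.subLeft z), hψs.trans hKt⟩
    have h2 := h0 ψ hψ v
    have h3 : ∀ y, fderiv ℝ ψ y v = -(fderiv ℝ ((φ i).normed volume) (z - y) v) := fun y => by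
      have := ((hsm.differentiable (by simp)).differentiableAt (x := z - y)).hasFDerivAt.comp y
        ((hasFDerivAt_id (𝕜 := ℝ) y).const_sub z)
      simp [show fderiv ℝ ψ y = _ from this.fderiv]
    rw [setIntegral_eq_integral_of_forall_compl_eq_zero (fun y hy => ?_)] at h2
    · rw [Pi.zero_apply, zero_apply, ← neg_eq_zero, ← integral_neg, ← h2]
      refine integral_congr_ae (ae_of_all _ fun y => ?_)
      simp only [ContinuousLinearMap.precompL_apply, ContinuousLinearMap.lsmul_apply, smul_eq_mul]
      rw [← neg_mul, ← h3, mul_comm]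
      by_cases hy : y ∈ K
      · simp [g, hy]
      · have : fderiv ℝ ψ y = 0 := by
          have := notMem_tsupport_iff_eventuallyEq.1 (fun h => hy (hψs h))
          rw [this.fderiv_eq]; simp
        simp [this]
    · have : fderiv ℝ ψ y = 0 := by
        have := notMem_tsupport_iff_eventuallyEq.1 (fun h => hy (hKt (hψs h)))
        rw [this.fderiv_eq]; simp
      simp [this]
  have hgf : ∀ x ∈ openHalfSpace e (t - 2 * δ), g x = f x := fun x hx =>
    indicator_of_mem (show x ∈ K from by
      rw [mem_openHalfSpace] at hx; change inner ℝ e x ≤ t - δ; linarith) f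
  -- The mollifications are constant on the smaller half-space, so one point of convergence fixes
  -- the value of the limit; without such a point the almost-everywhere claim is vacuous.
  by_cases hP : ∃ x₀ ∈ openHalfSpace e (t - 2 * δ), Tendsto (fun i =>
      convolution ((φ i).normed volume) g (ContinuousLinearMap.lsmul ℝ ℝ) volume x₀) atTop
      (𝓝 (g x₀))
  · obtain ⟨x₀, hx₀, hl⟩ := hP
    refine ⟨f x₀, ?_⟩
    filter_upwards [hae] with x hx hxm
    rw [← hgf x hxm, ← hgf x₀ hx₀]
    exact tendsto_nhds_unique hx (hl.congr fun i => hconst i _ hx₀ _ hxm)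
  · refine ⟨0, ?_⟩
    filter_upwards [hae] with x hx hxm
    exact absurd ⟨x, hxm, hx⟩ hP

/-- The constants on an exhausting sequence of half-spaces agree, because any two points of the full
half-space lie in a common member of the sequence. -/
theorem ae_eq_const_of_weakGradient_zero {e : E} (he : ‖e‖ = 1) {t : ℝ} {f : E → ℝ}
    (hf : LocallyIntegrableOn f (openHalfSpace e t))
    (h0 : ∀ ψ : E → ℝ, IsTestFunction (openHalfSpace e t) ψ → ∀ v : E,
      ∫ x in openHalfSpace e t, f x * fderiv ℝ ψ x v = 0) :
    ∃ c : ℝ, ∀ᵐ x ∂(volume : Measure E).restrict (openHalfSpace e t), f x = c := by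
  choose c hc using fun n : ℕ => ae_eq_const_of_weakGradient_zero_aux he hf h0
    (δ := 1 / (n + 1)) (by positivity)
  have hall := ae_all_iff.2 hc
  have hex : ∀ x ∈ openHalfSpace e t, ∀ y ∈ openHalfSpace e t, ∃ n : ℕ,
      x ∈ openHalfSpace e (t - 2 * (1 / (n + 1))) ∧
      y ∈ openHalfSpace e (t - 2 * (1 / (n + 1))) := by
    intro x hx y hy
    rw [mem_openHalfSpace] at hx hy
    obtain ⟨n, hn⟩ := exists_nat_one_div_lt
      (show 0 < min (t - inner ℝ e x) (t - inner ℝ e y) / 2 by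
        have := lt_min (sub_pos.2 hx) (sub_pos.2 hy); positivity)
    have h1 := min_le_left (t - inner ℝ e x) (t - inner ℝ e y)
    have h2 := min_le_right (t - inner ℝ e x) (t - inner ℝ e y)
    exact ⟨n, by rw [mem_openHalfSpace]; linarith, by rw [mem_openHalfSpace]; linarith⟩
  rw [show (∃ c : ℝ, ∀ᵐ x ∂(volume : Measure E).restrict (openHalfSpace e t), f x = c) ↔
    ∃ c : ℝ, ∀ᵐ x : E, x ∈ openHalfSpace e t → f x = c by
      simp only [ae_restrict_iff' (isOpen_openHalfSpace e t).measurableSet]]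
  by_cases hP : ∃ x₀ ∈ openHalfSpace e t, ∀ n : ℕ,
      x₀ ∈ openHalfSpace e (t - 2 * (1 / (n + 1))) → f x₀ = c n
  · obtain ⟨x₀, hx₀, hl⟩ := hP
    refine ⟨f x₀, ?_⟩
    filter_upwards [hall] with x hx hxm
    obtain ⟨n, h1, h2⟩ := hex x hxm x₀ hx₀
    rw [hx n h1, hl n h2]
  · refine ⟨0, ?_⟩
    filter_upwards [hall] with x hx hxm
    exact absurd ⟨x, hxm, hx⟩ hP

end Analysis

/-! ### Strict convexity of the p-th power of a norm -/

section Convexity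

/-- The convexity gap of `‖·‖ ^ p` at `C`, evaluated at `B`. -/
def powGap {E : Type*} [NormedAddCommGroup E] [InnerProductSpace ℝ E] (p : ℝ) (B C : E) : ℝ :=
  ‖B‖ ^ p + (p - 1) * ‖C‖ ^ p - p * (‖C‖ ^ (p - 2) * inner ℝ C B)

/-- After division by c^p this is Bernoulli's inequality for 1 + (b/c - 1), with its strict form
giving the equality case. -/
theorem scalar_powGap {p b c : ℝ} (hp : 1 < p) (hb : 0 ≤ b) (hc : 0 < c) :
    0 ≤ b ^ p + (p - 1) * c ^ p - p * (c ^ (p - 1) * b) ∧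
    (b ^ p + (p - 1) * c ^ p - p * (c ^ (p - 1) * b) = 0 → b = c) := by
  have key : b ^ p + (p - 1) * c ^ p - p * (c ^ (p - 1) * b) =
      c ^ p * ((1 + (b / c - 1)) ^ p - (1 + p * (b / c - 1))) := by
    rw [show 1 + (b / c - 1) = b / c by ring, Real.div_rpow hb hc.le,
      Real.rpow_sub_one hc.ne']
    have := (Real.rpow_pos_of_pos hc p).ne'
    field_simp
    ring
  have hcp := Real.rpow_pos_of_pos hc p
  have hs : -1 ≤ b / c - 1 := by have := div_nonneg hb hc.le; linarith
  rw [key]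
  refine ⟨mul_nonneg hcp.le (sub_nonneg.2 (one_add_mul_self_le_rpow_one_add hs hp.le)),
    fun h => ?_⟩
  by_contra hne
  have hs' : b / c - 1 ≠ 0 := fun h' => hne (by
    rwa [sub_eq_zero, div_eq_one_iff_eq hc.ne'] at h')
  have := one_add_mul_self_lt_rpow_one_add hs hs' hp
  have := mul_pos hcp (sub_pos.2 this)
  linarith

/-- Cauchy–Schwarz reduces the gap to the scalar one for the norms. If the gap vanishes, the scalar
case gives equal norms and then Cauchy–Schwarz is an equality, so the vectors coincide. -/
theorem powGap_nonneg_and_eq {E : Type*} [NormedAddCommGroup E] [InnerProductSpace ℝ E] {p : ℝ}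
    (hp : 1 < p) (B C : E) : 0 ≤ powGap p B C ∧ (powGap p B C = 0 → B = C) := by
  unfold powGap
  rcases eq_or_ne C 0 with rfl | hC
  · have : (0 : ℝ) ^ p = 0 := Real.zero_rpow (by linarith)
    simp only [norm_zero, this, inner_zero_left, mul_zero, add_zero, sub_zero]
    refine ⟨by positivity, fun h => ?_⟩
    rw [Real.rpow_eq_zero (norm_nonneg _) (by linarith)] at h
    exact norm_eq_zero.1 h
  have hc : 0 < ‖C‖ := norm_pos_iff.2 hC
  obtain ⟨h1, h2⟩ := scalar_powGap hp (norm_nonneg B) hc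
  have hcc : ‖C‖ ^ (p - 1) = ‖C‖ ^ (p - 2) * ‖C‖ := by
    rw [← Real.rpow_add_one hc.ne']; ring_nf
  have hle : ‖C‖ ^ (p - 2) * inner ℝ C B ≤ ‖C‖ ^ (p - 1) * ‖B‖ := by
    rw [hcc, mul_assoc]
    exact mul_le_mul_of_nonneg_left (real_inner_le_norm C B) (by positivity)
  refine ⟨by nlinarith, fun h => ?_⟩
  have hBC : ‖B‖ = ‖C‖ := h2 (le_antisymm (by nlinarith) h1)
  have : p * (‖C‖ ^ (p - 2) * inner ℝ C B) = p * (‖C‖ ^ (p - 2) * (‖C‖ * ‖B‖)) := by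
    have e1 : ‖C‖ ^ p = ‖C‖ ^ (p - 2) * (‖C‖ * ‖C‖) := by
      rw [← mul_assoc, ← hcc, ← Real.rpow_add_one hc.ne']; ring_nf
    rw [hBC, e1] at h
    rw [hBC]; linarith
  have h3 : inner ℝ C B = ‖C‖ * ‖B‖ := by
    have hpos : p * ‖C‖ ^ (p - 2) ≠ 0 := by positivity
    rw [← mul_assoc, ← mul_assoc] at this
    exact mul_left_cancel₀ hpos this
  rw [inner_eq_norm_mul_iff_real, hBC] at h3
  exact (smul_right_injective E hc.ne' h3).symm

end Convexity

/-! ### The minimal solution of the Riccati equation -/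

section Riccati

/-- The unnormalised Gaussian weight `exp (-s² / 2)`. -/
def bell (s : ℝ) : ℝ := Real.exp (-s ^ 2 / 2)

theorem bell_pos (s : ℝ) : 0 < bell s := Real.exp_pos _

theorem continuous_bell : Continuous bell := by unfold bell; fun_prop

theorem bell_le_one (s : ℝ) : bell s ≤ 1 := by
  unfold bell; rw [Real.exp_le_one_iff]; nlinarith [sq_nonneg s]

theorem hasDerivAt_bell (s : ℝ) : HasDerivAt bell (-s * bell s) s := by
  unfold bell
  have h := (((hasDerivAt_pow 2 s).neg).div_const 2).exp
  refine h.congr_deriv ?_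
  simp; ring

theorem integrable_bell : Integrable bell := by
  have := integrable_exp_neg_mul_sq (b := 1 / 2) (by norm_num)
  refine this.congr (ae_of_all _ fun x => ?_)
  unfold bell
  ring_nf

/-- On [-n, s] the integral of g is at most F s - F (-n) ≤ F s; then n tends to infinity. Only the
sign of F is used, so a supersolution needs no limit at -∞. -/
theorem lintegral_Iio_le_of_deriv_le {F F' g : ℝ → ℝ} {t s : ℝ} (hF : ∀ x < t, 0 ≤ F x)
    (hd : ∀ x < t, HasDerivAt F (F' x) x) (hg : ContinuousOn g (Iio t)) (hg0 : ∀ x < t, 0 ≤ g x)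
    (hle : ∀ x < t, g x ≤ F' x) (hs : s < t) :
    ∫⁻ x in Iio s, ENNReal.ofReal (g x) ≤ ENNReal.ofReal (F s) := by
  have hgm : AEMeasurable (fun x => ENNReal.ofReal (g x)) (volume.restrict (Iio s)) :=
    ((hg.mono (Iio_subset_Iio hs.le)).aemeasurable measurableSet_Iio).ennreal_ofReal
  have hcov : AECover (volume.restrict (Iio s)) atTop fun n : ℕ => Ici (-(n : ℝ)) :=
    aecover_Ici (tendsto_neg_atTop_atBot.comp tendsto_natCast_atTop_atTop)
  refine le_of_tendsto (hcov.lintegral_tendsto_of_countably_generated hgm) ?_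
  have hev : ∀ᶠ n : ℕ in atTop, -(n : ℝ) ≤ s :=
    (tendsto_neg_atTop_atBot.comp tendsto_natCast_atTop_atTop).eventually_le_atBot s
  filter_upwards [hev] with n hn
  rw [Measure.restrict_restrict measurableSet_Ici]
  have hsub : Icc (-(n : ℝ)) s ⊆ Iio t := fun x hx => hx.2.trans_lt hs
  have hgi : IntegrableOn g (Icc (-(n : ℝ)) s) := (hg.mono hsub).integrableOn_Icc
  calc ∫⁻ x in Ici (-(n : ℝ)) ∩ Iio s, ENNReal.ofReal (g x)
      ≤ ∫⁻ x in Icc (-(n : ℝ)) s, ENNReal.ofReal (g x) :=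
        lintegral_mono_set fun x hx => ⟨hx.1, le_of_lt hx.2⟩
    _ = ENNReal.ofReal (∫ x in Icc (-(n : ℝ)) s, g x) := by
        rw [ofReal_integral_eq_lintegral_ofReal hgi]
        filter_upwards [ae_restrict_mem measurableSet_Icc] with x hx using hg0 x (hsub hx)
    _ ≤ ENNReal.ofReal (F s) := by
        refine ENNReal.ofReal_le_ofReal ?_
        rw [integral_Icc_eq_integral_Ioc, ← intervalIntegral.integral_of_le hn]
        have h1 := intervalIntegral.integral_le_sub_of_hasDeriv_right_of_le (g := F) (g' := F')
          (φ := g) hn (fun x hx => (hd x (hsub hx)).continuousAt.continuousWithinAt)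
          (fun x hx => (hd x (hsub (Ioo_subset_Icc_self hx))).hasDerivWithinAt) hgi
          (fun x hx => hle x (hsub (Ioo_subset_Icc_self hx)))
        linarith [hF _ (hsub (left_mem_Icc.2 hn))]

variable {p : ℝ}

/-- The integral operator whose least fixed point is the flux `q · bell` of the minimal solution
of the Riccati equation `q' = l + s q + (p - 1) q ^ (p / (p - 1))`. -/
def fluxMap (hp : 1 < p) (l : ℝ) : (ℝ → ENNReal) →o (ℝ → ENNReal) where
  toFun y s := ∫⁻ r in Iio s, (ENNReal.ofReal (l * bell r) +
    ENNReal.ofReal ((p - 1) * bell r ^ (-(p - 1)⁻¹)) * y r ^ (1 + (p - 1)⁻¹))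
  monotone' y z hyz s := by
    have : 0 ≤ (p - 1)⁻¹ := inv_nonneg.2 (by linarith)
    refine lintegral_mono fun r => ?_
    gcongr
    exact hyz r

/-- With values in [0, ∞] the functions form a complete lattice, so the least fixed point exists for
every l, and explosion in finite time is recorded as the value ⊤. -/
def flux (hp : 1 < p) (l : ℝ) : ℝ → ENNReal := OrderHom.lfp (fluxMap hp l)

theorem flux_eq (hp : 1 < p) (l s : ℝ) : flux hp l s =
    ∫⁻ r in Iio s, (ENNReal.ofReal (l * bell r) +
      ENNReal.ofReal ((p - 1) * bell r ^ (-(p - 1)⁻¹)) * flux hp l r ^ (1 + (p - 1)⁻¹)) :=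
  (congrFun (OrderHom.map_lfp (fluxMap hp l)) s).symm

theorem flux_le_of_le {hp : 1 < p} {l : ℝ} {y : ℝ → ENNReal} (h : fluxMap hp l y ≤ y) :
    flux hp l ≤ y := OrderHom.lfp_le _ h

theorem monotone_flux (hp : 1 < p) (l : ℝ) : Monotone (flux hp l) := fun s t hst => by
  rw [flux_eq hp l s, flux_eq hp l t]
  exact lintegral_mono_set (Iio_subset_Iio hst)

theorem flux_mono {hp : 1 < p} {l l' : ℝ} (h : l ≤ l') : flux hp l ≤ flux hp l' := by
  refine flux_le_of_le fun s => ?_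
  conv_rhs => rw [flux_eq hp l' s]
  refine lintegral_mono fun r => ?_
  gcongr
  exact (bell_pos r).le

/-- Translates the nonlinearity of the integral equation for y = q · bell into that of the Riccati
equation for q. -/
theorem bell_rpow_mul {q : ℝ} (hq : 0 ≤ q) (r : ℝ) :
    (p - 1) * bell r ^ (-(p - 1)⁻¹) * (q * bell r) ^ (1 + (p - 1)⁻¹) =
      (p - 1) * q ^ (1 + (p - 1)⁻¹) * bell r := by
  have h1 : bell r ^ (1 + (p - 1)⁻¹) = bell r * bell r ^ (p - 1)⁻¹ := by
    rw [Real.rpow_add (bell_pos r), Real.rpow_one]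
  have h2 : bell r ^ (-(p - 1)⁻¹) * bell r ^ (p - 1)⁻¹ = 1 := by
    rw [← Real.rpow_add (bell_pos r)]; simp
  rw [Real.mul_rpow hq (bell_pos r).le, h1]
  linear_combination (p - 1) * q ^ (1 + (p - 1)⁻¹) * bell r * h2

/-- Comparison: a supersolution of the Riccati equation dominates the minimal solution. -/
theorem flux_le_of_supersolution (hp : 1 < p) {l t : ℝ} (hl : 0 ≤ l) {q q' : ℝ → ℝ}
    (hq : ∀ s < t, 0 ≤ q s) (hd : ∀ s < t, HasDerivAt q (q' s) s)
    (hsup : ∀ s < t, l + s * q s + (p - 1) * q s ^ (1 + (p - 1)⁻¹) ≤ q' s) :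
    ∀ s < t, flux hp l s ≤ ENNReal.ofReal (q s * bell s) := by
  have ha : 0 < (p - 1)⁻¹ := inv_pos.2 (by linarith)
  set g : ℝ → ℝ := fun r => l * bell r + (p - 1) * q r ^ (1 + (p - 1)⁻¹) * bell r
  have hqc : ContinuousOn q (Iio t) := fun s hs => (hd s hs).continuousAt.continuousWithinAt
  have hgc : ContinuousOn g (Iio t) := by
    have h1 : ContinuousOn (fun r => q r ^ (1 + (p - 1)⁻¹)) (Iio t) :=
      hqc.rpow_const fun x _ => Or.inr (by positivity)
    exact (continuous_const.mul continuous_bell).continuousOn.add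
      ((continuousOn_const.mul h1).mul continuous_bell.continuousOn)
  have hg0 : ∀ x < t, 0 ≤ g x := fun x hx => by
    have h1 := bell_pos x
    have h2 := Real.rpow_nonneg (hq x hx) (1 + (p - 1)⁻¹)
    have h3 : 0 < p - 1 := by linarith
    simp only [g]; positivity
  have hFd : ∀ x < t, HasDerivAt (fun s => q s * bell s)
      (q' x * bell x + q x * (-x * bell x)) x := fun x hx => (hd x hx).mul (hasDerivAt_bell x)
  -- Extended by ⊤ beyond t, the supersolution is a pre-fixed point on the whole line, and the least
  -- fixed point lies below every pre-fixed point.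
  have key : fluxMap hp l (fun s => if s < t then ENNReal.ofReal (q s * bell s) else ⊤) ≤
      fun s => if s < t then ENNReal.ofReal (q s * bell s) else ⊤ := by
    intro s
    by_cases hs : s < t
    swap
    · simp [hs]
    simp only [hs, if_true]
    refine le_trans (le_of_eq ?_) (lintegral_Iio_le_of_deriv_le (F := fun s => q s * bell s)
      (fun x hx => mul_nonneg (hq x hx) (bell_pos x).le) hFd hgc hg0 (fun x hx => ?_) hs)
    · refine setLIntegral_congr_fun measurableSet_Iio fun r (hr : r < s) => ?_
      have hrt := hr.trans hs
      have hb := bell_pos r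
      simp only [hrt, if_true]
      rw [ENNReal.ofReal_rpow_of_nonneg (mul_nonneg (hq r hrt) hb.le) (by positivity),
        ← ENNReal.ofReal_mul (mul_nonneg (by linarith) (Real.rpow_nonneg hb.le _)),
        bell_rpow_mul (hq r hrt), ← ENNReal.ofReal_add (by positivity)]
      exact mul_nonneg (mul_nonneg (by linarith) (Real.rpow_nonneg (hq r hrt) _)) hb.le
    · have := mul_le_mul_of_nonneg_right (hsup x hx) (bell_pos x).le
      simp only [g]; linarith
  intro s hs
  have := flux_le_of_le key s
  simpa [hs] using this

/-- The constant 1 is a supersolution there, since l + s + (p - 1) ≤ 0. This controls the quotient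
by `bell` near -∞, where `bell` degenerates. -/
theorem flux_le_bell (hp : 1 < p) {l s : ℝ} (hl : 0 ≤ l) (hs : s < -(l + (p - 1))) :
    flux hp l s ≤ ENNReal.ofReal (bell s) := by
  have := flux_le_of_supersolution hp hl (t := -(l + (p - 1))) (q := fun _ => 1)
    (q' := fun _ => 0) (fun _ _ => zero_le_one) (fun s _ => hasDerivAt_const s 1)
    (fun s hs => by rw [Real.one_rpow]; linarith) s hs
  simpa using this

/-- The minimal solution of the Riccati equation, where it is finite. -/
def riccati (hp : 1 < p) (l s : ℝ) : ℝ := (flux hp l s).toReal / bell s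

/-- The parameters for which the minimal solution is finite on `(-∞, t)`. -/
def admissible (hp : 1 < p) (t : ℝ) : Set ℝ := {l | 0 < l ∧ ∀ s < t, flux hp l s < ⊤}

theorem riccati_mul_bell (hp : 1 < p) (l s : ℝ) :
    riccati hp l s * bell s = (flux hp l s).toReal :=
  div_mul_cancel₀ _ (bell_pos s).ne'

theorem riccati_nonneg (hp : 1 < p) (l s : ℝ) : 0 ≤ riccati hp l s :=
  div_nonneg ENNReal.toReal_nonneg (bell_pos s).le

/-- Regularity is bootstrapped from monotonicity: the flux is measurable, hence a primitive of an
integrable function, hence continuous; then the integrand is continuous and the fundamental theorem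
of calculus applies. -/
theorem flux_toReal_facts (hp : 1 < p) {l t : ℝ} (h : l ∈ admissible hp t) :
    (∀ s < t, l * ∫ r in Iio s, bell r ≤ (flux hp l s).toReal) ∧
    ∀ s < t, HasDerivAt (fun s => (flux hp l s).toReal)
      (l * bell s + (p - 1) * bell s ^ (-(p - 1)⁻¹) * (flux hp l s).toReal ^ (1 + (p - 1)⁻¹)) s := by
  obtain ⟨hl, hfin⟩ := h
  have ha : 0 < (p - 1)⁻¹ := inv_pos.2 (by linarith)
  have hp1 : 0 < p - 1 := by linarith
  set Y : ℝ → ℝ := fun s => (flux hp l s).toReal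
  set f : ℝ → ℝ := fun r => l * bell r + (p - 1) * bell r ^ (-(p - 1)⁻¹) * Y r ^ (1 + (p - 1)⁻¹)
  have hY0 : ∀ r, 0 ≤ Y r := fun r => ENNReal.toReal_nonneg
  have hf0 : ∀ r, l * bell r ≤ f r := fun r => by
    have h1 := Real.rpow_nonneg (bell_pos r).le (-(p - 1)⁻¹)
    have h2 := Real.rpow_nonneg (hY0 r) (1 + (p - 1)⁻¹)
    simp only [f]
    have : 0 ≤ (p - 1) * bell r ^ (-(p - 1)⁻¹) * Y r ^ (1 + (p - 1)⁻¹) := by positivity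
    linarith
  have hlb : ∀ r, 0 ≤ l * bell r := fun r => mul_nonneg hl.le (bell_pos r).le
  have hYm : Measurable Y := (monotone_flux hp l).measurable.ennreal_toReal
  have hbm := continuous_bell.measurable
  have hfm : Measurable f := by
    simp only [f]; fun_prop
  have hfl : ∀ s < t, flux hp l s = ∫⁻ r in Iio s, ENNReal.ofReal (f r) := by
    intro s hs
    rw [flux_eq]
    refine setLIntegral_congr_fun measurableSet_Iio fun r (hr : r < s) => ?_
    have hr' := (hfin r (hr.trans hs)).ne
    have hb := bell_pos r
    simp only [f]
    rw [ENNReal.ofReal_add (hlb r) (mul_nonneg (mul_nonneg hp1.le (Real.rpow_nonneg hb.le _))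
        (Real.rpow_nonneg (hY0 r) _)),
      ENNReal.ofReal_mul (mul_nonneg hp1.le (Real.rpow_nonneg hb.le _)),
      ← ENNReal.ofReal_rpow_of_nonneg (hY0 r) (by positivity), ENNReal.ofReal_toReal hr']
  have hint : ∀ s < t, IntegrableOn f (Iio s) := fun s hs => by
    refine ⟨hfm.aestronglyMeasurable, ?_⟩
    rw [hasFiniteIntegral_iff_ofReal (ae_of_all _ fun r => (hlb r).trans (hf0 r)), ← hfl s hs]
    exact hfin s hs
  have hYint : ∀ s < t, Y s = ∫ r in Iio s, f r := fun s hs => by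
    simp only [Y]
    rw [hfl s hs, integral_eq_lintegral_of_nonneg_ae
      (ae_of_all _ fun r => (hlb r).trans (hf0 r)) hfm.aestronglyMeasurable]
  refine ⟨fun s hs => ?_, fun s hs => ?_⟩
  · change _ ≤ Y s
    rw [hYint s hs, ← integral_const_mul]
    exact integral_mono ((integrable_bell.const_mul l).integrableOn) (hint s hs) hf0
  · obtain ⟨b, hsb, hbt⟩ := exists_between hs
    set a := s - 1
    have hii : IntervalIntegrable f volume a b :=
      (intervalIntegrable_iff_integrableOn_Ioo_of_le (by simp only [a]; linarith)).2
        ((hint b hbt).mono_set Ioo_subset_Iio_self)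
    have hYa : ∀ r ∈ Ioo a b, Y r = Y a + ∫ x in a..r, f x := fun r hr => by
      rw [hYint r (hr.2.trans hbt), hYint a (by simp only [a]; linarith),
        ← integral_Iic_eq_integral_Iio, ← integral_Iic_eq_integral_Iio,
        ← intervalIntegral.integral_Iic_sub_Iic]
      · ring
      · exact (integrableOn_Iic_iff_integrableOn_Iio enorm_ne_top).2 (hint a (by simp only [a]; linarith))
      · exact (integrableOn_Iic_iff_integrableOn_Iio enorm_ne_top).2 (hint r (hr.2.trans hbt))
    have hmem : Ioo a b ∈ 𝓝 s := Ioo_mem_nhds (by simp only [a]; linarith) hsb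
    have hprim : ContinuousOn (fun r => ∫ x in a..r, f x) (uIcc a b) :=
      intervalIntegral.continuousOn_primitive_interval
        ((intervalIntegrable_iff_integrableOn_Icc_of_le (by simp only [a]; linarith)).1 hii |>.mono_set
          (by rw [uIcc_of_le (by simp only [a]; linarith)]))
    have hYc : ContinuousAt Y s := by
      have h1 : ContinuousAt (fun r => Y a + ∫ x in a..r, f x) s :=
        continuousAt_const.add (hprim.continuousAt (mem_of_superset hmem
          (Ioo_subset_Icc_self.trans Icc_subset_uIcc)))
      exact h1.congr (eventually_of_mem hmem fun r hr => (hYa r hr).symm)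
    have hfc : ContinuousAt f s :=
      (continuousAt_const.mul continuous_bell.continuousAt).add
        ((continuousAt_const.mul (continuous_bell.continuousAt.rpow_const
          (Or.inl (bell_pos s).ne'))).mul (hYc.rpow_const (Or.inr (by positivity))))
    have hii' : IntervalIntegrable f volume a s :=
      (intervalIntegrable_iff_integrableOn_Ioo_of_le (by simp only [a]; linarith)).2
        ((hint s hs).mono_set Ioo_subset_Iio_self)
    have hD := (intervalIntegral.integral_hasDerivAt_right hii'
      hfm.stronglyMeasurable.stronglyMeasurableAtFilter hfc).const_add (Y a)
    exact hD.congr_of_eventuallyEq (eventually_of_mem hmem hYa)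

theorem flux_toReal_pos (hp : 1 < p) {l t : ℝ} (h : l ∈ admissible hp t) {s : ℝ} (hs : s < t) :
    0 < (flux hp l s).toReal := by
  refine lt_of_lt_of_le (mul_pos h.1 ?_) ((flux_toReal_facts hp h).1 s hs)
  rw [setIntegral_pos_iff_support_of_nonneg_ae (ae_of_all _ fun x => (bell_pos x).le)
    integrable_bell.integrableOn]
  rw [show Function.support bell = univ from eq_univ_of_forall fun x => (bell_pos x).ne']
  simp

theorem riccati_pos (hp : 1 < p) {l t : ℝ} (h : l ∈ admissible hp t) {s : ℝ} (hs : s < t) :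
    0 < riccati hp l s := div_pos (flux_toReal_pos hp h hs) (bell_pos s)

theorem hasDerivAt_riccati (hp : 1 < p) {l t : ℝ} (h : l ∈ admissible hp t) {s : ℝ}
    (hs : s < t) : HasDerivAt (riccati hp l)
      (l + s * riccati hp l s + (p - 1) * riccati hp l s ^ (1 + (p - 1)⁻¹)) s := by
  have h1 := ((flux_toReal_facts hp h).2 s hs).div (hasDerivAt_bell s) (bell_pos s).ne'
  refine h1.congr_deriv ?_
  have hb := (bell_pos s).ne'
  rw [← riccati_mul_bell, bell_rpow_mul (riccati_nonneg hp l s)]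
  field_simp
  ring

/-- A priori bound: the flux at `s` is bounded in terms of the distance to the endpoint. -/
theorem flux_toReal_le (hp : 1 < p) {l t : ℝ} (h : l ∈ admissible hp t) {s : ℝ} (hs : s < t) :
    (flux hp l s).toReal ≤ (t - s) ^ (-(p - 1)) := by
  have hp1 : 0 < p - 1 := by linarith
  have ha : 0 < (p - 1)⁻¹ := inv_pos.2 hp1
  set Y : ℝ → ℝ := fun s => (flux hp l s).toReal
  have hYpos : ∀ r < t, 0 < Y r := fun r hr => flux_toReal_pos hp h hr
  have hW : ∀ r < t, HasDerivAt (fun r => Y r ^ (-(p - 1)⁻¹) + r)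
      ((l * bell r + (p - 1) * bell r ^ (-(p - 1)⁻¹) * Y r ^ (1 + (p - 1)⁻¹)) *
        (-(p - 1)⁻¹) * Y r ^ (-(p - 1)⁻¹ - 1) + 1) r := fun r hr =>
    (((flux_toReal_facts hp h).2 r hr).rpow_const (Or.inl (hYpos r hr).ne')).add
      (hasDerivAt_id r)
  -- As `bell` ≤ 1, Y' ≥ (p-1) Y^(p/(p-1)), that is (Y^(-1/(p-1)))' ≤ -1. A solution still finite up
  -- to t therefore has Y(s)^(-1/(p-1)) ≥ t - s.
  have hanti : AntitoneOn (fun r => Y r ^ (-(p - 1)⁻¹) + r) (Iio t) := by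
    refine antitoneOn_of_deriv_nonpos (convex_Iio t)
      (fun r hr => (hW r hr).continuousAt.continuousWithinAt)
      (fun r hr => (hW r (by simpa using hr)).differentiableAt.differentiableWithinAt) ?_
    intro r hr
    have hr : r < t := by simpa using hr
    rw [(hW r hr).deriv]
    have hy := hYpos r hr
    have hyy := Real.rpow_pos_of_pos hy (-(p - 1)⁻¹ - 1)
    have e1 : Y r ^ (1 + (p - 1)⁻¹) * Y r ^ (-(p - 1)⁻¹ - 1) = 1 := by
      rw [← Real.rpow_add hy, show 1 + (p - 1)⁻¹ + (-(p - 1)⁻¹ - 1) = 0 by ring, Real.rpow_zero]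
    have e2 : 1 ≤ bell r ^ (-(p - 1)⁻¹) :=
      Real.one_le_rpow_of_pos_of_le_one_of_nonpos (bell_pos r) (bell_le_one r) (by linarith)
    have e3 : (p - 1) * (p - 1)⁻¹ = 1 := mul_inv_cancel₀ hp1.ne'
    have e4 : 0 ≤ l * bell r * (p - 1)⁻¹ * Y r ^ (-(p - 1)⁻¹ - 1) := by
      have := h.1; have := bell_pos r; positivity
    have : (l * bell r + (p - 1) * bell r ^ (-(p - 1)⁻¹) * Y r ^ (1 + (p - 1)⁻¹)) *
        (-(p - 1)⁻¹) * Y r ^ (-(p - 1)⁻¹ - 1) + 1 =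
        -(l * bell r * (p - 1)⁻¹ * Y r ^ (-(p - 1)⁻¹ - 1)) + (1 - bell r ^ (-(p - 1)⁻¹)) := by
      linear_combination (-(p - 1) * (p - 1)⁻¹ * bell r ^ (-(p - 1)⁻¹)) * e1 -
        bell r ^ (-(p - 1)⁻¹) * e3
    rw [this]; linarith
  have hle : t - s ≤ Y s ^ (-(p - 1)⁻¹) := by
    refine le_of_forall_lt_imp_le_of_dense fun r hr => ?_
    by_cases hr0 : r ≤ 0
    · exact hr0.trans (Real.rpow_nonneg (hYpos s hs).le _)
    have h1 := hanti (show s ∈ Iio t from hs) (show s + r ∈ Iio t by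
      change s + r < t; linarith) (by linarith)
    have h2 := Real.rpow_nonneg (hYpos (s + r) (by linarith)).le (-(p - 1)⁻¹)
    have h1 : Y (s + r) ^ (-(p - 1)⁻¹) + (s + r) ≤ Y s ^ (-(p - 1)⁻¹) + s := h1
    linarith
  have h3 := Real.rpow_le_rpow_of_nonpos (by linarith) hle (show -(p - 1) ≤ 0 by linarith)
  rw [← Real.rpow_mul (hYpos s hs).le, neg_mul_neg, inv_mul_cancel₀ hp1.ne', Real.rpow_one] at h3
  exact h3

/-- Bound for the minimal solution on `(-∞, s]`, uniform in `l ≤ Λ`. -/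
theorem riccati_le (hp : 1 < p) {l Λ s M : ℝ} (hl : 0 < l) (hlΛ : l ≤ Λ)
    (hfin : flux hp l s < ⊤) (hM : (flux hp l s).toReal ≤ M) {r : ℝ} (hr : r ≤ s) :
    riccati hp l r ≤ 1 + M * Real.exp (((Λ + (p - 1)) ^ 2 + s ^ 2) / 2) := by
  have hM0 : 0 ≤ M := ENNReal.toReal_nonneg.trans hM
  unfold riccati
  rw [div_le_iff₀ (bell_pos r), add_mul, one_mul]
  have hb := bell_pos r
  -- Far to the left the barrier 1 applies; otherwise the flux is monotone and `bell` is bounded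
  -- below on the remaining bounded range of r.
  by_cases hr0 : r < -(l + (p - 1))
  · have h1 := ENNReal.toReal_mono ENNReal.ofReal_ne_top (flux_le_bell hp hl.le hr0)
    rw [ENNReal.toReal_ofReal hb.le] at h1
    have : 0 ≤ M * Real.exp (((Λ + (p - 1)) ^ 2 + s ^ 2) / 2) * bell r := by positivity
    linarith
  · push Not at hr0
    have h1 := ENNReal.toReal_mono hfin.ne (monotone_flux hp l hr)
    have h2 : 1 ≤ Real.exp (((Λ + (p - 1)) ^ 2 + s ^ 2) / 2) * bell r := by
      unfold bell
      rw [← Real.exp_add]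
      refine Real.one_le_exp ?_
      have : r ^ 2 ≤ (Λ + (p - 1)) ^ 2 + s ^ 2 := by
        rcases le_total 0 r with h0 | h0
        · nlinarith [sq_nonneg (Λ + (p - 1))]
        · have : -(Λ + (p - 1)) ≤ r := by linarith
          nlinarith [sq_nonneg s]
      linarith
    nlinarith

/-- Perturbation of the parameter. -/
theorem flux_add_le (hp : 1 < p) {l t K ε : ℝ} (h : l ∈ admissible hp t) (hε : 0 < ε)
    (hK : ∀ s < t, riccati hp l s ≤ K)
    (hεK : ε * Real.exp (Real.exp (p * (K + 1) ^ (p - 1)⁻¹ + t)) ≤ 1) :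
    ∀ s < t, flux hp (l + ε) s ≤ ENNReal.ofReal ((riccati hp l s +
      ε * Real.exp (Real.exp (p * (K + 1) ^ (p - 1)⁻¹ + s))) * bell s) := by
  have hp1 : 0 < p - 1 := by linarith
  have ha : 0 < (p - 1)⁻¹ := inv_pos.2 hp1
  -- C is a Lipschitz constant for the nonlinearity on [0, K + 1]. The factor g = exp(exp(C + s))
  -- has g' = g exp(C + s) ≥ g (1 + C + s), which pays for the new ε, the Lipschitz term and the
  -- drift, while g stays at least 1 and bounded as s → -∞.
  set C := p * (K + 1) ^ (p - 1)⁻¹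
  have hgd : ∀ s, HasDerivAt (fun s => Real.exp (Real.exp (C + s)))
      (Real.exp (Real.exp (C + s)) * Real.exp (C + s)) s := fun s =>
    ((((hasDerivAt_id s).const_add C).exp).exp).congr_deriv (by simp)
  refine flux_le_of_supersolution hp (add_pos h.1 hε).le
    (q' := fun s => (l + s * riccati hp l s + (p - 1) * riccati hp l s ^ (1 + (p - 1)⁻¹)) +
      ε * (Real.exp (Real.exp (C + s)) * Real.exp (C + s)))
    (fun s _ => add_nonneg (riccati_nonneg hp l s) (by positivity))
    (fun s hs => (hasDerivAt_riccati hp h hs).add ((hgd s).const_mul ε)) fun s hs => ?_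
  have hq := riccati_pos hp h hs
  have hqK := hK s hs
  set q := riccati hp l s
  set g := Real.exp (Real.exp (C + s))
  have hg1 : 1 ≤ g := Real.one_le_exp (Real.exp_pos _).le
  have hεg : ε * g ≤ 1 := le_trans (mul_le_mul_of_nonneg_left
    (Real.exp_le_exp.2 (Real.exp_le_exp.2 (by linarith))) hε.le) hεK
  have hεg0 : 0 < ε * g := by positivity
  have hm : 0 < q + ε * g := by positivity
  -- The tangent inequality for the conjugate exponent p/(p-1), taken at the larger point q + εg,
  -- bounds the increment of the nonlinearity from above.
  have hgap := (scalar_powGap (p := 1 + (p - 1)⁻¹) (by linarith) hq.le hm).1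
  have e1 : (q + ε * g) ^ (1 + (p - 1)⁻¹) = (q + ε * g) * (q + ε * g) ^ (p - 1)⁻¹ := by
    rw [Real.rpow_add hm, Real.rpow_one]
  have e2 : (q + ε * g) ^ (1 + (p - 1)⁻¹ - 1) = (q + ε * g) ^ (p - 1)⁻¹ := by
    rw [add_sub_cancel_left]
  have e3 : (p - 1) * (1 + (p - 1)⁻¹) = p := by
    rw [mul_add, mul_inv_cancel₀ hp1.ne']; ring
  have hCm : p * (q + ε * g) ^ (p - 1)⁻¹ ≤ C :=
    mul_le_mul_of_nonneg_left (Real.rpow_le_rpow hm.le (by linarith) ha.le) (by linarith)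
  have hincr : (p - 1) * (q + ε * g) ^ (1 + (p - 1)⁻¹) - (p - 1) * q ^ (1 + (p - 1)⁻¹) ≤
      C * (ε * g) := by
    refine le_trans ?_ (mul_le_mul_of_nonneg_right hCm hεg0.le)
    rw [e2] at hgap
    have h4 := mul_nonneg hp1.le hgap
    set X := (q + ε * g) ^ (p - 1)⁻¹
    rw [e1] at h4 ⊢
    linear_combination h4 + X * (ε * g) * e3
  have hexp : 1 + C + s ≤ Real.exp (C + s) := by linarith [Real.add_one_le_exp (C + s)]
  have h5 := mul_le_mul_of_nonneg_left hexp hεg0.le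
  have h6 : ε ≤ ε * g := le_mul_of_one_le_right hε.le hg1
  linarith

end Riccati

/-! ### The largest admissible parameter and blow-up at the endpoint -/

section Threshold

variable {p : ℝ}

theorem admissible_anti (hp : 1 < p) : Antitone (admissible hp) :=
  fun _ _ hst _ hl => ⟨hl.1, fun r hr => hl.2 r (hr.trans_le hst)⟩

theorem mem_admissible_of_le {hp : 1 < p} {l l' t : ℝ} (h : l' ∈ admissible hp t) (hl : 0 < l)
    (hle : l ≤ l') : l ∈ admissible hp t :=
  ⟨hl, fun s hs => lt_of_le_of_lt (flux_mono hle s) (h.2 s hs)⟩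

/-- The function q = c exp(exp s) satisfies q' ≥ q s + q. For small c, half of the spare q covers
the nonlinearity and the other half covers l = c/2. -/
theorem admissible_nonempty (hp : 1 < p) (t : ℝ) : (admissible hp t).Nonempty := by
  have hp1 : 0 < p - 1 := by linarith
  have ha : 0 < (p - 1)⁻¹ := inv_pos.2 hp1
  -- Chosen so that (p-1) m^(1/(p-1)) = 1/2; the factor exp(-exp t) in c then keeps the
  -- supersolution below m on (-∞, t).
  set m : ℝ := (2 * (p - 1)) ^ (-(p - 1))
  have hm : 0 < m := by positivity
  set c : ℝ := m * Real.exp (-Real.exp t)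
  have hc : 0 < c := by positivity
  refine ⟨c / 2, by positivity, fun s hs => ?_⟩
  have hgd : ∀ s, HasDerivAt (fun s => c * Real.exp (Real.exp s))
      (c * (Real.exp (Real.exp s) * Real.exp s)) s := fun s =>
    ((Real.hasDerivAt_exp s).exp).const_mul c
  refine lt_of_le_of_lt (flux_le_of_supersolution hp (by positivity : (0 : ℝ) ≤ c / 2) (t := t)
    (q := fun s => c * Real.exp (Real.exp s)) (fun s _ => by positivity) (fun s _ => hgd s)
    (fun s hs => ?_) s hs) ENNReal.ofReal_lt_top
  have hg1 : 1 ≤ Real.exp (Real.exp s) := Real.one_le_exp (Real.exp_pos _).le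
  set g := Real.exp (Real.exp s)
  have hq : 0 < c * g := by positivity
  have hqm : c * g ≤ m := by
    have : Real.exp (-Real.exp t) * g ≤ 1 := by
      rw [← Real.exp_add, Real.exp_le_one_iff]
      linarith [Real.exp_le_exp.2 hs.le]
    simp only [c]; rw [mul_assoc]
    exact mul_le_of_le_one_right hm.le this
  have e1 : (c * g) ^ (1 + (p - 1)⁻¹) = (c * g) * (c * g) ^ (p - 1)⁻¹ := by
    rw [Real.rpow_add hq, Real.rpow_one]
  have e2 : (p - 1) * (c * g) ^ (p - 1)⁻¹ ≤ 1 / 2 := by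
    have h1 := Real.rpow_le_rpow hq.le hqm ha.le
    have h2 : m ^ (p - 1)⁻¹ = (2 * (p - 1))⁻¹ := by
      simp only [m]
      rw [← Real.rpow_mul (by positivity), neg_mul, mul_inv_cancel₀ hp1.ne', Real.rpow_neg_one]
    rw [h2] at h1
    calc _ ≤ (p - 1) * (2 * (p - 1))⁻¹ := mul_le_mul_of_nonneg_left h1 hp1.le
      _ = 1 / 2 := by field_simp
  have h3 := mul_le_mul_of_nonneg_left e2 hq.le
  have h4 := mul_le_mul_of_nonneg_left (Real.add_one_le_exp s) hq.le
  have h5 : c ≤ c * g := le_mul_of_one_le_right hc.le hg1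
  rw [e1]
  nlinarith

/-- At t - 1 the flux is at least l times a Gaussian tail and, by the a priori bound at distance 1
from the endpoint, at most 1. -/
theorem bddAbove_admissible (hp : 1 < p) (t : ℝ) : BddAbove (admissible hp t) := by
  have hI : 0 < ∫ r in Iio (t - 1), bell r := by
    rw [setIntegral_pos_iff_support_of_nonneg_ae (ae_of_all _ fun x => (bell_pos x).le)
      integrable_bell.integrableOn]
    rw [show Function.support bell = univ from eq_univ_of_forall fun x => (bell_pos x).ne']
    simp
  refine ⟨1 / ∫ r in Iio (t - 1), bell r, fun l hl => ?_⟩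
  rw [le_div_iff₀ hI]
  have h1 := (flux_toReal_facts hp hl).1 (t - 1) (by linarith)
  have h2 := flux_toReal_le hp hl (show t - 1 < t by linarith)
  rw [sub_sub_cancel, Real.one_rpow] at h2
  exact h1.trans h2

/-- The largest parameter for which the minimal Riccati solution is finite on `(-∞, t)`. -/
def threshold (hp : 1 < p) (t : ℝ) : ℝ := sSup (admissible hp t)

theorem le_threshold {hp : 1 < p} {l t : ℝ} (h : l ∈ admissible hp t) : l ≤ threshold hp t :=
  le_csSup (bddAbove_admissible hp t) h

theorem threshold_pos (hp : 1 < p) (t : ℝ) : 0 < threshold hp t := by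
  obtain ⟨l, hl⟩ := admissible_nonempty hp t
  exact hl.1.trans_le (le_threshold hl)

theorem threshold_anti (hp : 1 < p) : Antitone (threshold hp) := fun s t hst =>
  csSup_le_csSup (bddAbove_admissible hp s) (admissible_nonempty hp t) (admissible_anti hp hst)

/-- Uniform bound on `(-∞, s)` for all admissible parameters. -/
theorem exists_riccati_bound (hp : 1 < p) {s t : ℝ} (hst : s < t) :
    ∃ K, 0 < K ∧ ∀ l ∈ admissible hp t, ∀ r ≤ s, riccati hp l r ≤ K :=
  ⟨1 + (t - s) ^ (-(p - 1)) * Real.exp (((threshold hp t + (p - 1)) ^ 2 + s ^ 2) / 2), by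
    have := Real.rpow_nonneg (sub_pos.2 hst).le (-(p - 1)); positivity,
    fun l hl r hr => riccati_le hp hl.1 (le_threshold hl) (hl.2 s hst)
      (flux_toReal_le hp hl hst) hr⟩

/-- Local Lipschitz dependence on the parameter. -/
theorem exists_riccati_lipschitz (hp : 1 < p) {s t : ℝ} (hst : s < t) :
    ∃ M, 0 < M ∧ ∀ l ∈ admissible hp t, ∀ l' > l, (l' - l) * M ≤ 1 →
      l' ∈ admissible hp s ∧ ∀ r < s, riccati hp l' r ≤ riccati hp l r + (l' - l) * M := by
  obtain ⟨K, hK0, hK⟩ := exists_riccati_bound hp hst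
  refine ⟨Real.exp (Real.exp (p * (K + 1) ^ (p - 1)⁻¹ + s)), Real.exp_pos _,
    fun l hl l' hl' hM => ?_⟩
  have hε : 0 < l' - l := sub_pos.2 hl'
  have key := flux_add_le hp (admissible_anti hp hst.le hl) hε
    (fun r hr => hK l hl r hr.le) hM
  rw [add_sub_cancel] at key
  refine ⟨⟨hl.1.trans hl', fun r hr => (key r hr).trans_lt ENNReal.ofReal_lt_top⟩,
    fun r hr => ?_⟩
  have h1 := ENNReal.toReal_mono ENNReal.ofReal_ne_top (key r hr)
  rw [ENNReal.toReal_ofReal (mul_nonneg (add_nonneg (riccati_nonneg hp l r) (by positivity))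
    (bell_pos r).le), ← riccati_mul_bell] at h1
  refine (le_of_mul_le_mul_right h1 (bell_pos r)).trans ?_
  gcongr

/-- For fixed s < t the Lipschitz constant M is the same for all admissible l, so an l within 1/M of
the supremum transfers finiteness at s to the supremum itself. -/
theorem threshold_mem (hp : 1 < p) (t : ℝ) : threshold hp t ∈ admissible hp t := by
  refine ⟨threshold_pos hp t, fun s hs => ?_⟩
  obtain ⟨s1, hss1, hs1⟩ := exists_between hs
  obtain ⟨M, hM0, hM⟩ := exists_riccati_lipschitz hp hs1
  obtain ⟨l, hl, hlt⟩ := exists_lt_of_lt_csSup (admissible_nonempty hp t)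
    (show threshold hp t - M⁻¹ < sSup (admissible hp t) by
      change _ < threshold hp t; linarith [inv_pos.2 hM0])
  rcases (le_threshold hl).lt_or_eq with h | h
  · refine (hM l hl _ h ?_).1.2 s hss1
    calc _ ≤ M⁻¹ * M := mul_le_mul_of_nonneg_right (by linarith) hM0.le
      _ = 1 := inv_mul_cancel₀ hM0.ne'
  · rw [← h]; exact hl.2 s hs

/-- A positive solution of the Riccati equation on `(-∞, t)`, bounded away from `t`, which blows
up at `t`. -/
structure IsBlowup (p l t : ℝ) (q : ℝ → ℝ) : Prop where
  pos : ∀ s < t, 0 < q s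
  ode : ∀ s < t, HasDerivAt q (l + s * q s + (p - 1) * q s ^ (1 + (p - 1)⁻¹)) s
  bdd : ∀ s < t, ∃ K, 0 < K ∧ ∀ r ≤ s, q r ≤ K
  blowup : Tendsto q (𝓝[<] t) atTop

/-- The flux is monotone, so if it is unbounded it tends to infinity at t, and `riccati` dominates
it because `bell` ≤ 1. -/
theorem isBlowup_or_bounded (hp : 1 < p) {l t : ℝ} (h : l ∈ admissible hp t) :
    IsBlowup p l t (riccati hp l) ∨ ∃ K, 0 < K ∧ ∀ r < t, riccati hp l r ≤ K := by
  by_cases hb : ∃ M, ∀ r < t, (flux hp l r).toReal ≤ M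
  · right
    obtain ⟨M, hM⟩ := hb
    have hM0 : 0 ≤ M := ENNReal.toReal_nonneg.trans (hM (t - 1) (by linarith))
    refine ⟨1 + M * Real.exp (((l + (p - 1)) ^ 2 + ((t - 1) ^ 2 + t ^ 2)) / 2),
      by positivity, fun r hr => ?_⟩
    rcases le_total r (t - 1) with h1 | h1
    · refine (riccati_le hp h.1 le_rfl (h.2 (t - 1) (by linarith)) (hM _ (by linarith))
        h1).trans ?_
      have := sq_nonneg t
      gcongr 1 + M * Real.exp ?_
      linarith
    · refine (riccati_le hp h.1 le_rfl (h.2 r hr) (hM _ hr) le_rfl).trans ?_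
      gcongr 1 + M * Real.exp ?_
      have : r ^ 2 ≤ (t - 1) ^ 2 + t ^ 2 := by
        rcases le_total 0 r with h0 | h0 <;> nlinarith [sq_nonneg (t - 1), sq_nonneg t]
      linarith
  · left
    push Not at hb
    refine ⟨fun s hs => riccati_pos hp h hs, fun s hs => hasDerivAt_riccati hp h hs,
      fun s hs => ?_, ?_⟩
    · obtain ⟨K, hK0, hK⟩ := exists_riccati_bound hp hs
      exact ⟨K, hK0, fun r hr => hK l h r hr⟩
    · rw [tendsto_atTop]
      intro M
      obtain ⟨r, hr, hMr⟩ := hb M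
      filter_upwards [Ioo_mem_nhdsLT hr] with s hs
      have h1 := ENNReal.toReal_mono (h.2 s hs.2).ne (monotone_flux hp l hs.1.le)
      have h2 : (flux hp l s).toReal ≤ riccati hp l s :=
        le_div_self ENNReal.toReal_nonneg (bell_pos s) (bell_le_one s)
      linarith

/-- If the solution stayed bounded up to t, the perturbation estimate would hold on all of (-∞, t)
and make a larger parameter admissible. -/
theorem isBlowup_threshold (hp : 1 < p) (t : ℝ) :
    IsBlowup p (threshold hp t) t (riccati hp (threshold hp t)) := by
  refine (isBlowup_or_bounded hp (threshold_mem hp t)).resolve_right ?_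
  rintro ⟨K, hK0, hK⟩
  set M := Real.exp (Real.exp (p * (K + 1) ^ (p - 1)⁻¹ + t))
  have hM : 0 < M := Real.exp_pos _
  have key := flux_add_le hp (threshold_mem hp t) (inv_pos.2 hM) hK (inv_mul_cancel₀ hM.ne').le
  have : threshold hp t + M⁻¹ ∈ admissible hp t :=
    ⟨add_pos (threshold_pos hp t) (inv_pos.2 hM),
      fun s hs => (key s hs).trans_lt ENNReal.ofReal_lt_top⟩
  linarith [le_threshold this, inv_pos.2 hM]

/-- If the minimal solution stays bounded up to `t`, slightly smaller parameters are admissible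
beyond `t`. -/
theorem mem_admissible_add (hp : 1 < p) {l t K δ : ℝ} (h : l ∈ admissible hp t)
    (hK : ∀ r < t, riccati hp l r ≤ K) (hδ : 0 ≤ δ) (hδK : δ * K < l) :
    l - δ * K ∈ admissible hp (t + δ) := by
  refine ⟨by linarith, fun s hs => ?_⟩
  -- The solution translated by δ has drift (s - δ) q instead of s q; the deficit δ q ≤ δ K is
  -- charged to the parameter.
  refine lt_of_le_of_lt (flux_le_of_supersolution hp (by linarith : 0 ≤ l - δ * K) (t := t + δ)
    (q := fun s => riccati hp l (s - δ)) (fun s _ => riccati_nonneg hp l _)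
    (fun s hs => (hasDerivAt_riccati hp h (show s - δ < t by linarith)).comp_sub_const s δ)
    (fun s hs => ?_) s hs) ENNReal.ofReal_lt_top
  have := mul_le_mul_of_nonneg_left (hK (s - δ) (by linarith)) hδ
  linarith

end Threshold

/-! ### From the Riccati solution to the eigenfunction profile -/

section Profile

variable {p l t a : ℝ} {q : ℝ → ℝ}

theorem contDiffOn_of_deriv_bootstrap {f g : ℝ → ℝ} {t : ℝ}
    (hd : ∀ s < t, HasDerivAt f (g s) s)
    (hb : ∀ n : ℕ, ContDiffOn ℝ n f (Iio t) → ContDiffOn ℝ n g (Iio t)) :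
    ContDiffOn ℝ ∞ f (Iio t) := by
  rw [contDiffOn_infty]
  intro n
  induction n with
  | zero =>
    exact contDiffOn_zero.2 fun s hs => (hd s hs).continuousAt.continuousWithinAt
  | succ n ih =>
    have h := (contDiffOn_succ_iff_deriv_of_isOpen (𝕜 := ℝ) (f := f) (n := (n : WithTop ℕ∞))
      isOpen_Iio).2 ⟨fun s hs => (hd s hs).differentiableAt.differentiableWithinAt, by simp,
        (hb n ih).congr fun s hs => (hd s hs).deriv⟩
    exact_mod_cast h

/-- The eigenfunction profile attached to a solution `q` of the Riccati equation, normalised to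
be `1` at `a`. -/
def profile (p t a : ℝ) (q : ℝ → ℝ) (s : ℝ) : ℝ :=
  -- The value 0 from t on is the limit at t for a blow-up solution with l > 0; it also lets
  -- integrals over the half-line be taken over the whole line.
  if s < t then Real.exp (-∫ x in a..s, q x ^ (p - 1)⁻¹) else 0

theorem profile_pos {s : ℝ} (hs : s < t) : 0 < profile p t a q s := by
  simp [profile, hs, Real.exp_pos]

theorem profile_nonneg (s : ℝ) : 0 ≤ profile p t a q s := by
  unfold profile; split_ifs <;> positivity

theorem profile_of_le {s : ℝ} (hs : t ≤ s) : profile p t a q s = 0 := by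
  simp [profile, not_lt.2 hs]

/-- The negative of the derivative of the profile. -/
def profileSlope (p t a : ℝ) (q : ℝ → ℝ) (s : ℝ) : ℝ := q s ^ (p - 1)⁻¹ * profile p t a q s

/-- The flux `q u ^ (p - 1) = |u'| ^ (p - 1)` of the profile. -/
def profileFlux (p t a : ℝ) (q : ℝ → ℝ) (s : ℝ) : ℝ := q s * profile p t a q s ^ (p - 1)

namespace IsBlowup

variable (h : IsBlowup p l t q) (hp : 1 < p)
include h hp

theorem contDiffOn : ContDiffOn ℝ ∞ q (Iio t) := by
  refine contDiffOn_of_deriv_bootstrap h.ode fun n hn => ?_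
  exact (contDiffOn_const.add (contDiffOn_id.mul hn)).add
    (contDiffOn_const.mul (hn.rpow_const_of_ne fun s hs => (h.pos s hs).ne'))

theorem hasDerivAt_profile (ha : a < t) {s : ℝ} (hs : s < t) :
    HasDerivAt (profile p t a q) (-profileSlope p t a q s) s := by
  have hk : ContinuousOn (fun x => q x ^ (p - 1)⁻¹) (Iio t) :=
    (h.contDiffOn hp).continuousOn.rpow_const fun x hx => Or.inl (h.pos x hx).ne'
  have hi : IntervalIntegrable (fun x => q x ^ (p - 1)⁻¹) volume a s :=
    (hk.mono fun x hx => lt_of_le_of_lt hx.2 (max_lt ha hs)).intervalIntegrable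
  have h1 := intervalIntegral.integral_hasDerivAt_right hi
    (hk.stronglyMeasurableAtFilter isOpen_Iio s hs) (hk.continuousAt (Iio_mem_nhds hs))
  have h2 := (h1.neg).exp
  have h3 : profile p t a q =ᶠ[𝓝 s] fun s => Real.exp (-∫ x in a..s, q x ^ (p - 1)⁻¹) := by
    filter_upwards [Iio_mem_nhds hs] with x hx
    simp [profile, show x < t from hx]
  refine (h2.congr_of_eventuallyEq h3).congr_deriv ?_
  simp only [profileSlope, profile, hs, if_true, Pi.neg_apply]; ring

theorem contDiffOn_profile (ha : a < t) : ContDiffOn ℝ ∞ (profile p t a q) (Iio t) := by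
  refine contDiffOn_of_deriv_bootstrap (fun s hs => h.hasDerivAt_profile hp ha hs) fun n hn => ?_
  exact (((((h.contDiffOn hp).of_le (by exact_mod_cast le_top)).rpow_const_of_ne
    fun s hs => (h.pos s hs).ne')).mul hn).neg

theorem profileSlope_eq {s : ℝ} (hs : s < t) :
    profileSlope p t a q s = profileFlux p t a q s ^ (p - 1)⁻¹ := by
  have hu := profile_pos (p := p) (a := a) (q := q) hs
  unfold profileSlope profileFlux
  rw [Real.mul_rpow (h.pos s hs).le (Real.rpow_nonneg hu.le _), ← Real.rpow_mul hu.le,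
    mul_inv_cancel₀ (by linarith), Real.rpow_one]

theorem profileFlux_pos {s : ℝ} (hs : s < t) : 0 < profileFlux p t a q s :=
  mul_pos (h.pos s hs) (Real.rpow_pos_of_pos (profile_pos hs) _)

theorem profileSlope_pos {s : ℝ} (hs : s < t) : 0 < profileSlope p t a q s :=
  mul_pos (Real.rpow_pos_of_pos (h.pos s hs) _) (profile_pos hs)

/-- The eigenvalue equation in flux form: the nonlinear term of the Riccati equation cancels against
the derivative of u^(p-1). -/
theorem hasDerivAt_profileFlux (ha : a < t) {s : ℝ} (hs : s < t) :
    HasDerivAt (profileFlux p t a q)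
      (l * profile p t a q s ^ (p - 1) + s * profileFlux p t a q s) s := by
  have hu := profile_pos (p := p) (a := a) (q := q) hs
  have hq := h.pos s hs
  have h1 := (h.ode s hs).mul ((h.hasDerivAt_profile hp ha hs).rpow_const (p := p - 1)
    (Or.inl hu.ne'))
  refine h1.congr_deriv ?_
  unfold profileFlux profileSlope
  have e1 : profile p t a q s ^ (p - 1) =
      profile p t a q s ^ (p - 1 - 1) * profile p t a q s := by
    rw [← Real.rpow_add_one hu.ne']; ring_nf
  have e2 : q s ^ (1 + (p - 1)⁻¹) = q s * q s ^ (p - 1)⁻¹ := by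
    rw [Real.rpow_add hq, Real.rpow_one]
  rw [e1, e2]; ring

theorem profile_le_one {s : ℝ} (has : a ≤ s) : profile p t a q s ≤ 1 := by
  unfold profile
  split_ifs with hs
  · rw [Real.exp_le_one_iff, neg_nonpos]
    refine intervalIntegral.integral_nonneg has fun x hx => Real.rpow_nonneg (h.pos x ?_).le _
    exact hx.2.trans_lt hs
  · exact zero_le_one

theorem profile_le_exp (ha : a < t) {K s : ℝ} (hK : ∀ r ≤ a, q r ≤ K) (hs : s ≤ a) :
    profile p t a q s ≤ Real.exp (K ^ (p - 1)⁻¹ * (a - s)) := by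
  unfold profile
  rw [if_pos (hs.trans_lt ha)]
  refine Real.exp_le_exp.2 ?_
  rw [← intervalIntegral.integral_symm]
  have hk : ContinuousOn (fun x => q x ^ (p - 1)⁻¹) (Icc s a) :=
    ((h.contDiffOn hp).continuousOn.rpow_const fun x hx => Or.inl (h.pos x hx).ne').mono
      fun x hx => hx.2.trans_lt ha
  have h1 := intervalIntegral.integral_mono_on (f := fun x => q x ^ (p - 1)⁻¹)
    (g := fun _ => K ^ (p - 1)⁻¹) hs (hk.intervalIntegrable_of_Icc hs)
    (intervalIntegrable_const (μ := volume))
    fun x hx => Real.rpow_le_rpow (h.pos x (hx.2.trans_lt ha)).le (hK x hx.2)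
      (inv_nonneg.2 (by linarith))
  rw [intervalIntegral.integral_const, smul_eq_mul, mul_comm] at h1
  exact h1

theorem hasDerivAt_profileFlux_mul_bell (ha : a < t) {s : ℝ} (hs : s < t) :
    HasDerivAt (fun s => profileFlux p t a q s * bell s)
      (l * profile p t a q s ^ (p - 1) * bell s) s :=
  ((h.hasDerivAt_profileFlux hp ha hs).mul (hasDerivAt_bell s)).congr_deriv (by ring)

/-- To the right of a the profile and `bell` are at most 1, so the weighted flux grows at rate at
most l. -/
theorem profileFlux_mul_bell_le (hl : 0 < l) (ha : a < t) {s : ℝ} (has : a ≤ s) (hs : s < t) :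
    profileFlux p t a q s * bell s ≤ q a + l * (s - a) := by
  have h1 := (convex_Icc a s).image_sub_le_mul_sub_of_deriv_le
    (f := fun s => profileFlux p t a q s * bell s) (C := l)
    (fun x hx => (h.hasDerivAt_profileFlux_mul_bell hp ha
      (hx.2.trans_lt hs)).continuousAt.continuousWithinAt)
    (fun x hx => (h.hasDerivAt_profileFlux_mul_bell hp ha
      ((interior_subset hx).2.trans_lt hs)).differentiableAt.differentiableWithinAt) ?_ a
    (left_mem_Icc.2 has) s (right_mem_Icc.2 has) has
  · have h2 : profileFlux p t a q a * bell a ≤ q a := by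
      have : profile p t a q a = 1 := by simp [profile, ha]
      simp only [profileFlux, this, Real.one_rpow, mul_one]
      exact mul_le_of_le_one_right (h.pos a ha).le (bell_le_one a)
    linarith
  · intro x hx
    have hx' := interior_subset hx
    rw [(h.hasDerivAt_profileFlux_mul_bell hp ha (hx'.2.trans_lt hs)).deriv, mul_assoc]
    refine mul_le_of_le_one_right hl.le (mul_le_one₀ ?_ (bell_pos x).le (bell_le_one x))
    exact Real.rpow_le_one (profile_nonneg x) (h.profile_le_one hp hx'.1) (by linarith)

/-- The weighted flux is increasing, positive and bounded, hence converges to a positive limit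
although q itself explodes. This gives the non-zero boundary slope. -/
theorem exists_tendsto_profileFlux (hl : 0 < l) (ha : a < t) :
    ∃ H, 0 < H ∧ Tendsto (profileFlux p t a q) (𝓝[<] t) (𝓝 H) := by
  have hmono : MonotoneOn (fun s => profileFlux p t a q s * bell s) (Iio t) := by
    refine monotoneOn_of_deriv_nonneg (convex_Iio t)
      (fun x hx => (h.hasDerivAt_profileFlux_mul_bell hp ha hx).continuousAt.continuousWithinAt)
      (fun x hx => (h.hasDerivAt_profileFlux_mul_bell hp ha
        (show x ∈ Iio t from interior_subset hx)).differentiableAt.differentiableWithinAt)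
        fun x hx => ?_
    rw [(h.hasDerivAt_profileFlux_mul_bell hp ha (show x ∈ Iio t from interior_subset hx)).deriv]
    have := bell_pos x
    have := Real.rpow_nonneg (profile_nonneg (p := p) (t := t) (a := a) (q := q) x) (p - 1)
    positivity
  have hbdd : BddAbove ((fun s => profileFlux p t a q s * bell s) '' Iio t) := by
    refine ⟨q a + l * (t - a), ?_⟩
    rintro _ ⟨s, hs, rfl⟩
    have hs : s < t := hs
    have h1 := hmono hs (show max s a ∈ Iio t from max_lt hs ha) (le_max_left s a)
    refine h1.trans ((h.profileFlux_mul_bell_le hp hl ha (le_max_right s a)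
      (max_lt hs ha)).trans ?_)
    have := (max_lt hs ha).le
    gcongr
  have hlim := hmono.tendsto_nhdsLT hbdd
  set S := sSup ((fun s => profileFlux p t a q s * bell s) '' Iio t)
  have hS : 0 < S := lt_of_lt_of_le (mul_pos (h.profileFlux_pos hp ha) (bell_pos a))
    (le_csSup hbdd ⟨a, ha, rfl⟩)
  refine ⟨S / bell t, div_pos hS (bell_pos t), ?_⟩
  have h2 := hlim.div (continuous_bell.continuousAt.mono_left nhdsWithin_le_nhds)
    (bell_pos t).ne'
  refine h2.congr fun s => ?_
  exact mul_div_cancel_right₀ _ (bell_pos s).ne'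

/-- u^(p-1) is the flux divided by q, with a finite numerator limit and q → ∞. Blow-up is thus
exactly the Dirichlet condition. -/
theorem tendsto_profile (hl : 0 < l) (ha : a < t) :
    Tendsto (profile p t a q) (𝓝[<] t) (𝓝 0) := by
  obtain ⟨H, -, hH⟩ := h.exists_tendsto_profileFlux hp hl ha
  have h1 : Tendsto (fun s => profile p t a q s ^ (p - 1)) (𝓝[<] t) (𝓝 0) := by
    refine (hH.div_atTop h.blowup).congr' ?_
    filter_upwards [self_mem_nhdsWithin] with s hs
    exact mul_div_cancel_left₀ _ (h.pos s hs).ne'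
  have hp1 : 0 < (p - 1)⁻¹ := inv_pos.2 (by linarith)
  have h2 := h1.rpow_const (p := (p - 1)⁻¹) (Or.inr hp1.le)
  rw [Real.zero_rpow hp1.ne'] at h2
  refine h2.congr fun s => ?_
  rw [← Real.rpow_mul (profile_nonneg s), mul_inv_cancel₀ (by linarith), Real.rpow_one]

theorem continuousOn_profile (hl : 0 < l) (ha : a < t) :
    ContinuousOn (profile p t a q) (Iic t) := by
  intro s hs
  rcases (show s ≤ t from hs).lt_or_eq with hs | rfl
  · exact (h.hasDerivAt_profile hp ha hs).continuousAt.continuousWithinAt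
  · have h1 := h.tendsto_profile hp hl ha
    rw [← Iio_insert, continuousWithinAt_insert_self]
    unfold ContinuousWithinAt
    rwa [profile_of_le le_rfl]

/-- The profile is `C¹` up to the boundary, with non-vanishing derivative there. -/
theorem exists_boundary_slope (hl : 0 < l) (ha : a < t) :
    ∃ σ, 0 < σ ∧ Tendsto (profileSlope p t a q) (𝓝[<] t) (𝓝 σ) ∧
      HasDerivWithinAt (profile p t a q) (-σ) (Iic t) t ∧
      ContDiffOn ℝ 1 (profile p t a q) (Iic t) := by
  obtain ⟨H, hH0, hH⟩ := h.exists_tendsto_profileFlux hp hl ha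
  have hp1 : 0 < (p - 1)⁻¹ := inv_pos.2 (by linarith)
  have hslope : Tendsto (profileSlope p t a q) (𝓝[<] t) (𝓝 (H ^ (p - 1)⁻¹)) := by
    refine (hH.rpow_const (p := (p - 1)⁻¹) (Or.inl hH0.ne')).congr' ?_
    filter_upwards [self_mem_nhdsWithin] with s hs
    exact (h.profileSlope_eq hp hs).symm
  have hder : Tendsto (deriv (profile p t a q)) (𝓝[<] t) (𝓝 (-(H ^ (p - 1)⁻¹))) := by
    refine hslope.neg.congr' ?_
    filter_upwards [self_mem_nhdsWithin] with s hs
    exact (h.hasDerivAt_profile hp ha hs).deriv.symm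
  have hcont : ContinuousOn (profile p t a q) (Iic t) := h.continuousOn_profile hp hl ha
  have hend : HasDerivWithinAt (profile p t a q) (-(H ^ (p - 1)⁻¹)) (Iic t) t :=
    hasDerivWithinAt_Iic_of_tendsto_deriv (s := Iio t)
      (fun s hs => (h.hasDerivAt_profile hp ha hs).differentiableAt.differentiableWithinAt)
      ((hcont t self_mem_Iic).mono Iio_subset_Iic_self) self_mem_nhdsWithin hder
  refine ⟨_, Real.rpow_pos_of_pos hH0 _, hslope, hend, ?_⟩
  have hdw : ∀ s < t, HasDerivWithinAt (profile p t a q) (-profileSlope p t a q s) (Iic t) s :=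
    fun s hs => (h.hasDerivAt_profile hp ha hs).hasDerivWithinAt
  have huniq : UniqueDiffOn ℝ (Iic t) := uniqueDiffOn_Iic t
  refine (contDiffOn_succ_iff_derivWithin (n := 0) huniq).2 ⟨fun s hs => ?_, by simp, ?_⟩
  · rcases (show s ≤ t from hs).lt_or_eq with hs | rfl
    · exact (hdw s hs).differentiableWithinAt
    · exact hend.differentiableWithinAt
  · rw [contDiffOn_zero]
    intro s hs
    rcases (show s ≤ t from hs).lt_or_eq with hs | rfl
    · have hc : ContinuousAt (profileSlope p t a q) s :=
        (((h.contDiffOn hp).continuousOn.continuousAt (Iio_mem_nhds hs)).rpow_const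
          (Or.inl (h.pos s hs).ne')).mul (h.hasDerivAt_profile hp ha hs).continuousAt
      refine (hc.neg.congr ?_).continuousWithinAt
      filter_upwards [Iio_mem_nhds hs] with r hr
      exact ((hdw r hr).derivWithin (huniq r (Iio_subset_Iic_self hr))).symm
    · rw [← Iio_insert, continuousWithinAt_insert_self, Iio_insert]
      unfold ContinuousWithinAt
      rw [hend.derivWithin (huniq s self_mem_Iic)]
      refine hslope.neg.congr' ?_
      filter_upwards [self_mem_nhdsWithin] with r hr
      exact ((hdw r hr).derivWithin (huniq r (Iio_subset_Iic_self hr))).symm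

end IsBlowup

/-- Exponential growth bounds, uniform in the data. -/
theorem exists_profile_bounds (hp : 1 < p) (a b : ℝ) {K Λ : ℝ} (hK : 0 < K) (hΛ : 0 < Λ)
    (hab : a ≤ b) : ∃ M c, 0 < M ∧ 0 < c ∧ ∀ l t q, IsBlowup p l t q → 0 < l → l ≤ Λ → a < t →
      t ≤ b → (∀ r ≤ a, q r ≤ K) → ∀ s < t, profile p t a q s ≤ M * Real.exp (c * |s|) ∧
        profileSlope p t a q s ≤ M * Real.exp (c * |s|) := by
  have hα : 0 < (p - 1)⁻¹ := inv_pos.2 (by linarith)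
  set c := K ^ (p - 1)⁻¹
  have hc : 0 < c := Real.rpow_pos_of_pos hK _
  -- Bounds the slope on [a, t): the first factor bounds the weighted flux and the exponential
  -- bounds 1/`bell` on [a, b]. To the left of a the bound K on q gives exponential growth with rate
  -- c.
  set B := ((K + Λ * (b - a)) * Real.exp ((a ^ 2 + b ^ 2) / 2)) ^ (p - 1)⁻¹
  have hB : 0 < B := by
    have := sub_nonneg.2 hab; positivity
  refine ⟨Real.exp (c * |a|) * (1 + c) + 1 + B, c, by positivity, hc,
    fun l t q h hl hlΛ hat htb hqK s hs => ?_⟩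
  have he1 : 1 ≤ Real.exp (c * |s|) := Real.one_le_exp (by positivity)
  have hea : 0 < Real.exp (c * |a|) := Real.exp_pos _
  rcases le_total s a with hsa | has
  · have h1 : profile p t a q s ≤ Real.exp (c * |a|) * Real.exp (c * |s|) := by
      refine (h.profile_le_exp hp hat hqK hsa).trans ?_
      rw [← Real.exp_add]
      refine Real.exp_le_exp.2 ?_
      rw [← mul_add]
      exact mul_le_mul_of_nonneg_left (by linarith [le_abs_self a, neg_abs_le s]) hc.le
    have h2 : q s ^ (p - 1)⁻¹ ≤ c := Real.rpow_le_rpow (h.pos s hs).le (hqK s hsa) hα.le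
    have hes : 0 < Real.exp (c * |s|) := Real.exp_pos _
    have hu := profile_pos (p := p) (a := a) (q := q) hs
    have h3 : profileSlope p t a q s ≤ c * (Real.exp (c * |a|) * Real.exp (c * |s|)) :=
      mul_le_mul h2 h1 hu.le hc.le
    have h4 : 0 < Real.exp (c * |a|) * Real.exp (c * |s|) := by positivity
    have h5 := mul_pos hB hes
    have h6 := mul_pos hc h4
    constructor <;> nlinarith
  · have h1 : profile p t a q s ≤ 1 := h.profile_le_one hp has
    have h2 : profileSlope p t a q s ≤ B := by
      rw [h.profileSlope_eq hp hs]
      refine Real.rpow_le_rpow (h.profileFlux_pos hp hs).le ?_ hα.le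
      have h3 := h.profileFlux_mul_bell_le hp hl hat has hs
      have h4 : profileFlux p t a q s * bell s ≤ K + Λ * (b - a) := by
        refine h3.trans (add_le_add (hqK a le_rfl) (mul_le_mul hlΛ (by linarith) (by linarith)
          hΛ.le))
      have h5 : 1 ≤ bell s * Real.exp ((a ^ 2 + b ^ 2) / 2) := by
        unfold bell
        rw [← Real.exp_add]
        refine Real.one_le_exp ?_
        have : s ^ 2 ≤ a ^ 2 + b ^ 2 := by
          rcases le_total 0 s with h0 | h0
          · nlinarith [sq_nonneg a, hs.trans_le htb]
          · nlinarith [sq_nonneg b]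
        linarith
      calc profileFlux p t a q s ≤ profileFlux p t a q s *
            (bell s * Real.exp ((a ^ 2 + b ^ 2) / 2)) :=
            le_mul_of_one_le_right (h.profileFlux_pos hp hs).le h5
        _ = profileFlux p t a q s * bell s * Real.exp ((a ^ 2 + b ^ 2) / 2) := by ring
        _ ≤ _ := mul_le_mul_of_nonneg_right h4 (Real.exp_pos _).le
    have h7 := mul_le_mul_of_nonneg_left he1 hB.le
    have h8 : 0 < Real.exp (c * |a|) * (1 + c) * Real.exp (c * |s|) := by positivity
    constructor <;> nlinarith

end Profile

/-! ### Limits of integrals under convergence in the Lebesgue norm -/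

section LpLimits

variable {X : Type*} [MeasurableSpace X] {μ : Measure X} {F : Type*} [NormedAddCommGroup F]
  {p : ℝ}

theorem tendsto_eLpNorm_zero_of_dominated (hp : 0 < p) {f : ℕ → X → F} {g : X → ℝ}
    (hg : MemLp g (ENNReal.ofReal p) μ) (hm : ∀ n, AEStronglyMeasurable (f n) μ)
    (hb : ∀ n, ∀ᵐ x ∂μ, ‖f n x‖ ≤ g x) (hlim : ∀ᵐ x ∂μ, ∀ᶠ n in atTop, f n x = 0) :
    Tendsto (fun n => eLpNorm (f n) (ENNReal.ofReal p) μ) atTop (𝓝 0) := by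
  have hp0 : ENNReal.ofReal p ≠ 0 := by simpa using hp
  have hpt : ENNReal.ofReal p ≠ ⊤ := ENNReal.ofReal_ne_top
  simp only [eLpNorm_eq_lintegral_rpow_enorm_toReal hp0 hpt, ENNReal.toReal_ofReal hp.le]
  have h1 : Tendsto (fun n => ∫⁻ x, ‖f n x‖ₑ ^ p ∂μ) atTop (𝓝 (∫⁻ _, 0 ∂μ)) := by
    refine tendsto_lintegral_of_dominated_convergence' (fun x => ‖g x‖ₑ ^ p)
      (fun n => (hm n).enorm.pow_const p) (fun n => ?_) ?_ ?_
    · filter_upwards [hb n] with x hx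
      refine ENNReal.rpow_le_rpow ?_ hp.le
      rw [enorm_le_iff_norm_le]
      exact hx.trans (Real.le_norm_self _)
    · have := hg.eLpNorm_lt_top
      rw [eLpNorm_lt_top_iff_lintegral_rpow_enorm_lt_top hp0 hpt, ENNReal.toReal_ofReal hp.le]
        at this
      exact this.ne
    · filter_upwards [hlim] with x hx
      refine tendsto_const_nhds.congr' ?_
      filter_upwards [hx] with n hn
      simp [hn, hp]
  rw [lintegral_zero] at h1
  have h2 := (ENNReal.continuous_rpow_const (y := 1 / p)).tendsto 0 |>.comp h1
  rwa [ENNReal.zero_rpow_of_pos (by positivity)] at h2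

theorem tendsto_integral_norm_rpow (hp : 1 < p) {f : X → F} {g : ℕ → X → F}
    (hf : MemLp f (ENNReal.ofReal p) μ) (hg : ∀ n, MemLp (g n) (ENNReal.ofReal p) μ)
    (hlim : Tendsto (fun n => eLpNorm (f - g n) (ENNReal.ofReal p) μ) atTop (𝓝 0)) :
    Tendsto (fun n => ∫ x, ‖g n x‖ ^ p ∂μ) atTop (𝓝 (∫ x, ‖f x‖ ^ p ∂μ)) := by
  have hp0 : ENNReal.ofReal p ≠ 0 := by simp; linarith
  have hpt : ENNReal.ofReal p ≠ ⊤ := ENNReal.ofReal_ne_top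
  have : Fact (1 ≤ ENNReal.ofReal p) := ⟨by simpa using hp.le⟩
  have h1 := (Lp.tendsto_Lp_iff_tendsto_eLpNorm'' g hg f hf).2
    (by simpa only [eLpNorm_sub_comm] using hlim)
  have h2 := (h1.norm).rpow_const (p := p) (Or.inr (by linarith))
  have key : ∀ (v : X → F) (hv : MemLp v (ENNReal.ofReal p) μ),
      ‖hv.toLp v‖ ^ p = ∫ x, ‖v x‖ ^ p ∂μ := fun v hv => by
    have h0 : 0 ≤ ∫ x, ‖v x‖ ^ p ∂μ := integral_nonneg fun x => by positivity
    rw [Lp.norm_toLp, hv.eLpNorm_eq_integral_rpow_norm hp0 hpt,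
      ENNReal.toReal_ofReal (show 0 ≤ p by linarith), ENNReal.toReal_ofReal (by positivity),
      ← Real.rpow_mul h0, inv_mul_cancel₀ (by linarith), Real.rpow_one]
  simpa only [key] using h2

theorem tendsto_integral_mul_of_eLpNorm (hp : 1 < p) {f g : X → ℝ} {h : ℕ → X → ℝ}
    (hf : MemLp f (ENNReal.ofReal (p / (p - 1))) μ) (hg : MemLp g (ENNReal.ofReal p) μ)
    (hh : ∀ n, MemLp (h n) (ENNReal.ofReal p) μ)
    (hlim : Tendsto (fun n => eLpNorm (g - h n) (ENNReal.ofReal p) μ) atTop (𝓝 0)) :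
    Tendsto (fun n => ∫ x, f x * h n x ∂μ) atTop (𝓝 (∫ x, f x * g x ∂μ)) := by
  have hpq : p.HolderConjugate (p / (p - 1)) := Real.HolderConjugate.conjExponent hp
  have inst : (ENNReal.ofReal (p / (p - 1))).HolderConjugate (ENNReal.ofReal p) :=
    hpq.symm.ennrealOfReal
  rw [tendsto_iff_edist_tendsto_0]
  have hup : Tendsto (fun n => eLpNorm f (ENNReal.ofReal (p / (p - 1))) μ *
      eLpNorm (g - h n) (ENNReal.ofReal p) μ) atTop (𝓝 0) := by
    have := ENNReal.Tendsto.const_mul hlim (Or.inr hf.eLpNorm_ne_top)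
    simpa using this
  refine tendsto_of_tendsto_of_tendsto_of_le_of_le tendsto_const_nhds hup (fun n => zero_le)
    fun n => ?_
  have i1 : Integrable (fun x => f x * h n x) μ := hf.integrable_mul (hh n)
  have i2 : Integrable (fun x => f x * g x) μ := hf.integrable_mul hg
  have h3 := eLpNorm_smul_le_mul_eLpNorm (r := 1) (hg.sub (hh n)).1 hf.1
    (p := ENNReal.ofReal (p / (p - 1))) (q := ENNReal.ofReal p)
  refine le_trans ?_ h3
  simp only
  rw [edist_comm, edist_eq_enorm_sub, ← integral_sub i2 i1, eLpNorm_one_eq_lintegral_enorm]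
  refine (enorm_integral_le_lintegral_enorm _).trans (le_of_eq ?_)
  refine lintegral_congr fun x => ?_
  simp [mul_sub]

end LpLimits

/-! ### Test-function approximation and membership in W₀ -/

section Membership

variable {E : Type*} [NormedAddCommGroup E] [InnerProductSpace ℝ E] [CompleteSpace E]
  [FiniteDimensional ℝ E] [MeasureSpace E] [BorelSpace E] [(volume : Measure E).IsAddHaarMeasure]

theorem integrable_of_continuousOn_of_eq_zero {F : Type*} [NormedAddCommGroup F]
    {Ω K : Set E} {g : E → F} (hΩ : IsOpen Ω) (hg : ContinuousOn g Ω) (hK : IsCompact K)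
    (hKΩ : K ⊆ Ω) (h0 : ∀ x ∉ K, g x = 0) : Continuous g ∧ Integrable g := by
  have hc : Continuous g := by
    rw [continuous_iff_continuousAt]
    intro x
    by_cases hx : x ∈ K
    · exact hg.continuousAt (hΩ.mem_nhds (hKΩ hx))
    · have : g =ᶠ[𝓝 x] fun _ => 0 := by
        filter_upwards [hK.isClosed.isOpen_compl.mem_nhds hx] with y hy using h0 y hy
      exact continuousAt_const.congr this.symm
  exact ⟨hc, hc.integrable_of_hasCompactSupport (HasCompactSupport.intro hK h0)⟩

namespace IsTestFunction

variable {Ω : Set E} {ψ : E → ℝ} (hψ : IsTestFunction Ω ψ)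
include hψ

theorem continuous_fderiv : Continuous (fderiv ℝ ψ) := hψ.1.continuous_fderiv (by simp)

theorem differentiable : Differentiable ℝ ψ := hψ.1.differentiable (by simp)

theorem continuous_gradient : Continuous (gradient ψ) :=
  (InnerProductSpace.toDual ℝ E).symm.continuous.comp hψ.continuous_fderiv

theorem eq_zero {x : E} (hx : x ∉ tsupport ψ) : ψ x = 0 := image_eq_zero_of_notMem_tsupport hx

theorem fderiv_eq_zero {x : E} (hx : x ∉ tsupport ψ) : fderiv ℝ ψ x = 0 := by
  rw [(notMem_tsupport_iff_eventuallyEq.1 hx).fderiv_eq]; simp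

theorem gradient_eq_zero {x : E} (hx : x ∉ tsupport ψ) : gradient ψ x = 0 := by
  unfold gradient; rw [hψ.fderiv_eq_zero hx]; simp

theorem memLp {p : ℝ} (hp : 0 < p) (hΩ : MeasurableSet Ω) :
    MemLp ψ (ENNReal.ofReal p) ((gaussMeasure E).restrict Ω) := by
  obtain ⟨C, hC⟩ := hψ.2.1.exists_bound_of_continuous hψ.1.continuous
  exact memLp_of_norm_le_exp hp (M := C) (c := 0) hΩ hψ.1.continuous.aestronglyMeasurable
    fun x _ => by simpa using hC x

theorem memLp_gradient {p : ℝ} (hp : 0 < p) (hΩ : MeasurableSet Ω) :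
    MemLp (gradient ψ) (ENNReal.ofReal p) ((gaussMeasure E).restrict Ω) := by
  obtain ⟨C, hC⟩ := (HasCompactSupport.intro hψ.2.1 fun x hx =>
    hψ.gradient_eq_zero hx).exists_bound_of_continuous hψ.continuous_gradient
  exact memLp_of_norm_le_exp hp (M := C) (c := 0) hΩ hψ.continuous_gradient.aestronglyMeasurable
    fun x _ => by simpa using hC x

end IsTestFunction

theorem MemW0.exists_seq {p : ℝ} (hp : 1 < p) {Ω : Set E} (hΩ : MeasurableSet Ω) {w : E → ℝ}
    {G : E → E} (h : MemW0 p Ω w G) : ∃ ψ : ℕ → E → ℝ, (∀ n, IsTestFunction Ω (ψ n)) ∧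
      Tendsto (fun n => eLpNorm (w - ψ n) (ENNReal.ofReal p) ((gaussMeasure E).restrict Ω))
        atTop (𝓝 0) ∧
      Tendsto (fun n => eLpNorm (G - gradient (ψ n)) (ENNReal.ofReal p)
        ((gaussMeasure E).restrict Ω)) atTop (𝓝 0) ∧
      (∀ᵐ x ∂(gaussMeasure E).restrict Ω, Tendsto (fun n => ψ n x) atTop (𝓝 (w x))) ∧
      ∀ᵐ x ∂(gaussMeasure E).restrict Ω, Tendsto (fun n => gradient (ψ n) x) atTop (𝓝 (G x)) := by
  have hp0 : ENNReal.ofReal p ≠ 0 := by simp; linarith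
  choose ψ hψ hlt using fun n : ℕ => h.2 ((n : ENNReal) + 1)⁻¹ (by simp)
  have hz : Tendsto (fun n : ℕ => ((n : ENNReal) + 1)⁻¹) atTop (𝓝 0) := by
    have := ENNReal.tendsto_inv_nat_nhds_zero.comp (tendsto_add_atTop_nat 1)
    refine this.congr fun n => by simp
  have hw : Tendsto (fun n => eLpNorm (w - ψ n) (ENNReal.ofReal p)
      ((gaussMeasure E).restrict Ω)) atTop (𝓝 0) :=
    tendsto_of_tendsto_of_tendsto_of_le_of_le tendsto_const_nhds hz (fun n => zero_le)
      fun n => le_self_add.trans (hlt n).le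
  have hG : Tendsto (fun n => eLpNorm (G - gradient (ψ n)) (ENNReal.ofReal p)
      ((gaussMeasure E).restrict Ω)) atTop (𝓝 0) :=
    tendsto_of_tendsto_of_tendsto_of_le_of_le tendsto_const_nhds hz (fun n => zero_le)
      fun n => le_add_self.trans (hlt n).le
  obtain ⟨k, hk, hkae⟩ := (tendstoInMeasure_of_tendsto_eLpNorm hp0
    (fun n => ((hψ n).memLp (by linarith) hΩ).1) h.1.2.1.1
    (by simpa only [eLpNorm_sub_comm] using hw)).exists_seq_tendsto_ae
  -- A second extraction along the first subsequence gives almost-everywhere convergence of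
  -- functions and gradients simultaneously.
  obtain ⟨j, hj, hjae⟩ := (tendstoInMeasure_of_tendsto_eLpNorm (f := fun n => gradient (ψ (k n)))
    hp0 (fun n => ((hψ (k n)).memLp_gradient (by linarith) hΩ).1) h.1.2.2.1
    (by simpa only [eLpNorm_sub_comm] using! hG.comp hk.tendsto_atTop)).exists_seq_tendsto_ae
  refine ⟨fun n => ψ (k (j n)), fun n => hψ _, hw.comp (hk.comp hj).tendsto_atTop,
    hG.comp (hk.comp hj).tendsto_atTop, ?_, hjae⟩
  filter_upwards [hkae] with x hx using hx.comp hj.tendsto_atTop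

/-- Smooth truncation of small values. -/
theorem exists_smooth_truncation : ∃ θ : ℝ → ℝ, ∃ C, 0 < C ∧ ContDiff ℝ ∞ θ ∧
    (∀ r ≤ 1, θ r = 0) ∧ (∀ r, 2 ≤ r → θ r = r) ∧ (∀ r, 0 ≤ r → |θ r| ≤ r) ∧
    ∀ r, |deriv θ r| ≤ C := by
  set θ : ℝ → ℝ := fun r => r * Real.smoothTransition (r - 1)
  have hθ : ContDiff ℝ ∞ θ :=
    contDiff_id.mul (Real.smoothTransition.contDiff.comp (contDiff_id.sub contDiff_const))
  have h1 : ∀ r ≤ 1, θ r = 0 := fun r hr => by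
    simp [θ, Real.smoothTransition.zero_of_nonpos (show r - 1 ≤ 0 by linarith)]
  have h2 : ∀ r, 2 ≤ r → θ r = r := fun r hr => by
    simp [θ, Real.smoothTransition.one_of_one_le (show 1 ≤ r - 1 by linarith)]
  obtain ⟨C, hC⟩ := (isCompact_Icc (a := (1 : ℝ)) (b := 2)).exists_bound_of_continuousOn
    (hθ.continuous_deriv (by simp)).continuousOn
  refine ⟨θ, max C 1, by positivity, hθ, h1, h2, fun r hr => ?_, fun r => ?_⟩
  · simp only [θ, abs_mul, abs_of_nonneg hr, abs_of_nonneg (Real.smoothTransition.nonneg _)]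
    exact mul_le_of_le_one_right hr (Real.smoothTransition.le_one _)
  · by_cases hr1 : r < 1
    · have : θ =ᶠ[𝓝 r] fun _ => 0 := by
        filter_upwards [Iio_mem_nhds hr1] with x hx using h1 x (le_of_lt hx)
      rw [this.deriv_eq]; simp
    by_cases hr2 : 2 < r
    · have : θ =ᶠ[𝓝 r] fun x => x := by
        filter_upwards [Ioi_mem_nhds hr2] with x hx using h2 x (le_of_lt hx)
      rw [this.deriv_eq]; simp
    · exact (hC r ⟨not_lt.1 hr1, not_lt.1 hr2⟩).trans (le_max_left _ _)

/-- Smooth cut-offs at infinity. -/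
theorem exists_smooth_cutoff (E : Type*) [NormedAddCommGroup E] [InnerProductSpace ℝ E]
    [FiniteDimensional ℝ E] : ∃ C, 0 < C ∧ ∀ N : ℝ, 1 ≤ N → ∃ χ : E → ℝ, ContDiff ℝ ∞ χ ∧
      HasCompactSupport χ ∧ (∀ x, |χ x| ≤ 1) ∧ (∀ x, ‖fderiv ℝ χ x‖ ≤ C) ∧
      ∀ x, ‖x‖ < N → χ =ᶠ[𝓝 x] fun _ => 1 := by
  let f : ContDiffBump (0 : E) := ⟨1, 2, by norm_num, by norm_num⟩
  obtain ⟨C, hC⟩ := (f.hasCompactSupport.fderiv ℝ).exists_bound_of_continuous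
    ((f.contDiff (n := ⊤)).continuous_fderiv (by simp))
  refine ⟨max C 1, by positivity, fun N hN => ?_⟩
  have hN0 : 0 < N := by linarith
  have hinv : N⁻¹ ≤ 1 := inv_le_one_of_one_le₀ hN
  refine ⟨fun x => f (N⁻¹ • x), (f.contDiff (n := ⊤)).comp (contDiff_const_smul _),
    f.hasCompactSupport.comp_homeomorph (Homeomorph.smulOfNeZero N⁻¹ (inv_pos.2 hN0).ne'),
    fun x => by rw [abs_of_nonneg f.nonneg]; exact f.le_one, fun x => ?_, fun x hx => ?_⟩
  · rw [fderiv_comp_smul (f := f) N⁻¹]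
    rw [norm_smul, Real.norm_of_nonneg (inv_pos.2 hN0).le]
    calc N⁻¹ * ‖fderiv ℝ f (N⁻¹ • x)‖ ≤ 1 * C :=
          mul_le_mul hinv (hC _) (norm_nonneg _) zero_le_one
      _ ≤ max C 1 := by rw [one_mul]; exact le_max_left _ _
  · filter_upwards [(isOpen_lt continuous_norm continuous_const).mem_nhds
      (show x ∈ {y : E | ‖y‖ < N} from hx)] with y hy
    refine f.one_of_mem_closedBall ?_
    have hy : ‖y‖ < N := hy
    simp only [mem_closedBall_zero_iff, norm_smul, Real.norm_of_nonneg (inv_pos.2 hN0).le, f]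
    rw [inv_mul_le_iff₀ hN0]; linarith

/-- Approximation of a one-dimensional profile, vanishing at `t`, by test functions. -/
theorem exists_testFunction_approx {e : E} (he : ‖e‖ = 1) {t : ℝ} {w w' : ℝ → ℝ}
    (hpos : ∀ s < t, 0 < w s) (hd : ∀ s < t, HasDerivAt w (w' s) s)
    (hsm : ContDiffOn ℝ ∞ w (Iio t)) (hlim : Tendsto w (𝓝[<] t) (𝓝 0)) :
    ∃ C, 0 < C ∧ ∀ N : ℝ, 1 ≤ N → ∃ ψ : E → ℝ, IsTestFunction (openHalfSpace e t) ψ ∧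
      (∀ x ∈ openHalfSpace e t, |ψ x| ≤ w (inner ℝ e x)) ∧
      (∀ x ∈ openHalfSpace e t,
        ‖gradient ψ x‖ ≤ C * (w (inner ℝ e x) + |w' (inner ℝ e x)|)) ∧
      ∀ x ∈ openHalfSpace e t, 2 < N * w (inner ℝ e x) → ‖x‖ < N →
        ψ =ᶠ[𝓝 x] fun x => w (inner ℝ e x) := by
  obtain ⟨θ, C₁, hC₁, hθ, hθ1, hθ2, hθle, hθd⟩ := exists_smooth_truncation
  obtain ⟨C₂, hC₂, hcut⟩ := exists_smooth_cutoff E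
  refine ⟨C₁ + C₂, by positivity, fun N hN => ?_⟩
  have hN0 : 0 < N := by linarith
  obtain ⟨χ, hχ, hχc, hχ1, hχd, hχN⟩ := hcut N hN
  -- Values of w below 1/N are sent to 0, and since w → 0 at t this makes W vanish near the
  -- boundary. The factors N cancel in W', so |W'| ≤ C₁ |w'| uniformly in N.
  set W : ℝ → ℝ := fun s => if s < t then θ (N * w s) / N else 0
  have hWeq : ∀ s < t, W =ᶠ[𝓝 s] fun s => θ (N * w s) / N := fun s hs => by
    filter_upwards [Iio_mem_nhds hs] with r hr
    simp [W, show r < t from hr]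
  obtain ⟨η, hηt, hη⟩ : ∃ η < t, ∀ s ∈ Ioo η t, w s < N⁻¹ := by
    have := (hlim.eventually_lt_const (inv_pos.2 hN0))
    obtain ⟨η, hη, h⟩ := (mem_nhdsLT_iff_exists_Ioo_subset (a := t)).1 this
    exact ⟨η, hη, h⟩
  have hW0 : ∀ s, η < s → W s = 0 := fun s hs => by
    by_cases hst : s < t
    · have h1 : N * w s ≤ 1 := by
        have := mul_le_mul_of_nonneg_left (hη s ⟨hs, hst⟩).le hN0.le
        rwa [mul_inv_cancel₀ hN0.ne'] at this
      simp [W, hst, hθ1 _ h1]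
    · simp [W, hst]
  have hWsm : ContDiff ℝ ∞ W := by
    rw [contDiff_iff_contDiffAt]
    intro s
    by_cases hs : η < s
    · refine contDiffAt_const (c := (0 : ℝ)) |>.congr_of_eventuallyEq ?_
      filter_upwards [Ioi_mem_nhds hs] with r hr using hW0 r hr
    · have hst : s < t := (not_lt.1 hs).trans_lt hηt
      have hws : ContDiffAt ℝ ∞ w s := hsm.contDiffAt (Iio_mem_nhds hst)
      exact ((hθ.contDiffAt.comp s (contDiffAt_const.mul hws)).div_const N).congr_of_eventuallyEq
        (hWeq s hst)
  have hWle : ∀ s < t, |W s| ≤ w s := fun s hs => by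
    simp only [W, hs, if_true, abs_div, abs_of_pos hN0]
    rw [div_le_iff₀ hN0, mul_comm (w s) N]
    exact hθle _ (mul_nonneg hN0.le (hpos s hs).le)
  have hWd : ∀ s < t, |deriv W s| ≤ C₁ * |w' s| := fun s hs => by
    have h1 : HasDerivAt (fun s => θ (N * w s) / N) (deriv θ (N * w s) * (N * w' s) / N) s :=
      ((((hθ.differentiable (by simp)) (N * w s)).hasDerivAt.comp s
        ((hd s hs).const_mul N))).div_const N
    rw [(hWeq s hs).deriv_eq, h1.deriv]
    rw [show deriv θ (N * w s) * (N * w' s) / N = deriv θ (N * w s) * w' s by field_simp,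
      abs_mul]
    exact mul_le_mul_of_nonneg_right (hθd _) (abs_nonneg _)
  have hWsupp : tsupport (fun x => χ x * W (inner ℝ e x)) ⊆ {x | inner ℝ e x ≤ η} := by
    refine closure_minimal (fun x hx => ?_) (isClosed_le (by fun_prop) continuous_const)
    by_contra h
    exact hx (by simp only; rw [hW0 _ (not_le.1 h), mul_zero])
  have hinner : ContDiff ℝ ∞ fun x : E => inner ℝ e x := contDiff_const.inner ℝ contDiff_id
  have hfd : ∀ x : E, HasFDerivAt (fun x => χ x * W (inner ℝ e x))
      (χ x • (deriv W (inner ℝ e x) • innerSL ℝ e) + W (inner ℝ e x) • fderiv ℝ χ x) x := by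
    intro x
    have h1 := (hχ.differentiable (by simp) x).hasFDerivAt
    have h2 : HasFDerivAt (fun x : E => W (inner ℝ e x))
        (deriv W (inner ℝ e x) • innerSL ℝ e) x :=
      (hWsm.differentiable (by simp) _).hasDerivAt.comp_hasFDerivAt x
        (innerSL ℝ e).hasFDerivAt
    exact h1.mul h2
  refine ⟨fun x => χ x * W (inner ℝ e x), ⟨hχ.mul (hWsm.comp hinner), hχc.mul_right,
    hWsupp.trans fun x hx => lt_of_le_of_lt hx hηt⟩, fun x hx => ?_, fun x hx => ?_,
    fun x hx h2 hxN => ?_⟩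
  · rw [abs_mul]
    exact (mul_le_of_le_one_left (abs_nonneg _) (hχ1 x)).trans (hWle _ hx)
  · have hx' : inner ℝ e x < t := hx
    unfold gradient
    rw [LinearIsometryEquiv.norm_map, (hfd x).fderiv]
    refine (norm_add_le _ _).trans ?_
    simp only [norm_smul, innerSL_apply_norm, he, mul_one, Real.norm_eq_abs]
    have b1 : |χ x| * |deriv W (inner ℝ e x)| ≤ C₁ * |w' (inner ℝ e x)| :=
      (mul_le_of_le_one_left (abs_nonneg _) (hχ1 x)).trans (hWd _ hx')
    have b2 : |W (inner ℝ e x)| * ‖fderiv ℝ χ x‖ ≤ w (inner ℝ e x) * C₂ :=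
      mul_le_mul (hWle _ hx') (hχd x) (norm_nonneg _) (hpos _ hx').le
    have b3 := mul_nonneg hC₂.le (abs_nonneg (w' (inner ℝ e x)))
    have b4 := mul_nonneg hC₁.le (hpos _ hx').le
    linarith
  · have hx' : inner ℝ e x < t := hx
    have hc : ContinuousAt (fun x : E => N * w (inner ℝ e x)) x :=
      continuousAt_const.mul (ContinuousAt.comp (f := fun x : E => inner ℝ e x)
        (hd _ hx').continuousAt hinner.continuous.continuousAt)
    filter_upwards [hχN x hxN, (isOpen_openHalfSpace e t).mem_nhds hx,
      hc.eventually_const_lt h2] with y hy1 hy2 hy3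
    have hy2 : inner ℝ e y < t := hy2
    simp only [hy1, W, hy2, if_true, one_mul]
    rw [hθ2 _ hy3.le, mul_div_cancel_left₀ _ hN0.ne']

/-- Near each point of the half-space the truncated approximants eventually coincide with w(⟨e, x⟩),
and they and their gradients have a common exponential bound, so dominated convergence gives
closeness in both norms. -/
theorem memW0_of_profile {p : ℝ} (hp : 1 < p) {e : E} (he : ‖e‖ = 1) {t : ℝ} {w w' : ℝ → ℝ}
    (hpos : ∀ s < t, 0 < w s) (hd : ∀ s < t, HasDerivAt w (w' s) s)
    (hsm : ContDiffOn ℝ ∞ w (Iio t)) (hlim : Tendsto w (𝓝[<] t) (𝓝 0)) {M c : ℝ} (hM : 0 ≤ M)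
    (hc : 0 ≤ c) (hw : ∀ s < t, w s ≤ M * Real.exp (c * |s|))
    (hw' : ∀ s < t, |w' s| ≤ M * Real.exp (c * |s|)) :
    MemW0 p (openHalfSpace e t) (fun x => w (inner ℝ e x)) fun x => w' (inner ℝ e x) • e := by
  have hp0 : 0 < p := by linarith
  have hO := isOpen_openHalfSpace e t
  have hOm := hO.measurableSet
  have hinner : Continuous fun x : E => inner ℝ e x := by fun_prop
  have hmaps : MapsTo (fun x : E => inner ℝ e x) (openHalfSpace e t) (Iio t) := fun x hx => hx
  have hUc : ContinuousOn (fun x : E => w (inner ℝ e x)) (openHalfSpace e t) :=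
    hsm.continuousOn.comp hinner.continuousOn hmaps
  have hw'c : ContinuousOn w' (Iio t) :=
    (hsm.continuousOn_deriv_of_isOpen isOpen_Iio (by simp)).congr fun s hs => (hd s hs).deriv.symm
  have hGc : ContinuousOn (fun x : E => w' (inner ℝ e x) • e) (openHalfSpace e t) :=
    (hw'c.comp hinner.continuousOn hmaps).smul continuousOn_const
  have hexp : ∀ x : E, M * Real.exp (c * |inner ℝ e x|) ≤ M * Real.exp (c * ‖x‖) := fun x => by
    have h1 : |inner ℝ e x| ≤ ‖x‖ := by simpa [he] using abs_real_inner_le_norm e x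
    gcongr
  have hUb : ∀ x ∈ openHalfSpace e t, ‖w (inner ℝ e x)‖ ≤ M * Real.exp (c * ‖x‖) :=
    fun x hx => by
      rw [Real.norm_of_nonneg (hpos _ hx).le]; exact (hw _ hx).trans (hexp x)
  have hGb : ∀ x ∈ openHalfSpace e t, ‖w' (inner ℝ e x) • e‖ ≤ M * Real.exp (c * ‖x‖) :=
    fun x hx => by
      rw [norm_smul, he, mul_one]; exact (hw' _ hx).trans (hexp x)
  have hUfd : ∀ x ∈ openHalfSpace e t, HasFDerivAt (fun x : E => w (inner ℝ e x))
      (w' (inner ℝ e x) • innerSL ℝ e) x := fun x hx =>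
    (hd _ hx).comp_hasFDerivAt x (innerSL ℝ e).hasFDerivAt
  have hUg : ∀ x ∈ openHalfSpace e t,
      gradient (fun x : E => w (inner ℝ e x)) x = w' (inner ℝ e x) • e := fun x hx => by
    unfold gradient
    rw [(hUfd x hx).fderiv, LinearIsometryEquiv.symm_apply_eq]
    ext v; simp
  refine ⟨⟨⟨hUc.locallyIntegrableOn hOm, hGc.locallyIntegrableOn hOm, fun ψ hψ => ?_⟩,
    memLp_of_norm_le_exp hp0 hOm (hUc.aestronglyMeasurable hOm) hUb,
    memLp_of_norm_le_exp hp0 hOm (hGc.aestronglyMeasurable hOm) hGb⟩, ?_⟩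
  · refine ext_inner_left ℝ fun v => ?_
    have i1 : IntegrableOn (fun x => w (inner ℝ e x) • gradient ψ x) (openHalfSpace e t) :=
      (integrable_of_continuousOn_of_eq_zero hO (hUc.smul hψ.continuous_gradient.continuousOn)
        hψ.2.1 hψ.2.2 fun x hx => by
          rw [Pi.smul_apply', hψ.gradient_eq_zero hx, smul_zero]).2.integrableOn
    have i2 : IntegrableOn (fun x => ψ x • w' (inner ℝ e x) • e) (openHalfSpace e t) :=
      (integrable_of_continuousOn_of_eq_zero hO (hψ.1.continuous.continuousOn.smul hGc)
        hψ.2.1 hψ.2.2 fun x hx => by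
          rw [Pi.smul_apply', hψ.eq_zero hx, zero_smul]).2.integrableOn
    rw [inner_neg_right, ← integral_inner i1, ← integral_inner i2]
    have hibp := (setIntegral_mul_lineDeriv_eq_neg (ψ := ψ) (ψ' := fun x => fderiv ℝ ψ x v)
      (a := fun x => w (inner ℝ e x)) (a' := fun x => w' (inner ℝ e x) * inner ℝ e v) (v := v) hO
      hψ.2.1 hψ.2.2 hψ.1.continuous (hψ.continuous_fderiv.clm_apply continuous_const)
      (fun x => (hψ.differentiable x).hasFDerivAt.hasLineDerivAt v) hUc
      ((hw'c.comp hinner.continuousOn hmaps).mul continuousOn_const)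
      (fun x hx => (hUfd x hx).hasLineDerivAt v)).2.2
    have e1 : ∀ x, inner ℝ v (w (inner ℝ e x) • gradient ψ x) =
        fderiv ℝ ψ x v * w (inner ℝ e x) := fun x => by
      rw [inner_smul_right, ← inner_gradient_left, real_inner_comm v, mul_comm]
    have e2 : ∀ x, inner ℝ v (ψ x • w' (inner ℝ e x) • e) =
        ψ x * (w' (inner ℝ e x) * inner ℝ e v) := fun x => by
      rw [inner_smul_right, inner_smul_right, real_inner_comm e]
    simp only [e1, e2]
    rw [hibp, neg_neg]
  · obtain ⟨C, hC, happ⟩ := exists_testFunction_approx he hpos hd hsm hlim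
    choose ψ hψ hψb hψg hψe using fun n : ℕ => happ (n + 1) (by simp)
    have hev : ∀ x ∈ openHalfSpace e t, ∀ᶠ n : ℕ in atTop,
        ψ n =ᶠ[𝓝 x] fun x => w (inner ℝ e x) := fun x hx => by
      have h1 : Tendsto (fun n : ℕ => (n : ℝ) + 1) atTop atTop :=
        tendsto_natCast_atTop_atTop.atTop_add tendsto_const_nhds
      have h2 := (h1.atTop_mul_const (hpos _ hx)).eventually_gt_atTop 2
      filter_upwards [h2, h1.eventually_gt_atTop ‖x‖] with n hn1 hn2 using hψe n x hx hn1 hn2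
    have t1 := tendsto_eLpNorm_zero_of_dominated (μ := (gaussMeasure E).restrict
      (openHalfSpace e t)) hp0 (f := fun n x => w (inner ℝ e x) - ψ n x)
      (g := fun x => (2 * M) * Real.exp (c * ‖x‖))
      (memLp_of_norm_le_exp hp0 (M := 2 * M) (c := c) hOm
        (Continuous.aestronglyMeasurable (by fun_prop))
        (fun x _ => by rw [Real.norm_of_nonneg (by positivity)]))
      (fun n => (hUc.aestronglyMeasurable hOm).sub (hψ n).1.continuous.aestronglyMeasurable)
      (fun n => by
        filter_upwards [ae_restrict_mem hOm] with x hx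
        refine (norm_sub_le _ _).trans ?_
        have h1 := hUb x hx
        have h2 := (hψb n x hx).trans ((le_abs_self _).trans h1)
        rw [← Real.norm_eq_abs] at h2
        linarith)
      (by
        filter_upwards [ae_restrict_mem hOm] with x hx
        filter_upwards [hev x hx] with n hn
        rw [hn.eq_of_nhds, sub_self])
    have t2 := tendsto_eLpNorm_zero_of_dominated (μ := (gaussMeasure E).restrict
      (openHalfSpace e t)) hp0 (f := fun n x => w' (inner ℝ e x) • e - gradient (ψ n) x)
      (g := fun x => ((1 + 2 * C) * M) * Real.exp (c * ‖x‖))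
      (memLp_of_norm_le_exp hp0 (M := (1 + 2 * C) * M) (c := c) hOm
        (Continuous.aestronglyMeasurable (by fun_prop))
        (fun x _ => by rw [Real.norm_of_nonneg (by positivity)]))
      (fun n => (hGc.aestronglyMeasurable hOm).sub
        (hψ n).continuous_gradient.aestronglyMeasurable)
      (fun n => by
        filter_upwards [ae_restrict_mem hOm] with x hx
        refine (norm_sub_le _ _).trans ?_
        have h1 := hGb x hx
        have h2 := hψg n x hx
        have h3 := (le_abs_self _).trans (hUb x hx)
        have h4 : |w' (inner ℝ e x)| ≤ M * Real.exp (c * ‖x‖) := (hw' _ hx).trans (hexp x)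
        have h5 := mul_le_mul_of_nonneg_left (add_le_add h3 h4) hC.le
        linarith)
      (by
        filter_upwards [ae_restrict_mem hOm] with x hx
        filter_upwards [hev x hx] with n hn
        rw [hn.gradient_eq, hUg x hx, sub_self])
    intro ε hε
    have t3 := t1.add t2
    rw [add_zero] at t3
    obtain ⟨n, hn⟩ := (t3.eventually_lt_const hε).exists
    exact ⟨ψ n, hψ n, hn⟩

end Membership

/-! ### Picone's identity and its equality case -/

section Picone

variable {E : Type*} [NormedAddCommGroup E] [InnerProductSpace ℝ E] [CompleteSpace E]
  [FiniteDimensional ℝ E] [MeasureSpace E] [BorelSpace E] [(volume : Measure E).IsAddHaarMeasure]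
  {p l t : ℝ} {q : ℝ → ℝ} {e : E}

theorem hasDerivAt_abs_rpow_self (hp : 1 < p) (a : ℝ) :
    HasDerivAt (fun x : ℝ => |x| ^ p) (p * (|a| ^ (p - 2) * a)) a :=
  (hasDerivAt_abs_rpow a hp).congr_deriv (by ring)

/-- For p < 2 the first factor is singular at 0, so continuity is read off from the derivative of
the C¹ function |·|^p. -/
theorem continuous_abs_rpow_mul_self (hp : 1 < p) :
    Continuous fun a : ℝ => |a| ^ (p - 2) * a := by
  have h1 : ContDiff ℝ 1 fun x : ℝ => ‖x‖ ^ p := contDiff_norm_rpow hp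
  have h2 := (h1.continuous_deriv le_rfl).const_smul p⁻¹
  refine h2.congr fun a => ?_
  have h3 : deriv (fun x : ℝ => ‖x‖ ^ p) a = p * (|a| ^ (p - 2) * a) :=
    (hasDerivAt_abs_rpow_self hp a).deriv
  rw [Pi.smul_apply, h3, smul_eq_mul, inv_mul_cancel_left₀ (by linarith)]

/-- The integrand of Picone's identity, for the Riccati variable `r`, the value `a` and the
gradient `B`. -/
def piconeGap (p r : ℝ) (e : E) (a : ℝ) (B : E) : ℝ :=
  ‖B‖ ^ p + (p - 1) * r ^ (1 + (p - 1)⁻¹) * |a| ^ p + p * (|a| ^ (p - 2) * a) * inner ℝ e B * r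

/-- The comparison vector -(r^(1/(p-1)) a) e is the gradient that a multiple of the profile with
value a would have. -/
theorem piconeGap_eq_powGap (hp : 1 < p) (he : ‖e‖ = 1) {r : ℝ} (hr : 0 < r) (a : ℝ) (B : E) :
    piconeGap p r e a B = powGap p B (-(r ^ (p - 1)⁻¹ * a) • e) := by
  have hp1 : p - 1 ≠ 0 := by linarith
  have hk : 0 < r ^ (p - 1)⁻¹ := Real.rpow_pos_of_pos hr _
  have hn : ‖-(r ^ (p - 1)⁻¹ * a) • e‖ = r ^ (p - 1)⁻¹ * |a| := by
    rw [norm_smul, he, mul_one, norm_neg, norm_mul, Real.norm_of_nonneg hk.le, Real.norm_eq_abs]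
  have e1 : (r ^ (p - 1)⁻¹) ^ p = r ^ (1 + (p - 1)⁻¹) := by
    rw [← Real.rpow_mul hr.le]
    congr 1
    field_simp
    ring
  have e2 : (r ^ (p - 1)⁻¹) ^ (p - 2) * r ^ (p - 1)⁻¹ = r := by
    rw [← Real.rpow_add_one hk.ne', ← Real.rpow_mul hr.le,
      show (p - 1)⁻¹ * (p - 2 + 1) = 1 by field_simp; ring, Real.rpow_one]
  unfold piconeGap powGap
  rw [hn, Real.mul_rpow hk.le (abs_nonneg a), Real.mul_rpow hk.le (abs_nonneg a), e1,
    inner_smul_left, conj_trivial]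
  linear_combination (-p * |a| ^ (p - 2) * a * inner ℝ e B) * e2

theorem piconeGap_nonneg (hp : 1 < p) (he : ‖e‖ = 1) {r : ℝ} (hr : 0 < r) (a : ℝ) (B : E) :
    0 ≤ piconeGap p r e a B := by
  rw [piconeGap_eq_powGap hp he hr]; exact (powGap_nonneg_and_eq hp _ _).1

theorem eq_of_piconeGap_eq_zero (hp : 1 < p) (he : ‖e‖ = 1) {r : ℝ} (hr : 0 < r) {a : ℝ} {B : E}
    (h : piconeGap p r e a B = 0) : B = -(r ^ (p - 1)⁻¹ * a) • e := by
  rw [piconeGap_eq_powGap hp he hr] at h; exact (powGap_nonneg_and_eq hp _ _).2 h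

theorem tendsto_piconeGap (hp : 1 < p) (r : ℝ) (e : E) {a : ℕ → ℝ} {B : ℕ → E} {a₀ : ℝ} {B₀ : E}
    (ha : Tendsto a atTop (𝓝 a₀)) (hB : Tendsto B atTop (𝓝 B₀)) :
    Tendsto (fun n => piconeGap p r e (a n) (B n)) atTop (𝓝 (piconeGap p r e a₀ B₀)) := by
  have hp0 : p ≠ 0 := by linarith
  have h1 := (hB.norm).rpow_const (p := p) (Or.inr (by linarith))
  have h2 := ((ha.abs).rpow_const (p := p) (Or.inr (by linarith))).const_mul
    ((p - 1) * r ^ (1 + (p - 1)⁻¹))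
  have h3 := (((continuous_abs_rpow_mul_self hp).tendsto a₀).comp ha).const_mul p
  have h4 : Tendsto (fun n => inner ℝ e (B n)) atTop (𝓝 (inner ℝ e B₀)) :=
    tendsto_const_nhds.inner hB
  exact (h1.add h2).add ((h3.mul h4).mul_const r)

theorem integrable_norm_rpow_of_memLp {X F : Type*} [MeasurableSpace X] [NormedAddCommGroup F]
    {μ : Measure X} (hp : 1 < p) {f : X → F} (hf : MemLp f (ENNReal.ofReal p) μ) :
    Integrable (fun x => ‖f x‖ ^ p) μ := by
  have := hf.integrable_norm_rpow (by simp; linarith) ENNReal.ofReal_ne_top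
  rwa [ENNReal.toReal_ofReal (by linarith)] at this

theorem hasLineDerivAt_comp_inner_mul_gaussDensity (he : ‖e‖ = 1) {f : ℝ → ℝ} {f' : ℝ} {x : E}
    (hf : HasDerivAt f f' (inner ℝ e x)) :
    HasLineDerivAt ℝ (fun x => f (inner ℝ e x) * gaussDensity x)
      ((f' - inner ℝ e x * f (inner ℝ e x)) * gaussDensity x) x e := by
  have h1 : HasLineDerivAt ℝ (fun x => f (inner ℝ e x)) f' x e := by
    have := (hf.comp_hasFDerivAt x (innerSL ℝ e).hasFDerivAt).hasLineDerivAt e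
    simpa [he] using! this
  have h2 := hasLineDerivAt_gaussDensity x e
  unfold HasLineDerivAt at h1 h2 ⊢
  refine (h1.mul h2).congr_deriv ?_
  simp only [zero_smul, add_zero]
  ring

/-- Picone's identity for test functions. -/
theorem IsBlowup.picone_testFunction (h : IsBlowup p l t q) (hp : 1 < p) (he : ‖e‖ = 1)
    {ψ : E → ℝ} (hψ : IsTestFunction (openHalfSpace e t) ψ) :
    IntegrableOn (fun x => piconeGap p (q (inner ℝ e x)) e (ψ x) (gradient ψ x))
      (openHalfSpace e t) (gaussMeasure E) ∧
    ∫ x in openHalfSpace e t, piconeGap p (q (inner ℝ e x)) e (ψ x) (gradient ψ x)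
        ∂gaussMeasure E =
      (∫ x in openHalfSpace e t, ‖gradient ψ x‖ ^ p ∂gaussMeasure E) -
        l * ∫ x in openHalfSpace e t, ‖ψ x‖ ^ p ∂gaussMeasure E := by
  have hO := isOpen_openHalfSpace e t
  have hOm := hO.measurableSet
  have hp0 : 0 < p := by linarith
  have hα : 0 < (p - 1)⁻¹ := inv_pos.2 (by linarith)
  have hinner : Continuous fun x : E => inner ℝ e x := by fun_prop
  have hmaps : MapsTo (fun x : E => inner ℝ e x) (openHalfSpace e t) (Iio t) := fun x hx => hx
  have hqc : ContinuousOn (fun x : E => q (inner ℝ e x)) (openHalfSpace e t) :=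
    (h.contDiffOn hp).continuousOn.comp hinner.continuousOn hmaps
  have hρsupp : Function.support (fun x => |ψ x| ^ p) ⊆ Function.support ψ := fun x hx h0 =>
    hx (by simp [h0, hp0.ne'])
  have hρt : tsupport (fun x => |ψ x| ^ p) ⊆ tsupport ψ := closure_mono hρsupp
  -- |ψ|^p is integrated against the e-derivative of q times the Gaussian density. The derivative of
  -- the density cancels the drift term of the Riccati equation, leaving l plus the nonlinearity.
  obtain ⟨i1, i2, hibp⟩ := setIntegral_mul_lineDeriv_eq_neg (v := e)
    (ψ := fun x => |ψ x| ^ p) (ψ' := fun x => p * (|ψ x| ^ (p - 2) * ψ x) * fderiv ℝ ψ x e)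
    (a := fun x => q (inner ℝ e x) * gaussDensity x)
    (a' := fun x => (l + (p - 1) * q (inner ℝ e x) ^ (1 + (p - 1)⁻¹)) * gaussDensity x) hO
    (hψ.2.1.of_isClosed_subset (isClosed_tsupport _) hρt) (hρt.trans hψ.2.2)
    (hψ.1.continuous.abs.rpow_const fun _ => Or.inr hp0.le)
    ((continuous_const.mul ((continuous_abs_rpow_mul_self hp).comp hψ.1.continuous)).mul
      (hψ.continuous_fderiv.clm_apply continuous_const))
    (fun x => by
      have := ((hasDerivAt_abs_rpow_self hp (ψ x)).comp_hasFDerivAt x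
        (hψ.differentiable x).hasFDerivAt).hasLineDerivAt e
      simpa using! this)
    (hqc.mul continuous_gaussDensity.continuousOn)
    ((continuousOn_const.add (continuousOn_const.mul (hqc.rpow_const fun x _ =>
      Or.inr (by positivity)))).mul continuous_gaussDensity.continuousOn)
    (fun x hx => by
      have := hasLineDerivAt_comp_inner_mul_gaussDensity he (h.ode _ (hmaps hx))
      convert! this using 1
      ring)
  have j1 := (integrableOn_gaussMeasure_iff hOm _).1
    (integrable_norm_rpow_of_memLp hp (hψ.memLp_gradient hp0 hOm))
  have j2 := (integrableOn_gaussMeasure_iff hOm _).1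
    (integrable_norm_rpow_of_memLp hp (hψ.memLp hp0 hOm))
  have hsplit : ∀ x, gaussDensity x • piconeGap p (q (inner ℝ e x)) e (ψ x) (gradient ψ x) =
      gaussDensity x • ‖gradient ψ x‖ ^ p - l * (gaussDensity x • ‖ψ x‖ ^ p) +
      (|ψ x| ^ p * ((l + (p - 1) * q (inner ℝ e x) ^ (1 + (p - 1)⁻¹)) * gaussDensity x) +
        p * (|ψ x| ^ (p - 2) * ψ x) * fderiv ℝ ψ x e *
          (q (inner ℝ e x) * gaussDensity x)) := fun x => by
    unfold piconeGap
    rw [real_inner_comm (gradient ψ x), inner_gradient_left]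
    simp only [smul_eq_mul, Real.norm_eq_abs]
    ring
  have k0 := j2.const_mul l
  have k1 : IntegrableOn (fun x => gaussDensity x • ‖gradient ψ x‖ ^ p -
      l * (gaussDensity x • ‖ψ x‖ ^ p)) (openHalfSpace e t) := j1.sub k0
  have k2 : IntegrableOn (fun x => |ψ x| ^ p *
      ((l + (p - 1) * q (inner ℝ e x) ^ (1 + (p - 1)⁻¹)) * gaussDensity x) +
        p * (|ψ x| ^ (p - 2) * ψ x) * fderiv ℝ ψ x e * (q (inner ℝ e x) * gaussDensity x))
      (openHalfSpace e t) := i1.add i2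
  constructor
  · rw [integrableOn_gaussMeasure_iff hOm]
    simp only [hsplit]
    exact k1.add k2
  · rw [setIntegral_gaussMeasure hOm, setIntegral_gaussMeasure hOm, setIntegral_gaussMeasure hOm]
    simp only [hsplit]
    rw [integral_add k1 k2, integral_sub j1 k0, integral_add i1 i2, hibp, integral_const_mul]
    ring

/-- Picone's inequality in `W₀^{1,p}`, with remainder. -/
theorem IsBlowup.picone_memW0 (h : IsBlowup p l t q) (hp : 1 < p) (he : ‖e‖ = 1)
    {v : E → ℝ} {G : E → E} (hv : MemW0 p (openHalfSpace e t) v G) :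
    l * ∫ x in openHalfSpace e t, |v x| ^ p ∂gaussMeasure E ≤
      ∫ x in openHalfSpace e t, ‖G x‖ ^ p ∂gaussMeasure E ∧
    ((∫ x in openHalfSpace e t, ‖G x‖ ^ p ∂gaussMeasure E =
        l * ∫ x in openHalfSpace e t, |v x| ^ p ∂gaussMeasure E) →
      ∀ᵐ x ∂(gaussMeasure E).restrict (openHalfSpace e t),
        G x = -(q (inner ℝ e x) ^ (p - 1)⁻¹ * v x) • e) := by
  have hO := isOpen_openHalfSpace e t
  have hOm := hO.measurableSet
  have hp0 : 0 < p := by linarith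
  obtain ⟨ψ, hψ, hψl, hgl, hψae, hgae⟩ := hv.exists_seq hp hOm
  have l1 := tendsto_integral_norm_rpow hp hv.1.2.2 (fun n => (hψ n).memLp_gradient hp0 hOm) hgl
  have l2 := tendsto_integral_norm_rpow hp hv.1.2.1 (fun n => (hψ n).memLp hp0 hOm) hψl
  have l3 := l1.sub (l2.const_mul l)
  have hnn : ∀ (a : E → ℝ) (B : E → E), 0 ≤ᵐ[(gaussMeasure E).restrict (openHalfSpace e t)]
      fun x => piconeGap p (q (inner ℝ e x)) e (a x) (B x) := fun a B => by
    filter_upwards [ae_restrict_mem hOm] with x hx using piconeGap_nonneg hp he (h.pos _ hx) _ _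
  have hpic := fun n => h.picone_testFunction hp he (hψ n)
  have hnonneg : ∀ n, 0 ≤ (∫ x in openHalfSpace e t, ‖gradient (ψ n) x‖ ^ p ∂gaussMeasure E) -
      l * ∫ x in openHalfSpace e t, ‖ψ n x‖ ^ p ∂gaussMeasure E := fun n => by
    rw [← (hpic n).2]
    exact integral_nonneg_of_ae (hnn _ _)
  simp only [← Real.norm_eq_abs]
  refine ⟨sub_nonneg.1 (ge_of_tendsto' l3 hnonneg), fun heq => ?_⟩
  have hae : ∀ᵐ x ∂(gaussMeasure E).restrict (openHalfSpace e t),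
      Tendsto (fun n => piconeGap p (q (inner ℝ e x)) e (ψ n x) (gradient (ψ n) x)) atTop
        (𝓝 (piconeGap p (q (inner ℝ e x)) e (v x) (G x))) := by
    filter_upwards [hψae, hgae] with x h1 h2 using tendsto_piconeGap hp _ e h1 h2
  have hmeas : AEMeasurable (fun x => piconeGap p (q (inner ℝ e x)) e (v x) (G x))
      ((gaussMeasure E).restrict (openHalfSpace e t)) :=
    aemeasurable_of_tendsto_metrizable_ae atTop (fun n => (hpic n).1.1.aemeasurable) hae
  -- Fatou along test functions avoids proving that the gap of v is integrable or that the identity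
  -- itself passes to the limit; under equality the gaps of the approximants have integrals tending
  -- to 0.
  have hfatou : ∫⁻ x in openHalfSpace e t,
      ENNReal.ofReal (piconeGap p (q (inner ℝ e x)) e (v x) (G x)) ∂gaussMeasure E ≤ 0 := by
    calc _ = ∫⁻ x in openHalfSpace e t, liminf (fun n => ENNReal.ofReal
          (piconeGap p (q (inner ℝ e x)) e (ψ n x) (gradient (ψ n) x))) atTop
          ∂gaussMeasure E := by
          refine lintegral_congr_ae ?_
          filter_upwards [hae] with x hx
          exact ((ENNReal.continuous_ofReal.tendsto _).comp hx).liminf_eq.symm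
      _ ≤ liminf (fun n => ∫⁻ x in openHalfSpace e t, ENNReal.ofReal
          (piconeGap p (q (inner ℝ e x)) e (ψ n x) (gradient (ψ n) x)) ∂gaussMeasure E) atTop :=
          lintegral_liminf_le' fun n => (hpic n).1.1.aemeasurable.ennreal_ofReal
      _ = 0 := by
          have : ∀ n, ∫⁻ x in openHalfSpace e t, ENNReal.ofReal
              (piconeGap p (q (inner ℝ e x)) e (ψ n x) (gradient (ψ n) x)) ∂gaussMeasure E =
              ENNReal.ofReal ((∫ x in openHalfSpace e t, ‖gradient (ψ n) x‖ ^ p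
                ∂gaussMeasure E) - l * ∫ x in openHalfSpace e t, ‖ψ n x‖ ^ p
                ∂gaussMeasure E) := fun n => by
            rw [← (hpic n).2, ofReal_integral_eq_lintegral_ofReal (hpic n).1 (hnn _ _)]
          simp only [this]
          have l4 := (ENNReal.continuous_ofReal.tendsto _).comp l3
          rw [heq, sub_self, ENNReal.ofReal_zero] at l4
          exact l4.liminf_eq
  have hz := (lintegral_eq_zero_iff' hmeas.ennreal_ofReal).1 (le_antisymm hfatou zero_le)
  filter_upwards [hz, ae_restrict_mem hOm] with x hx hxm
  have hq := h.pos _ hxm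
  refine eq_of_piconeGap_eq_zero hp he hq (le_antisymm ?_ (piconeGap_nonneg hp he hq _ _))
  exact ENNReal.ofReal_eq_zero.1 hx

end Picone

/-! ### Blow-up solutions give the first eigenvalue, its eigenfunction and simplicity -/

section Eigenfunctions

variable {E : Type*} [NormedAddCommGroup E] [InnerProductSpace ℝ E] [CompleteSpace E]
  [FiniteDimensional ℝ E] [MeasureSpace E] [BorelSpace E] [(volume : Measure E).IsAddHaarMeasure]
  {p l t a : ℝ} {q : ℝ → ℝ} {e : E}

theorem HasWeakGradient.integral_mul_fderiv {Ω : Set E} (hΩ : MeasurableSet Ω) {u : E → ℝ}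
    {G : E → E} (hu : HasWeakGradient Ω u G) {ψ : E → ℝ} (hψ : IsTestFunction Ω ψ)
    (v : E) :
    IntegrableOn (fun x => u x * fderiv ℝ ψ x v) Ω ∧
    IntegrableOn (fun x => ψ x * inner ℝ v (G x)) Ω ∧
    ∫ x in Ω, u x * fderiv ℝ ψ x v = -∫ x in Ω, ψ x * inner ℝ v (G x) := by
  have i1 : IntegrableOn (fun x => u x • gradient ψ x) Ω :=
    ((hu.1.integrableOn_compact_subset hψ.2.2 hψ.2.1).smul_continuousOn
      hψ.continuous_gradient.continuousOn hψ.2.1).of_forall_sdiff_eq_zero hΩ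
      fun x hx => by rw [hψ.gradient_eq_zero hx.2, smul_zero]
  have i2 : IntegrableOn (fun x => ψ x • G x) Ω :=
    ((hu.2.1.integrableOn_compact_subset hψ.2.2 hψ.2.1).continuousOn_smul
      hψ.1.continuous.continuousOn hψ.2.1).of_forall_sdiff_eq_zero hΩ
      fun x hx => by rw [hψ.eq_zero hx.2, zero_smul]
  have e1 : ∀ x, inner ℝ v (u x • gradient ψ x) = u x * fderiv ℝ ψ x v := fun x => by
    rw [inner_smul_right, ← inner_gradient_left, real_inner_comm v]
  have e2 : ∀ x, inner ℝ v (ψ x • G x) = ψ x * inner ℝ v (G x) := fun x => by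
    rw [inner_smul_right]
  have h1 := integral_inner (𝕜 := ℝ) i1 v
  have h2 := integral_inner (𝕜 := ℝ) i2 v
  rw [hu.2.2 ψ hψ, inner_neg_right, ← h2] at h1
  simp only [e1, e2] at h1
  exact ⟨(i1.const_inner v).congr (ae_of_all _ e1), (i2.const_inner v).congr (ae_of_all _ e2), h1⟩

theorem integral_norm_rpow_eq_of_weak (hp : 1 < p) {Ω : Set E} {v : E → ℝ} {G : E → E}
    (h : ∫ x in Ω, ‖G x‖ ^ (p - 2) * inner ℝ (G x) (G x) ∂gaussMeasure E =
      l * ∫ x in Ω, |v x| ^ (p - 2) * v x * v x ∂gaussMeasure E) :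
    ∫ x in Ω, ‖G x‖ ^ p ∂gaussMeasure E = l * ∫ x in Ω, |v x| ^ p ∂gaussMeasure E := by
  have e1 : ∀ y : E, ‖y‖ ^ (p - 2) * inner ℝ y y = ‖y‖ ^ p := fun y => by
    rcases eq_or_ne y 0 with rfl | h0
    · simp [show p ≠ 0 by linarith]
    · rw [real_inner_self_eq_norm_sq, ← Real.rpow_natCast ‖y‖ 2,
        ← Real.rpow_add (norm_pos_iff.2 h0)]
      norm_num
  have e2 : ∀ r : ℝ, |r| ^ (p - 2) * r * r = |r| ^ p := fun r => by
    rcases eq_or_ne r 0 with rfl | h0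
    · simp [show p ≠ 0 by linarith]
    · rw [mul_assoc, ← abs_mul_abs_self r, ← pow_two, ← Real.rpow_natCast |r| 2,
        ← Real.rpow_add (abs_pos.2 h0)]
      norm_num
  simpa only [e1, e2] using h

namespace IsBlowup

variable (h : IsBlowup p l t q) (hp : 1 < p) (hl : 0 < l) (ha : a < t)
include h hp hl ha

theorem exists_profile_le_exp : ∃ M c, 0 < M ∧ 0 < c ∧ ∀ s < t,
    profile p t a q s ≤ M * Real.exp (c * |s|) ∧
      profileSlope p t a q s ≤ M * Real.exp (c * |s|) := by
  obtain ⟨K, hK0, hK⟩ := h.bdd a ha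
  obtain ⟨M, c, hM, hc, H⟩ := exists_profile_bounds hp a t hK0 hl ha.le
  exact ⟨M, c, hM, hc, fun s hs => H l t q h hl le_rfl ha le_rfl hK s hs⟩

theorem memW0_profile (he : ‖e‖ = 1) :
    MemW0 p (openHalfSpace e t) (fun x => profile p t a q (inner ℝ e x))
      fun x => (-profileSlope p t a q (inner ℝ e x)) • e := by
  obtain ⟨M, c, hM, hc, H⟩ := h.exists_profile_le_exp hp hl ha
  exact memW0_of_profile (w' := fun s => -profileSlope p t a q s) hp he
    (fun s hs => profile_pos hs) (fun s hs => h.hasDerivAt_profile hp ha hs)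
    (h.contDiffOn_profile hp ha) (h.tendsto_profile hp hl ha) hM.le hc.le (fun s hs => (H s hs).1)
    fun s hs => by
      rw [abs_neg, abs_of_pos (h.profileSlope_pos hp hs)]
      exact (H s hs).2

/-- Integration by parts in the direction e only: the flux times the Gaussian density has
e-derivative l u^(p-1) times the density. -/
theorem weak_equation_testFunction (he : ‖e‖ = 1) {ψ : E → ℝ}
    (hψ : IsTestFunction (openHalfSpace e t) ψ) :
    ∫ x in openHalfSpace e t, profileFlux p t a q (inner ℝ e x) * inner ℝ e (gradient ψ x)
        ∂gaussMeasure E =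
      -(l * ∫ x in openHalfSpace e t, profile p t a q (inner ℝ e x) ^ (p - 1) * ψ x
        ∂gaussMeasure E) := by
  have hO := isOpen_openHalfSpace e t
  have hOm := hO.measurableSet
  have hinner : Continuous fun x : E => inner ℝ e x := by fun_prop
  have hmaps : MapsTo (fun x : E => inner ℝ e x) (openHalfSpace e t) (Iio t) := fun x hx => hx
  have hF : ContinuousOn (profileFlux p t a q) (Iio t) := fun s hs =>
    (h.hasDerivAt_profileFlux hp ha hs).continuousAt.continuousWithinAt
  have hU : ContinuousOn (profile p t a q) (Iio t) := fun s hs =>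
    (h.hasDerivAt_profile hp ha hs).continuousAt.continuousWithinAt
  have hibp := (setIntegral_mul_lineDeriv_eq_neg (ψ := ψ) (ψ' := fun x => fderiv ℝ ψ x e)
    (a := fun x => profileFlux p t a q (inner ℝ e x) * gaussDensity x)
    (a' := fun x => l * profile p t a q (inner ℝ e x) ^ (p - 1) * gaussDensity x) (v := e) hO
    hψ.2.1 hψ.2.2 hψ.1.continuous (hψ.continuous_fderiv.clm_apply continuous_const)
    (fun x => (hψ.differentiable x).hasFDerivAt.hasLineDerivAt e)
    ((hF.comp hinner.continuousOn hmaps).mul continuous_gaussDensity.continuousOn)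
    ((continuousOn_const.mul ((hU.comp hinner.continuousOn hmaps).rpow_const fun x _ =>
      Or.inr (by linarith))).mul continuous_gaussDensity.continuousOn)
    (fun x hx => by
      have := hasLineDerivAt_comp_inner_mul_gaussDensity he
        (h.hasDerivAt_profileFlux hp ha (hmaps hx))
      convert! this using 1
      ring)).2.2
  rw [setIntegral_gaussMeasure hOm, setIntegral_gaussMeasure hOm, ← integral_const_mul,
    eq_neg_iff_add_eq_zero, add_comm, ← eq_neg_iff_add_eq_zero]
  refine (integral_congr_ae (ae_of_all _ fun x => ?_)).trans
    (hibp.trans (congrArg Neg.neg (integral_congr_ae (ae_of_all _ fun x => ?_))))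
  · simp only [smul_eq_mul]; ring
  · simp only [smul_eq_mul]
    rw [real_inner_comm (gradient ψ x), inner_gradient_left]
    ring

/-- The flux and u^(p-1) grow at most exponentially, so they lie in the conjugate Lebesgue space,
and Hölder extends the equation from test functions to W₀. -/
theorem weak_equation_profile (he : ‖e‖ = 1) {ψ : E → ℝ} {Ψ : E → E}
    (hψ : MemW0 p (openHalfSpace e t) ψ Ψ) :
    ∫ x in openHalfSpace e t, ‖(-profileSlope p t a q (inner ℝ e x)) • e‖ ^ (p - 2) *
        inner ℝ ((-profileSlope p t a q (inner ℝ e x)) • e) (Ψ x) ∂gaussMeasure E =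
      l * ∫ x in openHalfSpace e t, |profile p t a q (inner ℝ e x)| ^ (p - 2) *
        profile p t a q (inner ℝ e x) * ψ x ∂gaussMeasure E := by
  have hO := isOpen_openHalfSpace e t
  have hOm := hO.measurableSet
  have hp0 : 0 < p := by linarith
  have hp1 : 0 < p - 1 := by linarith
  have hinner : Continuous fun x : E => inner ℝ e x := by fun_prop
  have hmaps : MapsTo (fun x : E => inner ℝ e x) (openHalfSpace e t) (Iio t) := fun x hx => hx
  obtain ⟨M, c, hM, hc, H⟩ := h.exists_profile_le_exp hp hl ha
  have hF : ContinuousOn (profileFlux p t a q) (Iio t) := fun s hs =>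
    (h.hasDerivAt_profileFlux hp ha hs).continuousAt.continuousWithinAt
  have hU : ContinuousOn (profile p t a q) (Iio t) := fun s hs =>
    (h.hasDerivAt_profile hp ha hs).continuousAt.continuousWithinAt
  have hFS : ∀ s < t, profileFlux p t a q s = profileSlope p t a q s ^ (p - 1) := fun s hs => by
    rw [h.profileSlope_eq hp hs, ← Real.rpow_mul (h.profileFlux_pos hp hs).le,
      inv_mul_cancel₀ hp1.ne', Real.rpow_one]
  have hpow : ∀ x : E, ∀ r, 0 ≤ r → r ≤ M * Real.exp (c * |inner ℝ e x|) →
      r ^ (p - 1) ≤ M ^ (p - 1) * Real.exp ((c * (p - 1)) * ‖x‖) := fun x r hr hrM => by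
    have hx : |inner ℝ e x| ≤ ‖x‖ := by
      have := abs_real_inner_le_norm e x
      rwa [he, one_mul] at this
    calc r ^ (p - 1) ≤ (M * Real.exp (c * ‖x‖)) ^ (p - 1) := by
          refine Real.rpow_le_rpow hr (hrM.trans ?_) hp1.le
          gcongr
      _ = _ := by
          rw [Real.mul_rpow hM.le (Real.exp_pos _).le, ← Real.exp_mul]
          ring_nf
  have hconj : 0 < p / (p - 1) := by positivity
  have m1 : MemLp (fun x : E => profileFlux p t a q (inner ℝ e x)) (ENNReal.ofReal (p / (p - 1)))
      ((gaussMeasure E).restrict (openHalfSpace e t)) :=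
    memLp_of_norm_le_exp hconj hOm
      ((hF.comp hinner.continuousOn hmaps).aestronglyMeasurable hOm) fun x hx => by
        rw [Real.norm_of_nonneg (h.profileFlux_pos hp hx).le, hFS _ hx]
        exact hpow x _ (h.profileSlope_pos hp hx).le (H _ hx).2
  have m2 : MemLp (fun x : E => profile p t a q (inner ℝ e x) ^ (p - 1))
      (ENNReal.ofReal (p / (p - 1))) ((gaussMeasure E).restrict (openHalfSpace e t)) :=
    memLp_of_norm_le_exp hconj hOm
      (((hU.comp hinner.continuousOn hmaps).rpow_const fun x _ =>
        Or.inr hp1.le).aestronglyMeasurable hOm) fun x hx => by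
        rw [Real.norm_of_nonneg (Real.rpow_nonneg (profile_nonneg _) _)]
        exact hpow x _ (profile_nonneg _) (H _ hx).1
  obtain ⟨φ, hφ, hφl, hgl, -, -⟩ := hψ.exists_seq hp hOm
  have l1 := tendsto_integral_mul_of_eLpNorm hp m2 hψ.1.2.1 (fun n => (hφ n).memLp hp0 hOm) hφl
  have l2 := tendsto_integral_mul_of_eLpNorm hp m1 (g := fun x => inner ℝ e (Ψ x))
    (h := fun n x => inner ℝ e (gradient (φ n) x)) (hψ.1.2.2.const_inner e)
    (fun n => ((hφ n).memLp_gradient hp0 hOm).const_inner e) (by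
      refine tendsto_of_tendsto_of_tendsto_of_le_of_le tendsto_const_nhds hgl
        (fun n => zero_le) fun n => ?_
      refine eLpNorm_mono fun x => ?_
      have := norm_inner_le_norm (𝕜 := ℝ) e (Ψ x - gradient (φ n) x)
      rwa [he, one_mul, inner_sub_right] at this)
  simp only [h.weak_equation_testFunction hp hl ha he (hφ _)] at l2
  have key := tendsto_nhds_unique l2 (l1.const_mul l).neg
  have e1 : ∫ x in openHalfSpace e t, ‖(-profileSlope p t a q (inner ℝ e x)) • e‖ ^ (p - 2) *
      inner ℝ ((-profileSlope p t a q (inner ℝ e x)) • e) (Ψ x) ∂gaussMeasure E =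
      -∫ x in openHalfSpace e t, profileFlux p t a q (inner ℝ e x) * inner ℝ e (Ψ x)
        ∂gaussMeasure E := by
    rw [← integral_neg]
    refine setIntegral_congr_fun hOm fun x hx => ?_
    have hs := h.profileSlope_pos (a := a) hp hx
    rw [norm_smul, he, mul_one, norm_neg, Real.norm_of_nonneg hs.le, inner_smul_left, hFS _ hx,
      show p - 1 = p - 2 + 1 by ring, Real.rpow_add_one hs.ne']
    simp only [conj_trivial]
    ring
  rw [e1, key, neg_neg]
  congr 1
  refine setIntegral_congr_fun hOm fun x hx => ?_
  have hs : 0 < profile p t a q (inner ℝ e x) := profile_pos hx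
  rw [abs_of_pos hs, show p - 1 = p - 2 + 1 by ring, Real.rpow_add_one hs.ne']

/-- A function satisfying equality in Picone's inequality is a multiple of the profile. -/
theorem ae_eq_const_mul_profile (he : ‖e‖ = 1) {v : E → ℝ} {G : E → E}
    (hv : HasWeakGradient (openHalfSpace e t) v G)
    (hG : ∀ᵐ x ∂(gaussMeasure E).restrict (openHalfSpace e t),
      G x = -(q (inner ℝ e x) ^ (p - 1)⁻¹ * v x) • e) :
    ∃ β : ℝ, ∀ᵐ x ∂(gaussMeasure E).restrict (openHalfSpace e t),
      v x = β * profile p t a q (inner ℝ e x) := by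
  have hO := isOpen_openHalfSpace e t
  have hOm := hO.measurableSet
  have hmaps : MapsTo (fun x : E => inner ℝ e x) (openHalfSpace e t) (Iio t) := fun x hx => hx
  set U : E → ℝ := fun x => profile p t a q (inner ℝ e x) with hUdef
  have hUpos : ∀ x ∈ openHalfSpace e t, 0 < U x := fun x hx => profile_pos hx
  have hUs : ContDiffOn ℝ ∞ U (openHalfSpace e t) :=
    (h.contDiffOn_profile hp ha).comp (contDiff_const.inner ℝ contDiff_id).contDiffOn hmaps
  have hVs : ContDiffOn ℝ ∞ (fun x => (U x)⁻¹) (openHalfSpace e t) :=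
    hUs.inv fun x hx => (hUpos x hx).ne'
  have hVd : ∀ x ∈ openHalfSpace e t, ∀ w, HasLineDerivAt ℝ (fun x => (U x)⁻¹)
      (q (inner ℝ e x) ^ (p - 1)⁻¹ * inner ℝ e w * (U x)⁻¹) x w := fun x hx w => by
    have h1 := ((h.hasDerivAt_profile hp ha (hmaps hx)).inv (hUpos x hx).ne').comp_hasFDerivAt x
      (innerSL ℝ e).hasFDerivAt
    have h2 := h1.hasLineDerivAt w
    have hne : profile p t a q (inner ℝ e x) ≠ 0 := (hUpos x hx).ne'
    convert! h2 using 1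
    simp only [smul_apply, innerSL_apply_apply, smul_eq_mul, profileSlope, hUdef,
      neg_neg]
    field_simp
  have hf : LocallyIntegrableOn (fun x => v x * (U x)⁻¹) (openHalfSpace e t) :=
    hv.1.mul_continuousOn hVs.continuousOn hO.isLocallyClosed
  -- The weak gradient of v is tested with ψ/U. The derivative of 1/U contributes exactly the term
  -- that cancels G, so v/U has zero weak gradient.
  obtain ⟨β, hβ⟩ := ae_eq_const_of_weakGradient_zero he hf fun ψ hψ w => by
    have hη : IsTestFunction (openHalfSpace e t) fun x => ψ x * (U x)⁻¹ := by
      have hsub : tsupport (fun x => ψ x * (U x)⁻¹) ⊆ tsupport ψ := tsupport_mul_subset_left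
      refine ⟨contDiff_iff_contDiffAt.2 fun x => ?_,
        hψ.2.1.of_isClosed_subset (isClosed_tsupport _) hsub, hsub.trans hψ.2.2⟩
      by_cases hx : x ∈ tsupport ψ
      · exact hψ.1.contDiffAt.mul (hVs.contDiffAt (hO.mem_nhds (hψ.2.2 hx)))
      · refine contDiffAt_const (c := (0 : ℝ)) |>.congr_of_eventuallyEq ?_
        filter_upwards [(isClosed_tsupport ψ).isOpen_compl.mem_nhds hx] with y hy
        rw [hψ.eq_zero hy, zero_mul]
    obtain ⟨i1, i2, h3⟩ := hv.integral_mul_fderiv hOm hη w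
    rw [eq_neg_iff_add_eq_zero, ← integral_add i1 i2] at h3
    rw [← h3]
    refine integral_congr_ae ?_
    filter_upwards [ae_gaussMeasure_restrict_iff.1 hG, ae_restrict_mem hOm] with x hx hxm
    have hfd : fderiv ℝ (fun x => ψ x * (U x)⁻¹) x w = fderiv ℝ ψ x w * (U x)⁻¹ +
        ψ x * (q (inner ℝ e x) ^ (p - 1)⁻¹ * inner ℝ e w * (U x)⁻¹) := by
      have h4 := (hη.differentiable x).hasFDerivAt.hasLineDerivAt w
      have h5 : HasLineDerivAt ℝ (fun x => ψ x * (U x)⁻¹) (fderiv ℝ ψ x w * (U x)⁻¹ +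
        ψ x * (q (inner ℝ e x) ^ (p - 1)⁻¹ * inner ℝ e w * (U x)⁻¹)) x w := by
        have h6 := (hψ.differentiable x).hasFDerivAt.hasLineDerivAt w
        have h7 := hVd x hxm w
        unfold HasLineDerivAt at h6 h7 ⊢
        refine (h6.mul h7).congr_deriv ?_
        simp only [zero_smul, add_zero]
      exact h4.unique h5
    rw [hfd, hx, inner_smul_right, real_inner_comm w]
    ring
  refine ⟨β, ae_gaussMeasure_restrict_iff.2 ?_⟩
  filter_upwards [hβ, ae_restrict_mem hOm] with x hx hxm
  rw [← hx, inv_mul_cancel_right₀ (hUpos x hxm).ne']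

/-- A weak solution tested with itself attains equality in Picone's inequality. -/
theorem ae_eq_const_mul_profile_of_isWeakSolution (he : ‖e‖ = 1) {v : E → ℝ}
    (hv : IsWeakSolution p (openHalfSpace e t) l v) :
    ∃ β : ℝ, ∀ᵐ x ∂(gaussMeasure E).restrict (openHalfSpace e t),
      v x = β * profile p t a q (inner ℝ e x) := by
  obtain ⟨G, hG, heq⟩ := hv
  refine h.ae_eq_const_mul_profile hp hl ha he hG.1.1 ((h.picone_memW0 hp he hG).2 ?_)
  exact integral_norm_rpow_eq_of_weak hp (heq v G hG)

theorem profile_not_ae_zero (he : ‖e‖ = 1) :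
    ¬ (fun x : E => profile p t a q (inner ℝ e x))
      =ᵐ[(gaussMeasure E).restrict (openHalfSpace e t)] 0 := fun h0 => by
  have hO := isOpen_openHalfSpace e t
  have h1 : ∀ᵐ x ∂(volume : Measure E).restrict (openHalfSpace e t), False := by
    filter_upwards [ae_gaussMeasure_restrict_iff.1 h0, ae_restrict_mem hO.measurableSet]
      with x hx hxm
    exact (profile_pos (p := p) (a := a) (q := q) hxm).ne' hx
  have h2 := ae_eq_bot.1 (eventually_false_iff_eq_bot.1 h1)
  rw [Measure.restrict_eq_zero] at h2
  refine (hO.measure_pos volume ⟨(t - 1) • e, ?_⟩).ne' h2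
  rw [mem_openHalfSpace, inner_smul_right, real_inner_self_eq_norm_sq, he]
  linarith

theorem isEigenfunction_profile (he : ‖e‖ = 1) :
    IsEigenfunction p (openHalfSpace e t) l fun x => profile p t a q (inner ℝ e x) :=
  ⟨⟨_, h.memW0_profile hp hl ha he, fun _ _ hψ => h.weak_equation_profile hp hl ha he hψ⟩,
    h.profile_not_ae_zero hp hl ha he⟩

/-- Picone's inequality is the lower bound, and the profile tested with itself attains it. -/
theorem isLeast_rayleighValues (he : ‖e‖ = 1) :
    IsLeast (rayleighValues p (openHalfSpace e t)) l := by
  have hpos : ∀ w : E → ℝ, MemLp w (ENNReal.ofReal p)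
      ((gaussMeasure E).restrict (openHalfSpace e t)) →
      ¬ w =ᵐ[(gaussMeasure E).restrict (openHalfSpace e t)] 0 →
      0 < ∫ x in openHalfSpace e t, |w x| ^ p ∂gaussMeasure E := fun w hw h0 => by
    refine lt_of_le_of_ne (integral_nonneg fun x => by positivity) fun h1 => h0 ?_
    have h2 := (integral_eq_zero_iff_of_nonneg (fun x => by simp only [Pi.zero_apply]; positivity)
      (integrable_norm_rpow_of_memLp hp hw)).1 h1.symm
    filter_upwards [h2] with x hx
    simpa using (Real.rpow_eq_zero (abs_nonneg (w x)) (by linarith)).1 hx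
  constructor
  · obtain hW := h.memW0_profile hp hl ha he
    have hne := h.profile_not_ae_zero hp hl ha he
    refine ⟨_, _, hW, hne, ?_⟩
    rw [integral_norm_rpow_eq_of_weak hp (h.weak_equation_profile hp hl ha he hW), mul_div_cancel_right₀ _ (hpos _ hW.1.2.1 hne).ne']
  · rintro r ⟨w, G, hw, h0, rfl⟩
    rw [le_div_iff₀ (hpos w hw.1.2.1 h0)]
    exact (h.picone_memW0 hp he hw).1

theorem lambda1_eq (he : ‖e‖ = 1) : lambda1 p (openHalfSpace e t) = l :=
  (h.isLeast_rayleighValues hp hl ha he).csInf_eq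

end IsBlowup

end Eigenfunctions

/-! ### Continuity of the threshold and of the ground state in the endpoint -/

section ThresholdContinuity

variable {p : ℝ}

theorem inner_one_left (x : ℝ) : inner ℝ (1 : ℝ) x = x := by simp

theorem openHalfSpace_one (t : ℝ) : openHalfSpace (1 : ℝ) t = Iio t := by
  ext x; rw [mem_openHalfSpace, inner_one_left, mem_Iio]

theorem gaussDensity_real (s : ℝ) :
    gaussDensity s = (2 * Real.pi) ^ (-(1 : ℝ) / 2) * bell s := by
  simp [gaussDensity, bell]

/-- Both parameters equal the first eigenvalue of the half-line, so the endpoint of blow-up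
determines l. -/
theorem IsBlowup.eq_threshold (hp : 1 < p) {l t : ℝ} {q : ℝ → ℝ} (h : IsBlowup p l t q)
    (hl : 0 < l) : l = threshold hp t :=
  (h.lambda1_eq hp hl (sub_one_lt t) (e := (1 : ℝ)) norm_one).symm.trans
    ((isBlowup_threshold hp t).lambda1_eq hp (threshold_pos hp t) (sub_one_lt t) norm_one)

/-- With equal thresholds the same function `riccati` would tend to infinity at s and, being a
solution up to t > s, be continuous there. -/
theorem strictAnti_threshold (hp : 1 < p) : StrictAnti (threshold hp) := fun s t hst => by
  refine lt_of_le_of_ne (threshold_anti hp hst.le) fun heq => ?_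
  have h1 := (isBlowup_threshold hp s).blowup
  rw [← heq] at h1
  exact not_tendsto_nhds_of_tendsto_atTop h1 _
    (((isBlowup_threshold hp t).ode s hst).continuousAt.tendsto.mono_left nhdsWithin_le_nhds)

/-- From below: a parameter under the threshold cannot blow up at t by uniqueness, so its solution
is bounded and nearby smaller parameters survive slightly beyond t. From above: a value not
exceeding the threshold of every τ < t is admissible at t. -/
theorem continuous_threshold (hp : 1 < p) : Continuous (threshold hp) := by
  rw [continuous_iff_continuousAt]
  intro t
  refine tendsto_order.2 ⟨fun b hb => ?_, fun b hb => ?_⟩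
  · set m := max b 0
    have hm : m < threshold hp t := max_lt hb (threshold_pos hp t)
    obtain ⟨l, hml, hl⟩ := exists_between hm
    have hl0 : 0 < l := (le_max_right b 0).trans_lt hml
    have hmem := mem_admissible_of_le (threshold_mem hp t) hl0 hl.le
    obtain ⟨K, hK0, hK⟩ := (isBlowup_or_bounded hp hmem).resolve_left fun hbl =>
      hl.ne (hbl.eq_threshold hp hl0)
    filter_upwards [Iio_mem_nhds (show t < t + (l - m) / K by
      have := div_pos (sub_pos.2 hml) hK0; linarith)] with τ hτ
    rcases le_total τ t with h | h
    · exact hb.trans_le (threshold_anti hp h)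
    · have h1 : (τ - t) * K < l - m := by
        rw [← lt_div_iff₀ hK0]; rw [mem_Iio] at hτ; linarith
      have hm0 : 0 ≤ m := le_max_right b 0
      have h2 := le_threshold (mem_admissible_add hp hmem hK (sub_nonneg.2 h) (by linarith))
      rw [add_sub_cancel] at h2
      have := le_max_left b 0
      change b ≤ m at this
      linarith
  · by_cases hex : ∃ τ < t, threshold hp τ < b
    · obtain ⟨τ, hτ, hlt⟩ := hex
      filter_upwards [Ioi_mem_nhds hτ] with r hr
      exact (threshold_anti hp (show τ ≤ r from le_of_lt hr)).trans_lt hlt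
    · push Not at hex
      have hb0 : 0 < b := (threshold_pos hp t).trans hb
      refine absurd (le_threshold (hp := hp) (l := b) (t := t) ⟨hb0, fun s hs => ?_⟩) (not_le.2 hb)
      obtain ⟨τ, h1, h2⟩ := exists_between hs
      exact (mem_admissible_of_le (threshold_mem hp τ) hb0 (hex τ h2)).2 s h1

theorem riccati_mono {hp : 1 < p} {l l' s : ℝ} (h : l ≤ l') (hfin : flux hp l' s < ⊤) :
    riccati hp l s ≤ riccati hp l' s :=
  div_le_div_of_nonneg_right (ENNReal.toReal_mono hfin.ne (flux_mono h s)) (bell_pos s).le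

theorem exists_abs_riccati_sub_le (hp : 1 < p) {s t : ℝ} (hst : s < t) :
    ∃ M, 0 < M ∧ ∀ᶠ τ in 𝓝 t, ∀ r < s,
      |riccati hp (threshold hp τ) r - riccati hp (threshold hp t) r| ≤
        |threshold hp τ - threshold hp t| * M := by
  obtain ⟨M, hM0, hM⟩ := exists_riccati_lipschitz hp hst
  have h1 : Tendsto (fun τ => |threshold hp τ - threshold hp t| * M) (𝓝 t) (𝓝 0) := by
    have := (((continuous_threshold hp).sub continuous_const).abs.mul_const M).tendsto
      (f := fun τ => |threshold hp τ - threshold hp t| * M) t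
    simpa using this
  refine ⟨M, hM0, ?_⟩
  filter_upwards [h1.eventually_le_const one_pos] with τ hτ r hr
  rcases lt_trichotomy (threshold hp τ) (threshold hp t) with h | h | h
  · have h2 := mem_admissible_of_le (threshold_mem hp t) (threshold_pos hp τ) h.le
    rw [abs_of_neg (sub_neg.2 h), neg_sub] at hτ ⊢
    have h3 := (hM _ h2 _ h hτ).2 r hr
    have h4 := riccati_mono h.le ((threshold_mem hp t).2 r (hr.trans hst))
    rw [abs_sub_comm, abs_of_nonneg (sub_nonneg.2 h4)]
    linarith
  · rw [h]; simp
  · rw [abs_of_pos (sub_pos.2 h)] at hτ ⊢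
    obtain ⟨h3, h5⟩ := hM _ (threshold_mem hp t) _ h hτ
    have h4 := riccati_mono h.le (h3.2 r hr)
    rw [abs_of_nonneg (sub_nonneg.2 h4)]
    linarith [h5 r hr]

theorem tendsto_riccati (hp : 1 < p) {s t : ℝ} (hst : s < t) :
    Tendsto (fun τ => riccati hp (threshold hp τ) s) (𝓝 t)
      (𝓝 (riccati hp (threshold hp t) s)) := by
  obtain ⟨s', hs', hst'⟩ := exists_between hst
  obtain ⟨M, hM0, hM⟩ := exists_abs_riccati_sub_le hp hst'
  rw [tendsto_iff_norm_sub_tendsto_zero]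
  have h1 : Tendsto (fun τ => |threshold hp τ - threshold hp t| * M) (𝓝 t) (𝓝 0) := by
    have := (((continuous_threshold hp).sub continuous_const).abs.mul_const M).tendsto
      (f := fun τ => |threshold hp τ - threshold hp t| * M) t
    simpa using this
  refine squeeze_zero' (Eventually.of_forall fun τ => norm_nonneg _) ?_ h1
  filter_upwards [hM] with τ hτ using hτ s hs'

theorem exists_eventually_riccati_le (hp : 1 < p) {s t : ℝ} (hst : s < t) :
    ∃ K, 0 < K ∧ ∀ᶠ τ in 𝓝 t, ∀ r ≤ s, riccati hp (threshold hp τ) r ≤ K := by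
  obtain ⟨s', hs', hst'⟩ := exists_between hst
  obtain ⟨K, hK0, hK⟩ := exists_riccati_bound hp hs'
  refine ⟨K, hK0, ?_⟩
  filter_upwards [Ioi_mem_nhds hst'] with τ hτ r hr
  exact hK _ (admissible_anti hp (le_of_lt hτ) (threshold_mem hp τ)) r hr

/-- The first eigenfunction on `(-∞, τ)`, normalized by the value `1` at `a`. -/
def groundState (hp : 1 < p) (a τ : ℝ) : ℝ → ℝ := profile p τ a (riccati hp (threshold hp τ))

/-- The absolute value of the derivative of the first eigenfunction. -/
def groundSlope (hp : 1 < p) (a τ : ℝ) : ℝ → ℝ :=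
  profileSlope p τ a (riccati hp (threshold hp τ))

theorem groundState_of_le {hp : 1 < p} {a τ s : ℝ} (h : τ ≤ s) : groundState hp a τ s = 0 :=
  profile_of_le h

theorem groundSlope_of_le {hp : 1 < p} {a τ s : ℝ} (h : τ ≤ s) : groundSlope hp a τ s = 0 := by
  rw [groundSlope, profileSlope, profile_of_le h, mul_zero]

theorem groundState_nonneg (hp : 1 < p) (a τ s : ℝ) : 0 ≤ groundState hp a τ s :=
  profile_nonneg s

theorem groundSlope_nonneg (hp : 1 < p) (a τ s : ℝ) : 0 ≤ groundSlope hp a τ s :=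
  mul_nonneg (Real.rpow_nonneg (riccati_nonneg hp _ _) _) (profile_nonneg s)

/-- Normalising at a fixed point a makes the state an exponential of an integral between a and s,
over which the Riccati solutions are uniformly bounded for τ near t. -/
theorem tendsto_groundState (hp : 1 < p) {a t s : ℝ} (ha : a < t) (hs : s < t) :
    Tendsto (fun τ => groundState hp a τ s) (𝓝 t) (𝓝 (groundState hp a t s)) := by
  have hα : 0 < (p - 1)⁻¹ := inv_pos.2 (by linarith)
  obtain ⟨K, hK0, hK⟩ := exists_eventually_riccati_le hp (max_lt ha hs)
  have h1 : Tendsto (fun τ => ∫ x in a..s, riccati hp (threshold hp τ) x ^ (p - 1)⁻¹) (𝓝 t)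
      (𝓝 (∫ x in a..s, riccati hp (threshold hp t) x ^ (p - 1)⁻¹)) := by
    refine intervalIntegral.tendsto_integral_filter_of_dominated_convergence
      (fun _ => K ^ (p - 1)⁻¹) ?_ ?_ intervalIntegrable_const ?_
    · filter_upwards [Ioi_mem_nhds (max_lt ha hs)] with τ hτ
      have hc : ContinuousOn (riccati hp (threshold hp τ)) (Iio τ) := fun x hx =>
        ((isBlowup_threshold hp τ).ode x hx).continuousAt.continuousWithinAt
      exact ((hc.mono fun x hx => lt_of_le_of_lt hx.2 hτ).rpow_const fun x _ =>
        Or.inr hα.le).aestronglyMeasurable measurableSet_uIoc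
    · filter_upwards [hK] with τ hτ
      refine ae_of_all _ fun x hx => ?_
      rw [Real.norm_of_nonneg (Real.rpow_nonneg (riccati_nonneg hp _ _) _)]
      exact Real.rpow_le_rpow (riccati_nonneg hp _ _) (hτ x hx.2) hα.le
    · refine ae_of_all _ fun x hx => ?_
      exact (tendsto_riccati hp (hx.2.trans_lt (max_lt ha hs))).rpow_const (Or.inr hα.le)
  have h2 := (Real.continuous_exp.tendsto _).comp h1.neg
  have h3 : groundState hp a t s =
      Real.exp (-∫ x in a..s, riccati hp (threshold hp t) x ^ (p - 1)⁻¹) := if_pos hs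
  rw [h3]
  refine h2.congr' ?_
  filter_upwards [Ioi_mem_nhds hs] with τ hτ
  exact (if_pos hτ).symm

theorem tendsto_groundSlope (hp : 1 < p) {a t s : ℝ} (ha : a < t) (hs : s < t) :
    Tendsto (fun τ => groundSlope hp a τ s) (𝓝 t) (𝓝 (groundSlope hp a t s)) :=
  ((tendsto_riccati hp hs).rpow_const (Or.inr (inv_nonneg.2 (by linarith)))).mul
    (tendsto_groundState hp ha hs)

theorem exists_groundState_bounds (hp : 1 < p) {a t : ℝ} (ha : a < t) :
    ∃ M c, 0 < M ∧ 0 < c ∧ ∀ᶠ τ in 𝓝 t, ∀ s, groundState hp a τ s ≤ M * Real.exp (c * |s|) ∧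
      groundSlope hp a τ s ≤ M * Real.exp (c * |s|) := by
  obtain ⟨K, hK0, hK⟩ := exists_eventually_riccati_le hp ha
  obtain ⟨M, c, hM, hc, H⟩ := exists_profile_bounds hp a (t + 1) hK0 (threshold_pos hp a)
    (by linarith)
  refine ⟨M, c, hM, hc, ?_⟩
  filter_upwards [hK, Ioo_mem_nhds ha (lt_add_one t)] with τ h1 h2 s
  rcases lt_or_ge s τ with h | h
  · exact H _ _ _ (isBlowup_threshold hp τ) (threshold_pos hp τ)
      (threshold_anti hp h2.1.le) h2.1 h2.2.le h1 s h
  · rw [groundState_of_le h, groundSlope_of_le h]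
    exact ⟨by positivity, by positivity⟩

theorem measurable_of_continuousOn_Iio {f : ℝ → ℝ} {t : ℝ} (hf : ContinuousOn f (Iio t))
    (h0 : ∀ s, t ≤ s → f s = 0) : AEStronglyMeasurable f volume := by
  have h1 : (Iio t).indicator f = f := by
    ext s
    by_cases hs : s ∈ Iio t
    · rw [indicator_of_mem hs]
    · rw [indicator_of_notMem hs, h0 s (not_lt.1 hs)]
  rw [← h1, aestronglyMeasurable_indicator_iff measurableSet_Iio]
  exact hf.aestronglyMeasurable measurableSet_Iio

theorem aestronglyMeasurable_groundState (hp : 1 < p) {a τ : ℝ} (ha : a < τ) :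
    AEStronglyMeasurable (groundState hp a τ) volume :=
  measurable_of_continuousOn_Iio (fun _ hs => ((isBlowup_threshold hp τ).hasDerivAt_profile hp
    ha hs).continuousAt.continuousWithinAt) fun _ hs => groundState_of_le hs

theorem aestronglyMeasurable_groundSlope (hp : 1 < p) {a τ : ℝ} (ha : a < τ) :
    AEStronglyMeasurable (groundSlope hp a τ) volume := by
  refine measurable_of_continuousOn_Iio (t := τ) ?_ fun _ hs => groundSlope_of_le hs
  have h := isBlowup_threshold hp τ
  refine ContinuousOn.mul (ContinuousOn.rpow_const (fun x hx =>
    (h.ode x hx).continuousAt.continuousWithinAt) fun x hx => Or.inl (h.pos x hx).ne') ?_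
  exact fun _ hs => (h.hasDerivAt_profile hp ha hs).continuousAt.continuousWithinAt

end ThresholdContinuity

/-! ### Shifted Gaussian weights and their difference quotients -/

section Weights

theorem integrable_exp_abs_mul_bell (c : ℝ) : Integrable fun s => Real.exp (c * |s|) * bell s := by
  have h := integrable_exp_norm_gaussMeasure (E := ℝ) c
  rw [← integrableOn_univ, integrableOn_gaussMeasure_iff MeasurableSet.univ, integrableOn_univ] at h
  have hκ : (0 : ℝ) < (2 * Real.pi) ^ (-(1 : ℝ) / 2) := by positivity
  refine (h.const_mul ((2 * Real.pi) ^ (-(1 : ℝ) / 2))⁻¹).congr (ae_of_all _ fun s => ?_)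
  simp only [gaussDensity_real, smul_eq_mul, Real.norm_eq_abs]
  field_simp

/-- The difference quotient of the Gaussian weight. -/
def bellSlope (δ s : ℝ) : ℝ := δ⁻¹ * (bell (s + δ) - bell s)

theorem bell_add_le {s δ : ℝ} (hδ : |δ| ≤ 1) : bell (s + δ) ≤ Real.exp |s| * bell s := by
  unfold bell
  rw [← Real.exp_add, Real.exp_le_exp]
  have h1 : -(s * δ) ≤ |s| := (neg_le_abs _).trans (by
    rw [abs_mul]; exact mul_le_of_le_one_right (abs_nonneg s) hδ)
  nlinarith [sq_nonneg δ]

theorem abs_bell_add_le {s δ : ℝ} (hδ : |δ| ≤ 1) :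
    |bell (s + δ)| ≤ Real.exp (2 * |s|) * bell s := by
  rw [abs_of_pos (bell_pos _)]
  refine (bell_add_le hδ).trans (mul_le_mul_of_nonneg_right ?_ (bell_pos s).le)
  exact Real.exp_le_exp.2 (by linarith [abs_nonneg s])

/-- Mean value inequality on [s-1, s+1]: one factor exp|s| pays for shifting the weight, the other
for the factor |x| in its derivative. -/
theorem abs_bellSlope_le {s δ : ℝ} (hδ : |δ| ≤ 1) :
    |bellSlope δ s| ≤ Real.exp (2 * |s|) * bell s := by
  have hb : ∀ x ∈ Icc (s - 1) (s + 1), ‖-x * bell x‖ ≤ Real.exp (2 * |s|) * bell s := by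
    intro x hx
    have h1 : |x - s| ≤ 1 := abs_le.2 ⟨by linarith [hx.1], by linarith [hx.2]⟩
    have h2 := bell_add_le (s := s) h1
    rw [add_sub_cancel] at h2
    have h3 : |x| ≤ Real.exp |s| := by
      have h4 := abs_add_le (x - s) s
      rw [sub_add_cancel] at h4
      linarith [Real.add_one_le_exp |s|]
    rw [norm_mul, norm_neg, Real.norm_eq_abs, Real.norm_of_nonneg (bell_pos x).le]
    calc |x| * bell x ≤ Real.exp |s| * (Real.exp |s| * bell s) :=
          mul_le_mul h3 h2 (bell_pos x).le (Real.exp_pos _).le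
      _ = Real.exp (2 * |s|) * bell s := by rw [← mul_assoc, ← Real.exp_add, two_mul]
  have h1 := (convex_Icc (s - 1) (s + 1)).norm_image_sub_le_of_norm_hasDerivWithin_le
    (fun x _ => (hasDerivAt_bell x).hasDerivWithinAt) hb
    (show s ∈ Icc (s - 1) (s + 1) from ⟨by linarith, by linarith⟩)
    (show s + δ ∈ Icc (s - 1) (s + 1) from
      ⟨by linarith [(abs_le.1 hδ).1], by linarith [(abs_le.1 hδ).2]⟩)
  rw [add_sub_cancel_left, Real.norm_eq_abs, Real.norm_eq_abs] at h1
  unfold bellSlope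
  rw [abs_mul, abs_inv]
  rcases eq_or_ne δ 0 with rfl | h0
  · have := bell_pos s
    simp only [abs_zero, inv_zero, zero_mul]; positivity
  · rw [inv_mul_le_iff₀ (abs_pos.2 h0), mul_comm]
    exact h1

theorem continuous_bellSlope (δ : ℝ) : Continuous (bellSlope δ) :=
  continuous_const.mul ((continuous_bell.comp (continuous_add_const δ)).sub continuous_bell)

theorem tendsto_bellSlope (s : ℝ) :
    Tendsto (fun δ => bellSlope δ s) (𝓝[≠] 0) (𝓝 (-s * bell s)) := by
  simpa [bellSlope] using (hasDerivAt_bell s).tendsto_slope_zero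

theorem integrable_mul_weight {F g : ℝ → ℝ} {M c : ℝ} (hF : AEStronglyMeasurable F volume)
    (hFb : ∀ s, |F s| ≤ M * Real.exp (c * |s|)) (hg : Continuous g)
    (hgb : ∀ s, |g s| ≤ Real.exp (2 * |s|) * bell s) : Integrable fun s => F s * g s := by
  refine ((integrable_exp_abs_mul_bell (c + 2)).const_mul M).mono' (hF.mul hg.aestronglyMeasurable)
    (ae_of_all _ fun s => ?_)
  rw [norm_mul, Real.norm_eq_abs, Real.norm_eq_abs]
  calc |F s| * |g s| ≤ (M * Real.exp (c * |s|)) * (Real.exp (2 * |s|) * bell s) :=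
        mul_le_mul (hFb s) (hgb s) (abs_nonneg _) ((abs_nonneg _).trans (hFb s))
    _ = _ := by rw [add_mul, Real.exp_add]; ring

theorem tendsto_integral_mul_weight {ι : Type*} {L : Filter ι} [L.IsCountablyGenerated]
    {F g : ι → ℝ → ℝ} {F₀ g₀ : ℝ → ℝ} {M c : ℝ}
    (hF : ∀ᶠ i in L, AEStronglyMeasurable (F i) volume)
    (hFb : ∀ᶠ i in L, ∀ s, |F i s| ≤ M * Real.exp (c * |s|))
    (hFl : ∀ᵐ s, Tendsto (fun i => F i s) L (𝓝 (F₀ s)))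
    (hg : ∀ i, Continuous (g i)) (hgb : ∀ᶠ i in L, ∀ s, |g i s| ≤ Real.exp (2 * |s|) * bell s)
    (hgl : ∀ s, Tendsto (fun i => g i s) L (𝓝 (g₀ s))) :
    Tendsto (fun i => ∫ s, F i s * g i s) L (𝓝 (∫ s, F₀ s * g₀ s)) := by
  refine tendsto_integral_filter_of_dominated_convergence
    (fun s => M * (Real.exp ((c + 2) * |s|) * bell s)) ?_ ?_
    ((integrable_exp_abs_mul_bell (c + 2)).const_mul M) ?_
  · filter_upwards [hF] with i hi using hi.mul (hg i).aestronglyMeasurable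
  · filter_upwards [hFb, hgb] with i h1 h2
    refine ae_of_all _ fun s => ?_
    rw [norm_mul, Real.norm_eq_abs, Real.norm_eq_abs]
    calc |F i s| * |g i s| ≤ (M * Real.exp (c * |s|)) * (Real.exp (2 * |s|) * bell s) :=
          mul_le_mul (h1 s) (h2 s) (abs_nonneg _) ((abs_nonneg _).trans (h1 s))
      _ = _ := by rw [add_mul, Real.exp_add]; ring
  · filter_upwards [hFl] with s hs using hs.mul (hgl s)

end Weights

/-! ### The derivative of the threshold by translation and Pohozaev's identity -/

section ThresholdDerivative

variable {p : ℝ}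

theorem setIntegral_openHalfSpace_one {τ : ℝ} {f : ℝ → ℝ} (hf : ∀ s, τ ≤ s → f s = 0) :
    ∫ x in openHalfSpace (1 : ℝ) τ, f x ∂gaussMeasure ℝ =
      (2 * Real.pi) ^ (-(1 : ℝ) / 2) * ∫ s, f s * bell s := by
  rw [setIntegral_gaussMeasure (isOpen_openHalfSpace _ _).measurableSet, openHalfSpace_one,
    setIntegral_eq_integral_of_forall_compl_eq_zero fun x hx => by
      rw [hf x (not_lt.1 hx), smul_zero], ← integral_const_mul]
  refine integral_congr_ae (ae_of_all _ fun s => ?_)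
  simp only [gaussDensity_real, smul_eq_mul]
  ring

theorem exists_ground_le_exp (hp : 1 < p) {a t : ℝ} (ha : a < t) :
    ∃ M c, 0 < M ∧ 0 < c ∧ ∀ s, groundState hp a t s ≤ M * Real.exp (c * |s|) ∧
      groundSlope hp a t s ≤ M * Real.exp (c * |s|) := by
  obtain ⟨M, c, hM, hc, H⟩ := exists_groundState_bounds hp ha
  exact ⟨M, c, hM, hc, H.self_of_nhds⟩

/-- The translated first eigenfunction as a competitor. -/
theorem threshold_mul_le (hp : 1 < p) {a t : ℝ} (ha : a < t) (τ : ℝ) :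
    threshold hp τ * ∫ s, groundState hp a t s ^ p * bell (s + (τ - t)) ≤
      ∫ s, groundSlope hp a t s ^ p * bell (s + (τ - t)) := by
  have hp0 : p ≠ 0 := by linarith
  obtain ⟨M, c, hM, hc, H⟩ := exists_ground_le_exp hp ha
  have h := isBlowup_threshold hp t
  have hκ : (0 : ℝ) < (2 * Real.pi) ^ (-(1 : ℝ) / 2) := by positivity
  set δ := τ - t
  have hlt : ∀ s < τ, s - δ < t := fun s hs => by simp only [δ]; linarith
  have hle : ∀ s, τ ≤ s → t ≤ s - δ := fun s hs => by simp only [δ]; linarith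
  have hexp : ∀ s, M * Real.exp (c * |s - δ|) ≤
      (M * Real.exp (c * |δ|)) * Real.exp (c * |s|) := fun s => by
    rw [mul_assoc, ← Real.exp_add, ← mul_add]
    gcongr
    rw [add_comm]
    exact abs_sub _ _
  have hW := memW0_of_profile (e := (1 : ℝ)) (t := τ) (w := fun s => groundState hp a t (s - δ))
    (w' := fun s => -groundSlope hp a t (s - δ)) hp norm_one
    (fun s hs => profile_pos (hlt s hs))
    (fun s hs => (h.hasDerivAt_profile hp ha (hlt s hs)).comp_sub_const s δ)
    ((h.contDiffOn_profile hp ha).comp (contDiff_id.sub contDiff_const).contDiffOn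
      fun s hs => hlt s hs)
    ((h.tendsto_profile hp (threshold_pos hp t) ha).comp
      (tendsto_nhdsWithin_of_tendsto_nhds_of_eventually_within _ (by
        have : Tendsto (fun s => s - δ) (𝓝 τ) (𝓝 (τ - δ)) := tendsto_id.sub_const δ
        rw [sub_sub_cancel] at this
        exact this.mono_left nhdsWithin_le_nhds)
        (by filter_upwards [self_mem_nhdsWithin] with s hs using hlt s hs)))
    (M := M * Real.exp (c * |δ|)) (c := c) (by positivity) hc.le
    (fun s _ => (H (s - δ)).1.trans (hexp s))
    (fun s _ => by
      rw [abs_neg, abs_of_nonneg (groundSlope_nonneg hp a t _)]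
      exact (H (s - δ)).2.trans (hexp s))
  have hpic := ((isBlowup_threshold hp τ).picone_memW0 hp norm_one hW).1
  simp only [inner_one_left, norm_smul, norm_one, mul_one, norm_neg, Real.norm_eq_abs,
    abs_of_nonneg (groundState_nonneg hp a t _), abs_of_nonneg (groundSlope_nonneg hp a t _)]
    at hpic
  rw [setIntegral_openHalfSpace_one (f := fun s => groundState hp a t (s - δ) ^ p) fun s hs => by
      simp only [groundState_of_le (hle s hs), Real.zero_rpow hp0],
    setIntegral_openHalfSpace_one (f := fun s => groundSlope hp a t (s - δ) ^ p) fun s hs => by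
      simp only [groundSlope_of_le (hle s hs), Real.zero_rpow hp0]] at hpic
  -- A change of variables moves the translation from the eigenfunction to the smooth Gaussian
  -- weight, where it can be differentiated.
  have h1 := integral_sub_right_eq_self (μ := volume)
    (fun s => groundState hp a t s ^ p * bell (s + δ)) δ
  have h2 := integral_sub_right_eq_self (μ := volume)
    (fun s => groundSlope hp a t s ^ p * bell (s + δ)) δ
  simp only [sub_add_cancel] at h1 h2
  rw [h1, h2, mul_left_comm] at hpic
  exact le_of_mul_le_mul_left hpic hκ

theorem integral_groundSlope_rpow (hp : 1 < p) {a t : ℝ} (ha : a < t) :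
    ∫ s, groundSlope hp a t s ^ p * bell s =
      threshold hp t * ∫ s, groundState hp a t s ^ p * bell s := by
  have hp0 : p ≠ 0 := by linarith
  have h := isBlowup_threshold hp t
  have hκ : (0 : ℝ) < (2 * Real.pi) ^ (-(1 : ℝ) / 2) := by positivity
  have h1 := integral_norm_rpow_eq_of_weak hp (h.weak_equation_profile hp (threshold_pos hp t) ha
    (e := (1 : ℝ)) norm_one (h.memW0_profile hp (threshold_pos hp t) ha norm_one))
  change ∫ x in _, ‖(-groundSlope hp a t (inner ℝ 1 x)) • (1 : ℝ)‖ ^ p ∂_ =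
    _ * ∫ x in _, |groundState hp a t (inner ℝ 1 x)| ^ p ∂_ at h1
  simp only [inner_one_left, norm_smul, norm_one, mul_one, norm_neg, Real.norm_eq_abs,
    abs_of_nonneg (groundState_nonneg hp a t _), abs_of_nonneg (groundSlope_nonneg hp a t _)]
    at h1
  rw [setIntegral_openHalfSpace_one (f := fun s => groundState hp a t s ^ p) fun s hs => by
      simp only [groundState_of_le hs, Real.zero_rpow hp0],
    setIntegral_openHalfSpace_one (f := fun s => groundSlope hp a t s ^ p) fun s hs => by
      simp only [groundSlope_of_le hs, Real.zero_rpow hp0], mul_left_comm] at h1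
  exact mul_left_cancel₀ hκ.ne' h1

/-- The Lagrangian density `|u'| ^ p - λ u ^ p` of the first eigenfunction. -/
def groundGap (hp : 1 < p) (a τ s : ℝ) : ℝ :=
  groundSlope hp a τ s ^ p - threshold hp τ * groundState hp a τ s ^ p

theorem rpow_le_of_le_exp (hp : 1 < p) {r M c s : ℝ} (hr : 0 ≤ r) (hM : 0 < M)
    (h : r ≤ M * Real.exp (c * |s|)) : |r ^ p| ≤ M ^ p * Real.exp ((c * p) * |s|) := by
  rw [abs_of_nonneg (Real.rpow_nonneg hr p)]
  refine (Real.rpow_le_rpow hr h (by linarith)).trans (le_of_eq ?_)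
  rw [Real.mul_rpow hM.le (Real.exp_pos _).le, ← Real.exp_mul]
  ring_nf

theorem abs_groundGap_le (hp : 1 < p) {a τ s M c Λ : ℝ} (hM : 0 < M) (hΛ : threshold hp τ ≤ Λ)
    (h1 : groundState hp a τ s ≤ M * Real.exp (c * |s|))
    (h2 : groundSlope hp a τ s ≤ M * Real.exp (c * |s|)) :
    |groundGap hp a τ s| ≤ ((1 + Λ) * M ^ p) * Real.exp ((c * p) * |s|) := by
  have h3 := rpow_le_of_le_exp hp (groundState_nonneg hp a τ s) hM h1
  have h4 := rpow_le_of_le_exp hp (groundSlope_nonneg hp a τ s) hM h2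
  have hL := threshold_pos hp τ
  unfold groundGap
  refine (abs_sub _ _).trans ?_
  rw [abs_mul, abs_of_pos hL]
  have h5 := mul_le_mul hΛ h3 (abs_nonneg _) (hL.le.trans hΛ)
  linarith

theorem aestronglyMeasurable_groundGap (hp : 1 < p) {a τ : ℝ} (ha : a < τ) :
    AEStronglyMeasurable (groundGap hp a τ) volume :=
  (((aestronglyMeasurable_groundSlope hp ha).aemeasurable.pow_const p).sub
    (((aestronglyMeasurable_groundState hp ha).aemeasurable.pow_const p).const_mul
      _)).aestronglyMeasurable

/-- The competitor inequality minus the equality holding at zero shift. It is valid for either sign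
of τ - t, so exchanging τ and t yields the opposite bound. -/
theorem threshold_sub_mul_le (hp : 1 < p) {a t τ : ℝ} (ha : a < t) (hτ : |τ - t| ≤ 1)
    (hne : τ ≠ t) :
    (threshold hp τ - threshold hp t) * ∫ s, groundState hp a t s ^ p * bell (s + (τ - t)) ≤
      (τ - t) * ∫ s, groundGap hp a t s * bellSlope (τ - t) s := by
  obtain ⟨M, c, hM, hc, H⟩ := exists_ground_le_exp hp ha
  have hU : ∀ δ, |δ| ≤ 1 → Integrable fun s => groundState hp a t s ^ p * bell (s + δ) :=
    fun δ hδ => integrable_mul_weight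
      ((aestronglyMeasurable_groundState hp ha).aemeasurable.pow_const p).aestronglyMeasurable
      (fun s => rpow_le_of_le_exp hp (groundState_nonneg hp a t s) hM (H s).1)
      (continuous_bell.comp (continuous_add_const δ)) fun s => abs_bell_add_le hδ
  have hS : ∀ δ, |δ| ≤ 1 → Integrable fun s => groundSlope hp a t s ^ p * bell (s + δ) :=
    fun δ hδ => integrable_mul_weight
      ((aestronglyMeasurable_groundSlope hp ha).aemeasurable.pow_const p).aestronglyMeasurable
      (fun s => rpow_le_of_le_exp hp (groundSlope_nonneg hp a t s) hM (H s).2)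
      (continuous_bell.comp (continuous_add_const δ)) fun s => abs_bell_add_le hδ
  have hU0 := hU 0 (by simp)
  have hS0 := hS 0 (by simp)
  simp only [add_zero] at hU0 hS0
  have hδ : τ - t ≠ 0 := sub_ne_zero.2 hne
  have k1 : Integrable fun s => groundSlope hp a t s ^ p * bell (s + (τ - t)) -
      threshold hp t * (groundState hp a t s ^ p * bell (s + (τ - t))) :=
    (hS _ hτ).sub ((hU _ hτ).const_mul _)
  have k2 : Integrable fun s => groundSlope hp a t s ^ p * bell s -
      threshold hp t * (groundState hp a t s ^ p * bell s) := hS0.sub (hU0.const_mul _)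
  have e1 : (τ - t) * ∫ s, groundGap hp a t s * bellSlope (τ - t) s =
      ((∫ s, groundSlope hp a t s ^ p * bell (s + (τ - t))) -
        threshold hp t * ∫ s, groundState hp a t s ^ p * bell (s + (τ - t))) -
      ((∫ s, groundSlope hp a t s ^ p * bell s) -
        threshold hp t * ∫ s, groundState hp a t s ^ p * bell s) := by
    rw [← integral_const_mul, ← integral_const_mul, ← integral_const_mul,
      ← integral_sub (hS _ hτ) ((hU _ hτ).const_mul _), ← integral_sub hS0 (hU0.const_mul _),
      ← integral_sub k1 k2]
    refine integral_congr_ae (ae_of_all _ fun s => ?_)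
    simp only [groundGap, bellSlope]
    field_simp
  rw [e1, integral_groundSlope_rpow hp ha, sub_self, sub_zero, sub_mul]
  linarith [threshold_mul_le hp ha τ]

theorem integral_groundState_pos (hp : 1 < p) {a t δ : ℝ} (ha : a < t) (hδ : |δ| ≤ 1) :
    0 < ∫ s, groundState hp a t s ^ p * bell (s + δ) := by
  obtain ⟨M, c, hM, hc, H⟩ := exists_ground_le_exp hp ha
  have hi : Integrable fun s => groundState hp a t s ^ p * bell (s + δ) := integrable_mul_weight
      ((aestronglyMeasurable_groundState hp ha).aemeasurable.pow_const p).aestronglyMeasurable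
      (fun s => rpow_le_of_le_exp hp (groundState_nonneg hp a t s) hM (H s).1)
      (continuous_bell.comp (continuous_add_const δ)) fun s => abs_bell_add_le hδ
  rw [integral_pos_iff_support_of_nonneg (fun s => mul_nonneg
    (Real.rpow_nonneg (groundState_nonneg hp a t s) _) (bell_pos _).le) hi]
  refine lt_of_lt_of_le ?_ (measure_mono (s := Iio t) fun s hs => ?_)
  · simp
  · exact (mul_pos (Real.rpow_pos_of_pos (profile_pos hs) _) (bell_pos _)).ne'

/-- Pohozaev's identity. -/
theorem integral_groundGap_mul (hp : 1 < p) {a t σ : ℝ} (ha : a < t)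
    (hσ : Tendsto (groundSlope hp a t) (𝓝[<] t) (𝓝 σ)) :
    ∫ s, groundGap hp a t s * (-s * bell s) = -((p - 1) * σ ^ p * bell t) := by
  have hp0 : 0 < p := by linarith
  have hp1 : p - 1 ≠ 0 := by linarith
  have h := isBlowup_threshold hp t
  have hL := threshold_pos hp t
  obtain ⟨M, c, hM, hc, H⟩ := exists_ground_le_exp hp ha
  have hσ0 : 0 ≤ σ := ge_of_tendsto' hσ fun s => groundSlope_nonneg hp a t s
  -- The energy ((p-1)|u'|^p + λ u^p) · `bell` has derivative s · `bell` times the Lagrangian. From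
  -- t on its limit is inserted by hand, because `groundSlope` is 0 there.
  set f : ℝ → ℝ := fun s => if s < t then ((p - 1) * groundSlope hp a t s ^ p +
    threshold hp t * groundState hp a t s ^ p) * bell s else (p - 1) * σ ^ p * bell t with hf
  have hd : ∀ s < t, HasDerivAt f (groundGap hp a t s * (s * bell s)) s := by
    intro s hs
    have hu : 0 < groundState hp a t s := profile_pos hs
    have hF : 0 < profileFlux p t a (riccati hp (threshold hp t)) s := h.profileFlux_pos hp hs
    set F := profileFlux p t a (riccati hp (threshold hp t)) with hFdef
    have hSF : ∀ r < t, groundSlope hp a t r ^ p = F r ^ (1 + (p - 1)⁻¹) := fun r hr => by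
      have h1 : groundSlope hp a t r = F r ^ (p - 1)⁻¹ := h.profileSlope_eq hp hr
      rw [h1, ← Real.rpow_mul (h.profileFlux_pos hp hr).le]
      congr 1
      field_simp
      ring
    have h1 : HasDerivAt (fun r => groundSlope hp a t r ^ p)
        ((threshold hp t * groundState hp a t s ^ (p - 1) + s * F s) * (1 + (p - 1)⁻¹) *
          groundSlope hp a t s) s := by
      have h2 := (h.hasDerivAt_profileFlux hp ha hs).rpow_const (p := 1 + (p - 1)⁻¹)
        (Or.inl hF.ne')
      rw [add_sub_cancel_left, ← h.profileSlope_eq hp hs] at h2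
      refine h2.congr_of_eventuallyEq ?_
      filter_upwards [Iio_mem_nhds hs] with r hr using hSF r hr
    have h3 := (h.hasDerivAt_profile hp ha hs).rpow_const (p := p) (Or.inl hu.ne')
    have h4 := (((h1.const_mul (p - 1)).add (h3.const_mul (threshold hp t))).mul (hasDerivAt_bell s))
    have e1 : groundSlope hp a t s * F s = groundSlope hp a t s ^ p := by
      rw [hSF s hs, Real.rpow_add hF, Real.rpow_one, mul_comm]
      congr 1
      exact h.profileSlope_eq hp hs
    refine (h4.congr_of_eventuallyEq ?_).congr_deriv ?_
    · filter_upwards [Iio_mem_nhds hs] with r hr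
      simp only [hf, if_pos (show r < t from hr)]
      rfl
    · simp only [Pi.add_apply, groundGap]
      change (((p - 1) * (_ * _ * groundSlope hp a t s) + threshold hp t *
        (-groundSlope hp a t s * p * groundState hp a t s ^ (p - 1))) * bell s +
        ((p - 1) * groundSlope hp a t s ^ p + threshold hp t * groundState hp a t s ^ p) *
        (-s * bell s)) = _
      rw [← e1]
      field_simp
      ring
  have hgint : Integrable fun s => groundGap hp a t s * (s * bell s) := by
    refine (integrable_mul_weight (g := fun s => s * bell s) (aestronglyMeasurable_groundGap hp ha)
      (fun s => abs_groundGap_le hp hM le_rfl (H s).1 (H s).2) (continuous_id.mul continuous_bell)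
      fun s => ?_)
    rw [abs_mul, abs_of_pos (bell_pos s)]
    refine mul_le_mul_of_nonneg_right ?_ (bell_pos s).le
    linarith [Real.add_one_le_exp (2 * |s|), abs_nonneg s]
  have hcont : ContinuousWithinAt f (Iic t) t := by
    rw [← Iio_insert, continuousWithinAt_insert_self]
    have h1 : f t = ((p - 1) * σ ^ p + threshold hp t * 0 ^ p) * bell t := by
      simp [hf, Real.zero_rpow hp0.ne']
    unfold ContinuousWithinAt
    rw [h1]
    have h2 := (((hσ.rpow_const (p := p) (Or.inr hp0.le)).const_mul (p - 1)).add
      (((h.tendsto_profile hp hL ha).rpow_const (p := p) (Or.inr hp0.le)).const_mul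
        (threshold hp t))).mul (continuous_bell.continuousWithinAt (s := Iio t) (x := t))
    refine h2.congr' ?_
    filter_upwards [self_mem_nhdsWithin] with r hr
    simp only [hf, if_pos (show r < t from hr)]
    rfl
  have hbot : Tendsto f atBot (𝓝 0) := by
    have h1 : Tendsto (fun s : ℝ => ((p - 1) * M ^ p + threshold hp t * M ^ p) *
        (Real.exp ((c * p) * |s|) * bell s)) atBot (𝓝 0) := by
      have h2 : Tendsto (fun s : ℝ => (c * p) * |s| + -s ^ 2 / 2) atBot atBot := by
        have h3 : Tendsto (fun s : ℝ => |s| * (|s| / 2 + -(c * p))) atBot atTop :=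
          tendsto_abs_atBot_atTop.atTop_mul_atTop₀
            ((tendsto_abs_atBot_atTop.atTop_div_const two_pos).atTop_add tendsto_const_nhds)
        refine (tendsto_neg_atTop_atBot.comp h3).congr fun s => ?_
        simp only [Function.comp]
        rw [← sq_abs s]
        ring
      have h4 := (Real.tendsto_exp_atBot.comp h2).const_mul
        ((p - 1) * M ^ p + threshold hp t * M ^ p)
      rw [mul_zero] at h4
      refine h4.congr fun s => ?_
      simp only [Function.comp, Real.exp_add, bell]
    refine squeeze_zero' ?_ ?_ h1
    · filter_upwards [Iio_mem_atBot t] with s hs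
      simp only [hf, if_pos (show s < t from hs)]
      have := groundSlope_nonneg hp a t s
      have := groundState_nonneg hp a t s
      have := bell_pos s
      have : 0 < p - 1 := by linarith
      positivity
    · filter_upwards [Iio_mem_atBot t] with s hs
      simp only [hf, if_pos (show s < t from hs)]
      have h3 := (le_abs_self _).trans
        (rpow_le_of_le_exp hp (groundState_nonneg hp a t s) hM (H s).1)
      have h4 := (le_abs_self _).trans
        (rpow_le_of_le_exp hp (groundSlope_nonneg hp a t s) hM (H s).2)
      rw [← mul_assoc]
      refine mul_le_mul_of_nonneg_right ?_ (bell_pos s).le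
      have h5 := mul_le_mul_of_nonneg_left h4 (show 0 ≤ p - 1 by linarith)
      have h6 := mul_le_mul_of_nonneg_left h3 hL.le
      linarith
  have key := integral_Iic_of_hasDerivAt_of_tendsto hcont hd hgint.integrableOn hbot
  rw [setIntegral_eq_integral_of_forall_compl_eq_zero fun s hs => by
    have hs : t ≤ s := (not_le.1 hs).le
    simp [groundGap, groundState_of_le hs, groundSlope_of_le hs, Real.zero_rpow hp0.ne']] at key
  have e2 : f t = (p - 1) * σ ^ p * bell t := by simp [hf]
  rw [e2, sub_zero] at key
  rw [← key, ← integral_neg]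
  refine integral_congr_ae (ae_of_all _ fun s => ?_)
  simp only
  ring

/-- The difference quotient is squeezed between two quotients of integrals, one built on the
eigenfunction of t and one on that of τ. Dominated convergence sends both to the same limit,
evaluated by Pohozaev's identity. -/
theorem hasDerivAt_threshold (hp : 1 < p) {a t σ : ℝ} (ha : a < t)
    (hσ : Tendsto (groundSlope hp a t) (𝓝[<] t) (𝓝 σ)) :
    HasDerivAt (threshold hp)
      (-((p - 1) * σ ^ p * bell t) / ∫ s, groundState hp a t s ^ p * bell s) t := by
  have hp0 : 0 < p := by linarith
  obtain ⟨M, c, hM, hc, H⟩ := exists_groundState_bounds hp ha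
  have hH := H.self_of_nhds
  have hsub : Tendsto (fun τ => τ - t) (𝓝[≠] t) (𝓝[≠] 0) :=
    tendsto_nhdsWithin_of_tendsto_nhds_of_eventually_within _ (by
      have : Tendsto (fun τ => τ - t) (𝓝 t) (𝓝 (t - t)) := tendsto_id.sub_const t
      rw [sub_self] at this
      exact this.mono_left nhdsWithin_le_nhds)
      (by filter_upwards [self_mem_nhdsWithin] with τ hτ using sub_ne_zero.2 hτ)
  have hneg : Tendsto (fun τ => t - τ) (𝓝[≠] t) (𝓝[≠] 0) :=
    tendsto_nhdsWithin_of_tendsto_nhds_of_eventually_within _ (by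
      have : Tendsto (fun τ => t - τ) (𝓝 t) (𝓝 (t - t)) := tendsto_id.const_sub t
      rw [sub_self] at this
      exact this.mono_left nhdsWithin_le_nhds)
      (by filter_upwards [self_mem_nhdsWithin] with τ hτ using sub_ne_zero.2 (Ne.symm hτ))
  have hsmall : ∀ᶠ τ in 𝓝[≠] t, |τ - t| ≤ 1 := by
    filter_upwards [nhdsWithin_le_nhds (Metric.closedBall_mem_nhds t one_pos)] with τ hτ
    simpa [Real.dist_eq] using hτ
  -- The point s = t is discarded: the slope of the profile extended by 0 jumps there.
  have hae : ∀ᵐ s : ℝ, s ≠ t := by simp [ae_iff, measure_singleton]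
  have hstate : ∀ s, s ≠ t → Tendsto (fun τ => groundState hp a τ s) (𝓝[≠] t)
      (𝓝 (groundState hp a t s)) := fun s hs => by
    refine Tendsto.mono_left ?_ nhdsWithin_le_nhds
    rcases hs.lt_or_gt with h | h
    · exact tendsto_groundState hp ha h
    · rw [groundState_of_le h.le]
      refine tendsto_const_nhds.congr' ?_
      filter_upwards [Iio_mem_nhds h] with τ hτ using (groundState_of_le (le_of_lt hτ)).symm
  have hslope : ∀ s, s ≠ t → Tendsto (fun τ => groundSlope hp a τ s) (𝓝[≠] t)
      (𝓝 (groundSlope hp a t s)) := fun s hs => by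
    refine Tendsto.mono_left ?_ nhdsWithin_le_nhds
    rcases hs.lt_or_gt with h | h
    · exact tendsto_groundSlope hp ha h
    · rw [groundSlope_of_le h.le]
      refine tendsto_const_nhds.congr' ?_
      filter_upwards [Iio_mem_nhds h] with τ hτ using (groundSlope_of_le (le_of_lt hτ)).symm
  have hL : Tendsto (threshold hp) (𝓝[≠] t) (𝓝 (threshold hp t)) :=
    ((continuous_threshold hp).tendsto t).mono_left nhdsWithin_le_nhds
  have hbw : ∀ s, Tendsto (fun δ => bell (s + δ)) (𝓝[≠] 0) (𝓝 (bell s)) := fun s => by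
    have : Tendsto (fun δ => bell (s + δ)) (𝓝 0) (𝓝 (bell (s + 0))) :=
      (continuous_bell.comp (continuous_const_add s)).tendsto 0
    rw [add_zero] at this
    exact this.mono_left nhdsWithin_le_nhds
  have hgap : ∀ s, s ≠ t → Tendsto (fun τ => groundGap hp a τ s) (𝓝[≠] t)
      (𝓝 (groundGap hp a t s)) := fun s hs =>
    ((hslope s hs).rpow_const (Or.inr hp0.le)).sub
      (hL.mul ((hstate s hs).rpow_const (Or.inr hp0.le)))
  have hat : ∀ᶠ τ in 𝓝[≠] t, a < τ := nhdsWithin_le_nhds (Ioi_mem_nhds ha)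
  have hbound : ∀ᶠ τ in 𝓝[≠] t, ∀ s, |groundGap hp a τ s| ≤
      ((1 + threshold hp a) * M ^ p) * Real.exp ((c * p) * |s|) := by
    filter_upwards [hat, nhdsWithin_le_nhds H] with τ h1 h2 s
    exact abs_groundGap_le hp hM (threshold_anti hp h1.le) (h2 s).1 (h2 s).2
  have A1 := tendsto_integral_mul_weight (L := 𝓝[≠] t) (F := fun _ => groundGap hp a t)
    (g := fun τ => bellSlope (τ - t)) (F₀ := groundGap hp a t) (g₀ := fun s => -s * bell s)
    (Eventually.of_forall fun _ => aestronglyMeasurable_groundGap hp ha)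
    (Eventually.of_forall fun _ s => abs_groundGap_le hp hM le_rfl (hH s).1 (hH s).2)
    (ae_of_all _ fun s => tendsto_const_nhds) (fun τ => continuous_bellSlope _)
    (by filter_upwards [hsmall] with τ hτ s using abs_bellSlope_le hτ)
    (fun s => (tendsto_bellSlope s).comp hsub)
  have A2 := tendsto_integral_mul_weight (L := 𝓝[≠] t) (F := fun τ => groundGap hp a τ)
    (g := fun τ => bellSlope (t - τ)) (F₀ := groundGap hp a t) (g₀ := fun s => -s * bell s)
    (by filter_upwards [hat] with τ hτ using aestronglyMeasurable_groundGap hp hτ) hbound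
    (by filter_upwards [hae] with s hs using hgap s hs) (fun τ => continuous_bellSlope _)
    (by filter_upwards [hsmall] with τ hτ s using abs_bellSlope_le (by rwa [abs_sub_comm]))
    (fun s => (tendsto_bellSlope s).comp hneg)
  have B1 := tendsto_integral_mul_weight (L := 𝓝[≠] t) (F := fun _ s => groundState hp a t s ^ p)
    (g := fun τ s => bell (s + (τ - t))) (F₀ := fun s => groundState hp a t s ^ p) (g₀ := bell)
    (Eventually.of_forall fun _ =>
      ((aestronglyMeasurable_groundState hp ha).aemeasurable.pow_const p).aestronglyMeasurable)
    (Eventually.of_forall fun _ s =>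
      rpow_le_of_le_exp hp (groundState_nonneg hp a t s) hM (hH s).1)
    (ae_of_all _ fun s => tendsto_const_nhds)
    (fun τ => continuous_bell.comp (continuous_add_const _))
    (by filter_upwards [hsmall] with τ hτ s using abs_bell_add_le hτ)
    (fun s => (hbw s).comp hsub)
  have B2 := tendsto_integral_mul_weight (L := 𝓝[≠] t) (F := fun τ s => groundState hp a τ s ^ p)
    (g := fun τ s => bell (s + (t - τ))) (F₀ := fun s => groundState hp a t s ^ p) (g₀ := bell)
    (by
      filter_upwards [hat] with τ hτ
      exact ((aestronglyMeasurable_groundState hp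
        hτ).aemeasurable.pow_const p).aestronglyMeasurable)
    (by
      filter_upwards [nhdsWithin_le_nhds H] with τ h2 s
      exact rpow_le_of_le_exp hp (groundState_nonneg hp a τ s) hM (h2 s).1)
    (by filter_upwards [hae] with s hs using (hstate s hs).rpow_const (Or.inr hp0.le))
    (fun τ => continuous_bell.comp (continuous_add_const _))
    (by filter_upwards [hsmall] with τ hτ s using abs_bell_add_le (by rwa [abs_sub_comm]))
    (fun s => (hbw s).comp hneg)
  rw [integral_groundGap_mul hp ha hσ] at A1 A2
  have hD : 0 < ∫ s, groundState hp a t s ^ p * bell s := by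
    simpa using integral_groundState_pos hp (δ := 0) ha (by simp)
  have X := A1.div B1 hD.ne'
  have Y := A2.div B2 hD.ne'
  have X' := X.min Y
  have Y' := X.max Y
  rw [min_self] at X'
  rw [max_self] at Y'
  rw [hasDerivAt_iff_tendsto_slope]
  -- Dividing by τ - t reverses the inequalities on the left of t, so which quotient is the upper
  -- bound depends on the side; the minimum and maximum cover both.
  have hslopeb : ∀ᶠ τ in 𝓝[≠] t,
      min ((∫ s, groundGap hp a t s * bellSlope (τ - t) s) /
          ∫ s, groundState hp a t s ^ p * bell (s + (τ - t)))
        ((∫ s, groundGap hp a τ s * bellSlope (t - τ) s) /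
          ∫ s, groundState hp a τ s ^ p * bell (s + (t - τ))) ≤ slope (threshold hp) t τ ∧
      slope (threshold hp) t τ ≤
      max ((∫ s, groundGap hp a t s * bellSlope (τ - t) s) /
          ∫ s, groundState hp a t s ^ p * bell (s + (τ - t)))
        ((∫ s, groundGap hp a τ s * bellSlope (t - τ) s) /
          ∫ s, groundState hp a τ s ^ p * bell (s + (t - τ))) := by
    filter_upwards [hat, hsmall, self_mem_nhdsWithin] with τ h1 h2 h3
    have h2' : |t - τ| ≤ 1 := by rwa [abs_sub_comm]
    have h3 : τ ≠ t := h3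
    have d1 := integral_groundState_pos hp ha h2
    have d2 := integral_groundState_pos hp h1 h2'
    have k1 := threshold_sub_mul_le hp ha h2 h3
    have k2 := threshold_sub_mul_le hp h1 h2' h3.symm
    rw [slope_def_field]
    rcases h3.lt_or_gt with h | h
    · have hδ : τ - t < 0 := sub_neg.2 h
      have m1 : (∫ s, groundGap hp a t s * bellSlope (τ - t) s) /
          (∫ s, groundState hp a t s ^ p * bell (s + (τ - t))) ≤
          (threshold hp τ - threshold hp t) / (τ - t) := by
        rw [div_le_iff₀ d1, div_mul_eq_mul_div, le_div_iff_of_neg hδ]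
        linarith
      have m2 : (threshold hp τ - threshold hp t) / (τ - t) ≤
          (∫ s, groundGap hp a τ s * bellSlope (t - τ) s) /
          (∫ s, groundState hp a τ s ^ p * bell (s + (t - τ))) := by
        rw [le_div_iff₀ d2, div_mul_eq_mul_div, div_le_iff_of_neg hδ]
        linarith
      exact ⟨(min_le_left _ _).trans m1, m2.trans (le_max_right _ _)⟩
    · have hδ : 0 < τ - t := sub_pos.2 h
      have m1 : (threshold hp τ - threshold hp t) / (τ - t) ≤
          (∫ s, groundGap hp a t s * bellSlope (τ - t) s) /
          (∫ s, groundState hp a t s ^ p * bell (s + (τ - t))) := by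
        rw [le_div_iff₀ d1, div_mul_eq_mul_div, div_le_iff₀ hδ]
        linarith
      have m2 : (∫ s, groundGap hp a τ s * bellSlope (t - τ) s) /
          (∫ s, groundState hp a τ s ^ p * bell (s + (t - τ))) ≤
          (threshold hp τ - threshold hp t) / (τ - t) := by
        rw [div_le_iff₀ d2, div_mul_eq_mul_div, le_div_iff₀ hδ]
        linarith
      exact ⟨(min_le_right _ _).trans m2, m1.trans (le_max_left _ _)⟩
  exact tendsto_of_tendsto_of_tendsto_of_le_of_le' X' Y' (hslopeb.mono fun _ h => h.1)
    (hslopeb.mono fun _ h => h.2)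

end ThresholdDerivative

/-! ### Transfer to Euclidean half-spaces and the normalised derivative formula -/

section EuclideanHalfSpace

variable {N : ℕ} {p : ℝ}

theorem integral_gaussDensity_real : ∫ s : ℝ, gaussDensity s = 1 := by
  have h1 : ∫ s : ℝ, bell s = Real.sqrt (Real.pi / (1 / 2)) := by
    rw [← integral_gaussian]
    refine integral_congr_ae (ae_of_all _ fun s => ?_)
    simp only [bell]
    ring_nf
  simp only [gaussDensity_real]
  rw [integral_const_mul, h1, Real.sqrt_eq_rpow, div_div_eq_mul_div, div_one, mul_comm Real.pi,
    ← Real.rpow_add (by positivity)]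
  norm_num

theorem gaussDensity_toLp (y : Fin N → ℝ) :
    gaussDensity (WithLp.toLp 2 y : EuclideanSpace ℝ (Fin N)) = ∏ i, gaussDensity (y i) := by
  simp only [gaussDensity, Finset.prod_mul_distrib, Finset.prod_const, Finset.card_univ,
    Fintype.card_fin, finrank_euclideanSpace, EuclideanSpace.norm_sq_eq, Module.finrank_self,
    ← Real.exp_sum, Real.norm_eq_abs, sq_abs]
  congr 1
  · rw [← Real.rpow_natCast, ← Real.rpow_mul (by positivity)]
    push_cast
    ring_nf
  · rw [← Finset.sum_div, Finset.sum_neg_distrib]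

variable [NeZero N]

theorem inner_single_zero (x : EuclideanSpace ℝ (Fin N)) :
    inner ℝ (EuclideanSpace.single (0 : Fin N) (1 : ℝ)) x = x 0 := by
  simp [EuclideanSpace.inner_single_left]

theorem norm_single_zero : ‖EuclideanSpace.single (0 : Fin N) (1 : ℝ)‖ = 1 := by simp

theorem openHalfSpace_single (t : ℝ) :
    openHalfSpace (EuclideanSpace.single (0 : Fin N) (1 : ℝ)) t = halfSpace N t := by
  ext x; rw [mem_openHalfSpace, inner_single_zero]; rfl

/-- The blow-up solution knows nothing of the dimension, so the eigenvalue is the same for every N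
and for the half-line. -/
theorem lambda1_halfSpace (hp : 1 < p) (t : ℝ) : lambda1 p (halfSpace N t) = threshold hp t := by
  rw [← openHalfSpace_single]
  exact (isBlowup_threshold hp t).lambda1_eq hp (threshold_pos hp t) (sub_one_lt t)
    norm_single_zero

/-- The first marginal of the Gaussian measure is Gaussian. -/
theorem setIntegral_halfSpace {t : ℝ} {g : ℝ → ℝ} (hg : ∀ s, t ≤ s → g s = 0) :
    ∫ x in halfSpace N t, g (x 0) ∂gaussMeasure (EuclideanSpace ℝ (Fin N)) =
      (2 * Real.pi) ^ (-(1 : ℝ) / 2) * ∫ s, g s * bell s := by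
  have hm : MeasurableSet (halfSpace N t) := by
    rw [← openHalfSpace_single]; exact (isOpen_openHalfSpace _ _).measurableSet
  rw [setIntegral_gaussMeasure hm, setIntegral_eq_integral_of_forall_compl_eq_zero fun x hx => by
      rw [hg _ (not_lt.1 hx), smul_zero],
    ← (EuclideanSpace.volume_preserving_symm_measurableEquiv_toLp (Fin N)).symm.integral_comp']
  have h1 := integral_fintype_prod_volume_eq_prod (𝕜 := ℝ) (E := fun _ : Fin N => ℝ)
    fun i s => (if i = 0 then g s else 1) * gaussDensity s
  rw [Finset.prod_eq_single (0 : Fin N) (fun i _ hi => by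
    simp only [hi, if_false, one_mul, integral_gaussDensity_real]) (by simp)] at h1
  simp only [if_true, Finset.prod_mul_distrib] at h1
  rw [← integral_const_mul]
  refine Eq.trans (integral_congr_ae (ae_of_all _ fun y => ?_))
    (h1.trans (integral_congr_ae (ae_of_all _ fun s => ?_)))
  · change gaussDensity (WithLp.toLp 2 y : EuclideanSpace ℝ (Fin N)) • g (y 0) = _
    rw [gaussDensity_toLp, smul_eq_mul, mul_comm, Finset.prod_ite_eq' _ 0]
    simp
  · simp only [gaussDensity_real]
    ring

theorem exists_eigenfunction_halfSpace (hp : 1 < p) (t : ℝ) :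
    IsLeast (rayleighValues p (halfSpace N t)) (lambda1 p (halfSpace N t)) ∧
    ∃ u₁ : ℝ → ℝ, ContinuousOn u₁ (Iic t) ∧ (∀ s < t, 0 < u₁ s) ∧
      IsEigenfunction p (halfSpace N t) (lambda1 p (halfSpace N t)) (fun x => u₁ (x 0)) ∧
      IsEigenfunction p (Iio t) (lambda1 p (halfSpace N t)) u₁ ∧
      (∀ u : EuclideanSpace ℝ (Fin N) → ℝ,
        IsWeakSolution p (halfSpace N t) (lambda1 p (halfSpace N t)) u →
        ∃ β : ℝ, ∀ᵐ x ∂(gaussMeasure (EuclideanSpace ℝ (Fin N))).restrict (halfSpace N t),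
          u x = β * u₁ (x 0)) ∧
      (∀ u : ℝ → ℝ, IsWeakSolution p (Iio t) (lambda1 p (halfSpace N t)) u →
        ∃ β : ℝ, ∀ᵐ s ∂(gaussMeasure ℝ).restrict (Iio t), u s = β * u₁ s) := by
  have h := isBlowup_threshold hp t
  have hL := threshold_pos hp t
  have ha := sub_one_lt t
  rw [lambda1_halfSpace hp, ← openHalfSpace_single, ← openHalfSpace_one]
  refine ⟨h.isLeast_rayleighValues hp hL ha norm_single_zero, groundState hp (t - 1) t,
    h.continuousOn_profile hp hL ha, fun s hs => profile_pos hs, ?_, ?_, fun u hu => ?_,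
    fun u hu => ?_⟩
  · simpa only [inner_single_zero] using!
      h.isEigenfunction_profile hp hL ha (norm_single_zero (N := N))
  · simpa only [inner_one_left] using!
      h.isEigenfunction_profile hp hL ha (e := (1 : ℝ)) norm_one
  · simpa only [inner_single_zero] using!
      h.ae_eq_const_mul_profile_of_isWeakSolution hp hL ha norm_single_zero hu
  · simpa only [inner_one_left] using!
      h.ae_eq_const_mul_profile_of_isWeakSolution hp hL ha norm_one hu

/-- Positive first eigenfunctions depending only on the first coordinate are multiples of the
ground state. -/
theorem exists_eq_const_mul_groundState (hp : 1 < p) {t : ℝ} {u : ℝ → ℝ}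
    (hu : ContinuousOn u (Iic t)) (hpos : ∀ s < t, 0 < u s)
    (hw : IsWeakSolution p (halfSpace N t) (lambda1 p (halfSpace N t)) fun x => u (x 0)) :
    ∃ β, 0 < β ∧ EqOn u (fun s => β * groundState hp (t - 1) t s) (Iic t) := by
  have h := isBlowup_threshold hp t
  have hL := threshold_pos hp t
  have ha := sub_one_lt t
  rw [lambda1_halfSpace hp, ← openHalfSpace_single] at hw
  obtain ⟨β, hβ⟩ := h.ae_eq_const_mul_profile_of_isWeakSolution hp hL ha norm_single_zero hw
  have hU : ContinuousOn (fun s => β * groundState hp (t - 1) t s) (Iic t) :=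
    continuousOn_const.mul (h.continuousOn_profile hp hL ha)
  have hmaps : MapsTo (fun x : EuclideanSpace ℝ (Fin N) => x 0)
      (openHalfSpace (EuclideanSpace.single (0 : Fin N) (1 : ℝ)) t) (Iic t) := fun x hx => by
    rw [mem_openHalfSpace, inner_single_zero] at hx; exact hx.le
  have hcoord : Continuous fun x : EuclideanSpace ℝ (Fin N) => x 0 := by fun_prop
  simp only [inner_single_zero] at hβ
  have h1 := Measure.eqOn_open_of_ae_eq (ae_gaussMeasure_restrict_iff.1 hβ)
    (isOpen_openHalfSpace _ _) (hu.comp hcoord.continuousOn hmaps)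
    (hU.comp hcoord.continuousOn hmaps)
  have h2 : EqOn u (fun s => β * groundState hp (t - 1) t s) (Iio t) := fun s hs => by
    have := h1 (x := EuclideanSpace.single 0 s) (by
      rw [mem_openHalfSpace, inner_single_zero]; simpa using hs)
    simpa using! this
  refine ⟨β, ?_, h2.of_subset_closure hu hU Iio_subset_Iic_self (by rw [closure_Iio])⟩
  have h3 := h2 (show t - 1 ∈ Iio t from ha)
  have h4 := hpos _ ha
  rw [h3] at h4
  exact pos_of_mul_pos_left h4 (groundState_nonneg hp _ _ _)

/-- By simplicity and continuity u is β times the ground state with β > 0. The first marginal of the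
Gaussian measure turns the normalisation into a formula for β^p, which replaces the denominator of
the threshold derivative, and u'(t) = -βσ. -/
theorem hasDerivAt_lambda1_halfSpace (hp : 1 < p) {t : ℝ} {u : ℝ → ℝ}
    (hu : ContinuousOn u (Iic t)) (hpos : ∀ s < t, 0 < u s)
    (hw : IsWeakSolution p (halfSpace N t) (lambda1 p (halfSpace N t)) fun x => u (x 0))
    (hnorm : eLpNorm (fun x : EuclideanSpace ℝ (Fin N) => u (x 0)) (ENNReal.ofReal p)
      ((gaussMeasure (EuclideanSpace ℝ (Fin N))).restrict (halfSpace N t)) = 1) :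
    ContDiffOn ℝ 1 u (Iic t) ∧
      HasDerivAt (fun s : ℝ => lambda1 p (halfSpace N s))
        (-(p - 1) * |derivWithin u (Iic t) t| ^ p * gaussDensity t) t := by
  have hp0 : 0 < p := by linarith
  have h := isBlowup_threshold hp t
  have hL := threshold_pos hp t
  have ha := sub_one_lt t
  obtain ⟨β, hβ, heq⟩ := exists_eq_const_mul_groundState hp hu hpos hw
  obtain ⟨σ, hσ, hlim, hder, hC1⟩ := h.exists_boundary_slope hp hL ha
  refine ⟨(contDiffOn_const.mul hC1).congr heq, ?_⟩
  have hd : derivWithin u (Iic t) t = β * -σ :=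
    ((hder.const_mul β).congr heq (heq self_mem_Iic)).derivWithin
      (uniqueDiffOn_Iic t t self_mem_Iic)
  have hmain := hasDerivAt_threshold hp ha hlim
  simp only [lambda1_halfSpace hp]
  have hnorm1 : β ^ p * ((2 * Real.pi) ^ (-(1 : ℝ) / 2) *
      ∫ s, groundState hp (t - 1) t s ^ p * bell s) = 1 := by
    have hmem : MemLp (fun x : EuclideanSpace ℝ (Fin N) => β * groundState hp (t - 1) t (x 0))
        (ENNReal.ofReal p)
        ((gaussMeasure (EuclideanSpace ℝ (Fin N))).restrict (halfSpace N t)) := by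
      have := (h.memW0_profile hp hL ha (norm_single_zero (N := N))).1.2.1.const_mul β
      simpa only [inner_single_zero, openHalfSpace_single] using! this
    have hm : MeasurableSet (halfSpace N t) := by
      rw [← openHalfSpace_single]; exact (isOpen_openHalfSpace _ _).measurableSet
    rw [eLpNorm_congr_ae (g := fun x => β * groundState hp (t - 1) t (x 0)) (by
        filter_upwards [ae_restrict_mem hm] with x hx using heq (show x 0 ≤ t from le_of_lt hx)),
      hmem.eLpNorm_eq_integral_rpow_norm (by simpa using hp0) ENNReal.ofReal_ne_top,
      ENNReal.ofReal_eq_one, ENNReal.toReal_ofReal hp0.le] at hnorm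
    replace hnorm := (Real.rpow_left_inj (integral_nonneg fun x => by positivity) zero_le_one
      (inv_ne_zero hp0.ne')).1 (hnorm.trans (Real.one_rpow p⁻¹).symm)
    simp only [Real.norm_eq_abs, abs_mul, abs_of_pos hβ,
      abs_of_nonneg (groundState_nonneg hp _ _ _),
      Real.mul_rpow hβ.le (groundState_nonneg hp _ _ _)] at hnorm
    rw [integral_const_mul, setIntegral_halfSpace (g := fun s => groundState hp (t - 1) t s ^ p)
      fun s hs => by simp only [groundState_of_le hs, Real.zero_rpow hp0.ne']] at hnorm
    exact hnorm
  refine hmain.congr_deriv ?_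
  have hI : (∫ s, groundState hp (t - 1) t s ^ p * bell s) ≠ 0 := fun h0 => by
    rw [h0, mul_zero, mul_zero] at hnorm1; exact zero_ne_one hnorm1
  rw [hd, abs_mul, abs_neg, abs_of_pos hβ, abs_of_pos hσ, Real.mul_rpow hβ.le hσ.le,
    gaussDensity_real, div_eq_iff hI]
  linear_combination ((p - 1) * σ ^ p * bell t) * hnorm1

end EuclideanHalfSpace

end GaussP
end

theorem mainTheorem9 (N : ℕ) [NeZero N] (p : ℝ) (hp : 1 < p) :
    -- existence of a positive first eigenfunction depending only on `x_1`, and simplicity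
    (∀ t : ℝ,
      IsLeast (rayleighValues p (halfSpace N t)) (lambda1 p (halfSpace N t)) ∧
      ∃ u₁ : ℝ → ℝ, ContinuousOn u₁ (Iic t) ∧ (∀ s < t, 0 < u₁ s) ∧
        -- as an eigenfunction in the half-space, and of the one-dimensional problem
        IsEigenfunction p (halfSpace N t) (lambda1 p (halfSpace N t)) (fun x => u₁ (x 0)) ∧
        IsEigenfunction p (Iio t) (lambda1 p (halfSpace N t)) u₁ ∧
        (∀ u : EuclideanSpace ℝ (Fin N) → ℝ,
          IsWeakSolution p (halfSpace N t) (lambda1 p (halfSpace N t)) u →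
          ∃ β : ℝ, ∀ᵐ x ∂(gaussMeasure (EuclideanSpace ℝ (Fin N))).restrict (halfSpace N t),
            u x = β * u₁ (x 0)) ∧
        (∀ u : ℝ → ℝ, IsWeakSolution p (Iio t) (lambda1 p (halfSpace N t)) u →
          ∃ β : ℝ, ∀ᵐ s ∂(gaussMeasure ℝ).restrict (Iio t), u s = β * u₁ s)) ∧
    -- monotonicity
    StrictAnti (fun t : ℝ => lambda1 p (halfSpace N t)) ∧
    -- differentiation formula for the (continuous) positive normalized eigenfunction
    (∀ (t : ℝ) (u : ℝ → ℝ), ContinuousOn u (Iic t) → (∀ s < t, 0 < u s) →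
      IsEigenfunction p (halfSpace N t) (lambda1 p (halfSpace N t)) (fun x => u (x 0)) →
      eLpNorm (fun x : EuclideanSpace ℝ (Fin N) => u (x 0)) (ENNReal.ofReal p)
        ((gaussMeasure (EuclideanSpace ℝ (Fin N))).restrict (halfSpace N t)) = 1 →
      ContDiffOn ℝ 1 u (Iic t) ∧
        HasDerivAt (fun s : ℝ => lambda1 p (halfSpace N s))
          (-(p - 1) * |derivWithin u (Iic t) t| ^ p * gaussDensity t) t) :=
  ⟨fun t => exists_eigenfunction_halfSpace hp t, fun s t hst => by
    simpa only [lambda1_halfSpace hp] using strictAnti_threshold hp hst,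
    fun _ _ hu hpos hw hnorm => hasDerivAt_lambda1_halfSpace hp hu hpos hw.1 hnorm⟩
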